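/- Let $\Omega\subset\mathbb R^n$ ($n\ge 1$) be a bounded, connected, open set with Lipschitz boundary, $\sigma$ the $(n-1)$-dimensional Hausdorff measure on $\partial\Omega$, $\mathbf n$ the exterior unit normal, $Y\subseteq\mathbb R^m$, $Z\subseteq\mathbb R^{m\times n}$, $p\in[1,\infty]$, and $I$ an arbitrary index set. Let $L,A_i,B_i,C_i:\Omega\times Y\times Z\to\mathbb R$ and $L_\partial,A_{\partial,i},B_{\partial,i},C_{\partial,i}:\partial\Omega\times Y\to\mathbb R$ ($i\in I$) be functions, with $L,C_i,L_\partial,C_{\partial,i}$ Borel measurable. Integrals of these functions take values in $[-\infty,+\infty]$ and are $+\infty$ whenever the positive part has infinite integral; likewise $(+\infty)+(-\infty)=+\infty$. *Original problem.* $M$ is the infimum of $\int_\Omega L(x,y,Dy)\,dx+\int_{\partial\Omega}L_\partial(x,y)\,d\sigma$ over all $y\in W^{1,p}(\Omega;\mathbb R^m)$ (boundary values are traces) with $y\in Y$, $Dy\in Z$ a.e. in $\Omega$ and $y\in Y$ $\sigma$-a.e. on $\partial\Omega$, such that for a.e. $x\in\Omega$, $A_i(x,y,Dy)=0$ and $B_i(x,y,Dy)\le0$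 for all $i$; for $\sigma$-a.e. $x\in\partial\Omega$, $A_{\partial,i}(x,y)=0$ and $B_{\partial,i}(x,y)\le 0$ for all $i$; and $\int_\Omega C_i(x,y,Dy)\,dx\le0$, $\int_{\partial\Omega}C_{\partial,i}(x,y)\,d\sigma\le0$ for all $i$. *Relaxations.* $\mathcal O_p^{\rm aff}$ is the set of pairs $(\mu,\mu_\partial)$ of finite positive Borel measures carried by $\overline\Omega\times Y\times Z$ and $\partial\Omega\times Y$, respectively, such that $\mu$ has total mass $|\Omega|$; the supports (in the ambient Euclidean spaces) are compact if $p=\infty$, and $\int_{\Omega\times Y\times Z}\|y\|^p+\sum_j\|z_j\|^p\,d\mu<\infty$, $\int\|y\|^p\,d\mu_\partial<\infty$ if $p<\infty$ (where $z_j$ are the columns of $z$); the normal $\mathbf n(x)$ exists for $\mu_\partial$-a.e. $(x,y)$; and for all $\phi_1\in C^\infty(\mathbb R^n;\mathbb R)$, $\phi_2\in C^\infty(\mathbb R^n;\mathbb R^m)$, $$\int_{\Omega\times Y\times Z}\Big[\tfrac{\partial\phi_1}{\partial x}+y^\top\tfrac{\partial\phi_2}{\partial x}+\phi_2^\top z\Big]d\mu=\int_{\partial\Omega\times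 Y}(\phi_1+y^\top\phi_2)\,\mathbf n\,d\mu_\partial .$$ $\mathcal O_p\subseteq\mathcal O_p^{\rm aff}$ is the subset of pairs with $\int_{\Omega\times Y\times Z}\frac{\partial\phi}{\partial x}+\frac{\partial\phi}{\partial y}z\,d\mu=\int_{\partial\Omega\times Y}\phi\,\mathbf n\,d\mu_\partial$ for all $\phi\in C^\infty(\mathbb R^n\times\mathbb R^m)$ for which, if $p<\infty$, there is $c>0$ with $\|\frac{\partial\phi}{\partial x}\|\le c(1+\|y\|^p)$, $\|\frac{\partial\phi}{\partial y}\|\le c(1+\|y\|^{p-1})$, $|\phi|\le c(1+\|y\|^p)$ on $\Omega\times Y$. $M_{\rm r}^{\rm aff}$ and $M_{\rm r}$ are the infima of $\int L\,d\mu+\int L_\partial\,d\mu_\partial$ over the pairs in $\mathcal O_p^{\rm aff}$, respectively $\mathcal O_p$, such that $\mu$ is carried by $\{(x,y,z)\in\Omega\times Y\times Z: A_i=0,\ B_i\le0\ \forall i\}$, $\mu_\partial$ is carried by $\{(x,y)\in\partial\Omega\times Y: A_{\partial,i}=0,\ B_{\partial,i}\le0\ \forall i\}$, and $\int C_i\,d\mu\le0$,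 $\int C_{\partial,i}\,d\mu_\partial\le0$ for all $i$. *Underestimators.* Let $\hat Y\supseteq Y$, $\hat Z\supseteq Z$ be convex, let $\hat L,\hat B_i,\hat C_i:\Omega\times\hat Y\times\hat Z\to\mathbb R$ be convex in $(y,z)$ and $\hat L_\partial,\hat B_{\partial,i},\hat C_{\partial,i}:\partial\Omega\times\hat Y\to\mathbb R$ convex in $y$, with $\hat L,\hat C_i,\hat L_\partial,\hat C_{\partial,i}$ Borel measurable, such that $\hat L\le L$, $\hat B_i\le B_i$, $\hat C_i\le C_i$ at all $(x,y,z)\in\Omega\times Y\times Z$ with $A_j=0,\ B_j\le0$ for all $j$, and $\hat L_\partial\le L_\partial$, $\hat B_{\partial,i}\le B_{\partial,i}$, $\hat C_{\partial,i}\le C_{\partial,i}$ at all $(x,y)\in\partial\Omega\times Y$ with $A_{\partial,j}=0,\ B_{\partial,j}\le0$ for all $j$. Let $A_i$ and $A_{\partial,i}$ be defined also on $\Omega\times\hat Y\times\hat Z$ and $\partial\Omega\times\hat Y$, and let $M_{\rm under}$ be the infimum of the original problem with $Y,Z,L,B_i,C_i,L_\partial,B_{\partial,i},C_{\partial,i}$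 replaced by $\hat Y,\hat Z,\hat L,\hat B_i,\hat C_i,\hat L_\partial,\hat B_{\partial,i},\hat C_{\partial,i}$. **Statement.** Suppose that $A_i(x,\cdot,\cdot)$ is affine on $\hat Y\times\hat Z$ for every $x\in\Omega$ and $A_{\partial,i}(x,\cdot)$ is affine on $\hat Y$ for every $x\in\partial\Omega$, $i\in I$. Then $$M_{\rm under}\le M_{\rm r}^{\rm aff}\le M_{\rm r}\le M.$$ In particular, if $M_{\rm under}=M$, then $M_{\rm r}^{\rm aff}=M_{\rm r}=M$. -/

import Mathlib

open MeasureTheory Set Filter Topology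
open scoped ENNReal ContDiff

noncomputable section

namespace OccMeas

/-- Euclidean space `ℝᵈ`. -/
abbrev Vec (d : ℕ) : Type := EuclideanSpace ℝ (Fin d)

/-- The space `ℝ^{m×n}` of `m × n` matrices, a matrix `z = (z₁, …, zₙ)` being the list of its `n`
columns `z_j ∈ ℝᵐ`. The `j`-th column of `Dy` is the partial derivative `∂y/∂x_j`. -/
abbrev Mat (m n : ℕ) : Type := Fin n → EuclideanSpace ℝ (Fin m)

/-- The `j`-th partial derivative of a function on `ℝⁿ`. -/
def pderiv {n : ℕ} {F : Type*} [NormedAddCommGroup F] [NormedSpace ℝ F]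
    (j : Fin n) (f : Vec n → F) (x : Vec n) : F :=
  fderiv ℝ f x (EuclideanSpace.single j 1)

/-! ### Extended integrals -/

/-- The integral of a real function with values in `[-∞, +∞]`: the difference of the integrals of
the positive and the negative part, with the convention of minimization that it is `+∞` as soon as
the positive part has infinite integral. -/
def extIntegral {α : Type*} [MeasurableSpace α] (μ : Measure α) (f : α → ℝ) : EReal :=
  if ∫⁻ a, ENNReal.ofReal (f a) ∂μ = ⊤ then ⊤
  else ((∫⁻ a, ENNReal.ofReal (f a) ∂μ : ℝ≥0∞) : EReal)
    - ((∫⁻ a, ENNReal.ofReal (-f a) ∂μ : ℝ≥0∞) : EReal)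

/-- For integrable functions the extended integral is the usual integral. -/
theorem extIntegral_eq_integral {α : Type*} [MeasurableSpace α] {μ : Measure α} {f : α → ℝ}
    (hf : Integrable f μ) : extIntegral μ f = ((∫ a, f a ∂μ : ℝ) : EReal) := by
  have h1 : ∫⁻ a, ENNReal.ofReal (f a) ∂μ ≠ ⊤ := hf.lintegral_lt_top.ne
  have h2 : ∫⁻ a, ENNReal.ofReal (-f a) ∂μ ≠ ⊤ := hf.neg.lintegral_lt_top.ne
  rw [extIntegral, if_neg h1, integral_eq_lintegral_pos_part_sub_lintegral_neg_part hf,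
    EReal.coe_sub, ← EReal.coe_ennreal_toReal h1, ← EReal.coe_ennreal_toReal h2]

/-- Addition on `[-∞, +∞]` with the convention of minimization `(+∞) + (-∞) = +∞`. -/
def addTop (a b : EReal) : EReal := by
  classical exact if a = ⊤ ∨ b = ⊤ then ⊤ else a + b

/-! ### The domain, its surface measure and its exterior normal -/

/-- `Ω` has Lipschitz boundary: near each boundary point and for a suitable unit vector `e`, the set
`Ω` is the part strictly above the graph of a Lipschitz function `g` of the coordinates orthogonal
to `e` (that is, of a Lipschitz function on `ℝⁿ` which is constant along `e`). -/
def HasLipschitzBoundary {n : ℕ} (Ω : Set (Vec n)) : Prop :=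
  ∀ x₀ ∈ frontier Ω, ∃ e : Vec n, ‖e‖ = 1 ∧ ∃ K : NNReal, ∃ g : Vec n → ℝ,
    LipschitzWith K g ∧ (∀ (x : Vec n) (s : ℝ), g (x + s • e) = g x) ∧
    ∃ r > 0, ∀ x ∈ Metric.ball x₀ r, (x ∈ Ω ↔ g x < inner ℝ x e)

/-- The `(n-1)`-dimensional Hausdorff measure (normalized as surface area) on `∂Ω`. -/
def surfaceMeasure {n : ℕ} (Ω : Set (Vec n)) : Measure (Vec n) :=
  (Measure.euclideanHausdorffMeasure (n - 1)).restrict (frontier Ω)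

/-- `ν` is the exterior unit normal of `Ω` at `x`: up to first order at `x`, the set `Ω` is the
half-space `{w | ⟨w - x, ν⟩ < 0}`. -/
def IsExteriorNormal {n : ℕ} (Ω : Set (Vec n)) (x ν : Vec n) : Prop :=
  ‖ν‖ = 1 ∧ ∀ ε > 0, ∃ δ > 0, ∀ w ∈ Metric.ball x δ,
    (ε * ‖w - x‖ < inner ℝ (w - x) ν → w ∉ Ω) ∧
    (inner ℝ (w - x) ν < -(ε * ‖w - x‖) → w ∈ Ω)

/-- There is at most one exterior unit normal at a point. -/
theorem IsExteriorNormal.unique {n : ℕ} {Ω : Set (Vec n)} {x ν ν' : Vec n}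
    (h : IsExteriorNormal Ω x ν) (h' : IsExteriorNormal Ω x ν') : ν = ν' := by
  by_contra hne
  obtain ⟨h1, h2⟩ := h
  obtain ⟨h1', h2'⟩ := h'
  set d := ν - ν' with hd
  have hd0 : 0 < ‖d‖ := norm_pos_iff.mpr (sub_ne_zero.mpr hne)
  have hsq : ‖d‖ ^ 2 = 2 - 2 * inner ℝ ν ν' := by
    rw [hd, norm_sub_sq_real, h1, h1']; ring
  have e1 : inner ℝ d ν = ‖d‖ ^ 2 / 2 := by
    rw [hsq, hd, inner_sub_left, real_inner_self_eq_norm_sq, h1, real_inner_comm]; ring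
  have e2 : inner ℝ d ν' = -(‖d‖ ^ 2 / 2) := by
    rw [hsq, hd, inner_sub_left, real_inner_self_eq_norm_sq, h1']; ring
  obtain ⟨δ, hδ, H⟩ := h2 (‖d‖ / 4) (by positivity)
  obtain ⟨δ', hδ', H'⟩ := h2' (‖d‖ / 4) (by positivity)
  set s := min δ δ' / (2 * ‖d‖) with hs
  have hm : 0 < min δ δ' := lt_min hδ hδ'
  have hs0 : 0 < s := by positivity
  have hsd : s * ‖d‖ = min δ δ' / 2 := by rw [hs]; field_simp
  have hdist : dist (x + s • d) x < min δ δ' := by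
    rw [dist_eq_norm, add_sub_cancel_left, norm_smul, Real.norm_of_nonneg hs0.le, hsd]; linarith
  have k1 := (H (x + s • d) (lt_of_lt_of_le hdist (min_le_left _ _))).1
  have k2 := (H' (x + s • d) (lt_of_lt_of_le hdist (min_le_right _ _))).2
  rw [add_sub_cancel_left, norm_smul, Real.norm_of_nonneg hs0.le, real_inner_smul_left] at k1 k2
  rw [e1] at k1
  rw [e2] at k2
  have hp : 0 < s * ‖d‖ ^ 2 := by positivity
  exact k1 (by nlinarith) (k2 (by nlinarith))

/-- The exterior unit normal `𝐧(x)` of `Ω` (with the dummy value `0` where there is none). -/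
def exteriorNormal {n : ℕ} (Ω : Set (Vec n)) (x : Vec n) : Vec n := by
  classical exact if h : ∃ ν, IsExteriorNormal Ω x ν then h.choose else 0

theorem IsExteriorNormal.exteriorNormal_eq {n : ℕ} {Ω : Set (Vec n)} {x ν : Vec n}
    (h : IsExteriorNormal Ω x ν) : exteriorNormal Ω x = ν := by
  have h' : ∃ ν, IsExteriorNormal Ω x ν := ⟨ν, h⟩
  rw [exteriorNormal, dif_pos h']
  exact h'.choose_spec.unique h

/-! ### Sobolev functions and their traces -/

/-- `G` is the weak derivative of `y` in `Ω`. -/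
def IsWeakDeriv {n m : ℕ} (Ω : Set (Vec n)) (y : Vec n → Vec m) (G : Vec n → Mat m n) : Prop :=
  ∀ ψ : Vec n → ℝ, ContDiff ℝ ∞ ψ → HasCompactSupport ψ → tsupport ψ ⊆ Ω →
    ∀ j : Fin n, ∫ x in Ω, pderiv j ψ x • y x = -∫ x in Ω, ψ x • G x j

/-- `y ∈ W^{1,p}(Ω; ℝᵐ)` with weak derivative `Dy = G`. -/
structure IsSobolev {n m : ℕ} (Ω : Set (Vec n)) (p : ℝ≥0∞)
    (y : Vec n → Vec m) (G : Vec n → Mat m n) : Prop where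
  memLp : MemLp y p (volume.restrict Ω)
  memLp_deriv : MemLp G p (volume.restrict Ω)
  weakDeriv : IsWeakDeriv Ω y G

/-- `t` is the trace on `∂Ω` of the Sobolev function `y` with weak derivative `G`. The trace operator
is the continuous extension to `W^{1,1}(Ω) → L¹(∂Ω)` of the restriction of functions smooth up to
the boundary, and `W^{1,p}(Ω) ⊆ W^{1,1}(Ω)` for bounded `Ω`. -/
def IsTrace {n m : ℕ} (Ω : Set (Vec n)) (y : Vec n → Vec m) (G : Vec n → Mat m n)
    (t : Vec n → Vec m) : Prop :=
  AEStronglyMeasurable t (surfaceMeasure Ω) ∧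
  ∃ u : ℕ → Vec n → Vec m, (∀ k, ContDiff ℝ ∞ (u k)) ∧
    Tendsto (fun k => eLpNorm (fun x => u k x - y x) 1 (volume.restrict Ω)) atTop (𝓝 0) ∧
    (∀ j : Fin n, Tendsto
      (fun k => eLpNorm (fun x => pderiv j (u k) x - G x j) 1 (volume.restrict Ω)) atTop (𝓝 0)) ∧
    Tendsto (fun k => eLpNorm (fun x => u k x - t x) 1 (surfaceMeasure Ω)) atTop (𝓝 0)

/-! ### The variational problem -/

/-- The data of a problem of the calculus of variations: the sets `Y`, `Z`, the Lagrangian densities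
`L` (bulk) and `Lb` (boundary), the pointwise constraint functions `A i`, `B i` (bulk) and `Ab i`,
`Bb i` (boundary), and the integral constraint functions `C i` (bulk) and `Cb i` (boundary).
Only the values on `Ω × Y × Z`, respectively `∂Ω × Y`, are relevant. -/
structure VarData (n m : ℕ) (I : Type*) where
  Y : Set (Vec m)
  Z : Set (Mat m n)
  L : Vec n → Vec m → Mat m n → ℝ
  A : I → Vec n → Vec m → Mat m n → ℝ
  B : I → Vec n → Vec m → Mat m n → ℝ
  C : I → Vec n → Vec m → Mat m n → ℝ
  Lb : Vec n → Vec m → ℝ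
  Ab : I → Vec n → Vec m → ℝ
  Bb : I → Vec n → Vec m → ℝ
  Cb : I → Vec n → Vec m → ℝ

namespace VarData

variable {n m : ℕ} {I : Type*}

/-- The bulk phase space `Ω × Y × Z`. -/
def bulk (P : VarData n m I) (Ω : Set (Vec n)) : Set (Vec n × Vec m × Mat m n) :=
  Ω ×ˢ P.Y ×ˢ P.Z

/-- The boundary phase space `∂Ω × Y`. -/
def bdry (P : VarData n m I) (Ω : Set (Vec n)) : Set (Vec n × Vec m) :=
  frontier Ω ×ˢ P.Y

/-- The integrands occurring in the problem are Borel functions on `Ω × Y × Z`, respectively on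
`∂Ω × Y`. -/
structure MeasurableIntegrands (P : VarData n m I) (Ω : Set (Vec n)) : Prop where
  L : Measurable ((P.bulk Ω).domRestrict fun w => P.L w.1 w.2.1 w.2.2)
  C : ∀ i, Measurable ((P.bulk Ω).domRestrict fun w => P.C i w.1 w.2.1 w.2.2)
  Lb : Measurable ((P.bdry Ω).domRestrict fun w => P.Lb w.1 w.2)
  Cb : ∀ i, Measurable ((P.bdry Ω).domRestrict fun w => P.Cb i w.1 w.2)

/-- The pointwise bulk constraints at `(x, y, z)`. -/
def Admissible (P : VarData n m I) (x : Vec n) (y : Vec m) (z : Mat m n) : Prop :=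
  ∀ i, P.A i x y z = 0 ∧ P.B i x y z ≤ 0

/-- The pointwise boundary constraints at `(x, y)`. -/
def AdmissibleBdry (P : VarData n m I) (x : Vec n) (y : Vec m) : Prop :=
  ∀ i, P.Ab i x y = 0 ∧ P.Bb i x y ≤ 0

/-- `y ∈ W^{1,p}(Ω; Y)`, with weak derivative `G` taking values in `Z` and with trace `t`, satisfies
all constraints of the variational problem. -/
structure Feasible (P : VarData n m I) (Ω : Set (Vec n)) (p : ℝ≥0∞)
    (y : Vec n → Vec m) (G : Vec n → Mat m n) (t : Vec n → Vec m) : Prop where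
  sobolev : IsSobolev Ω p y G
  trace : IsTrace Ω y G t
  mem_bulk : ∀ᵐ x ∂(volume.restrict Ω), y x ∈ P.Y ∧ G x ∈ P.Z
  mem_bdry : ∀ᵐ x ∂(surfaceMeasure Ω), t x ∈ P.Y
  bulk : ∀ᵐ x ∂(volume.restrict Ω), P.Admissible x (y x) (G x)
  bdry : ∀ᵐ x ∂(surfaceMeasure Ω), P.AdmissibleBdry x (t x)
  integral_bulk : ∀ i, extIntegral (volume.restrict Ω) (fun x => P.C i x (y x) (G x)) ≤ 0
  integral_bdry : ∀ i, extIntegral (surfaceMeasure Ω) (fun x => P.Cb i x (t x)) ≤ 0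

/-- The objective `∫_Ω L(x, y, Dy) dx + ∫_{∂Ω} L_∂(x, y) dσ`. -/
def cost (P : VarData n m I) (Ω : Set (Vec n))
    (y : Vec n → Vec m) (G : Vec n → Mat m n) (t : Vec n → Vec m) : EReal :=
  addTop (extIntegral (volume.restrict Ω) fun x => P.L x (y x) (G x))
    (extIntegral (surfaceMeasure Ω) fun x => P.Lb x (t x))

/-- The infimum of the variational problem over `W^{1,p}(Ω; Y)`. -/
def classicalValue (P : VarData n m I) (Ω : Set (Vec n)) (p : ℝ≥0∞) : EReal :=
  ⨅ (y : Vec n → Vec m) (G : Vec n → Mat m n) (t : Vec n → Vec m)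
    (_ : P.Feasible Ω p y G t), P.cost Ω y G t

/-! ### Occupation measures -/

/-- `(μ, μb)` is a pair of affinely relaxed occupation measures (on `closure Ω × Y × Z` and on
`∂Ω × Y`). The right-hand side of the Liouville equation presupposes that the exterior normal
is defined `μb`-almost everywhere. -/
structure IsAffOccupation (P : VarData n m I) (Ω : Set (Vec n)) (p : ℝ≥0∞)
    (μ : Measure (Vec n × Vec m × Mat m n)) (μb : Measure (Vec n × Vec m)) : Prop where
  finite_bulk : IsFiniteMeasure μ
  finite_bdry : IsFiniteMeasure μb
  conc_bulk : ∀ᵐ w ∂μ, w.1 ∈ closure Ω ∧ w.2.1 ∈ P.Y ∧ w.2.2 ∈ P.Z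
  conc_bdry : ∀ᵐ w ∂μb, w.1 ∈ frontier Ω ∧ w.2 ∈ P.Y
  mass : μ univ = volume Ω
  compact_support : p = ⊤ → IsCompact μ.support ∧ IsCompact μb.support
  moment : p ≠ ⊤ →
    (∫⁻ w in {w | w.1 ∈ Ω}, (‖w.2.1‖ₑ ^ p.toReal + ∑ j, ‖w.2.2 j‖ₑ ^ p.toReal) ∂μ < ⊤) ∧
    ∫⁻ w, ‖w.2‖ₑ ^ p.toReal ∂μb < ⊤
  normal : ∀ᵐ w ∂μb, ∃ ν, IsExteriorNormal Ω w.1 ν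
  liouville : ∀ (φ₁ : Vec n → ℝ) (φ₂ : Vec n → Vec m), ContDiff ℝ ∞ φ₁ → ContDiff ℝ ∞ φ₂ →
    ∀ j : Fin n,
      ∫ w in {w | w.1 ∈ Ω},
        (pderiv j φ₁ w.1 + inner ℝ w.2.1 (pderiv j φ₂ w.1) + inner ℝ (φ₂ w.1) (w.2.2 j)) ∂μ
      = ∫ w, (φ₁ w.1 + inner ℝ w.2 (φ₂ w.1)) * exteriorNormal Ω w.1 j ∂μb

/-- The class `𝐅_p` of test functions. -/
def IsTest (P : VarData n m I) (Ω : Set (Vec n)) (p : ℝ≥0∞) (φ : Vec n × Vec m → ℝ) : Prop :=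
  ContDiff ℝ ∞ φ ∧ (p ≠ ⊤ → ∃ c > 0, ∀ x ∈ Ω, ∀ y ∈ P.Y,
    ‖fderiv ℝ (fun x' => φ (x', y)) x‖ ≤ c * (1 + ‖y‖ ^ p.toReal) ∧
    ‖fderiv ℝ (fun y' => φ (x, y')) y‖ ≤ c * (1 + ‖y‖ ^ (p.toReal - 1)) ∧
    |φ (x, y)| ≤ c * (1 + ‖y‖ ^ p.toReal))

/-- `(μ, μb)` is a pair of relaxed occupation measures. -/
structure IsOccupation (P : VarData n m I) (Ω : Set (Vec n)) (p : ℝ≥0∞)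
    (μ : Measure (Vec n × Vec m × Mat m n)) (μb : Measure (Vec n × Vec m)) : Prop
    extends P.IsAffOccupation Ω p μ μb where
  liouville_full : ∀ φ : Vec n × Vec m → ℝ, P.IsTest Ω p φ → ∀ j : Fin n,
      ∫ w in {w | w.1 ∈ Ω},
        (pderiv j (fun x' => φ (x', w.2.1)) w.1
          + fderiv ℝ (fun y' => φ (w.1, y')) w.2.1 (w.2.2 j)) ∂μ
      = ∫ w, φ w * exteriorNormal Ω w.1 j ∂μb

/-- The constraints of the relaxed problems. The two support conditions say that the measures are
carried by the constraint sets; for relatively closed constraint sets (in particular for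
continuous `A i`, `B i`) this is the inclusion of the supports, see `carried_iff_support`. -/
structure RelaxedConstraints (P : VarData n m I) (Ω : Set (Vec n))
    (μ : Measure (Vec n × Vec m × Mat m n)) (μb : Measure (Vec n × Vec m)) : Prop where
  bulk : ∀ᵐ w ∂μ, w ∈ P.bulk Ω ∧ P.Admissible w.1 w.2.1 w.2.2
  bdry : ∀ᵐ w ∂μb, w ∈ P.bdry Ω ∧ P.AdmissibleBdry w.1 w.2
  integral_bulk : ∀ i,
    extIntegral (μ.restrict {w | w.1 ∈ Ω}) (fun w => P.C i w.1 w.2.1 w.2.2) ≤ 0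
  integral_bdry : ∀ i, extIntegral μb (fun w => P.Cb i w.1 w.2) ≤ 0

/-- The objective `∫ L dμ + ∫ L_∂ dμb`. -/
def relaxedCost (P : VarData n m I) (Ω : Set (Vec n))
    (μ : Measure (Vec n × Vec m × Mat m n)) (μb : Measure (Vec n × Vec m)) : EReal :=
  addTop (extIntegral (μ.restrict {w | w.1 ∈ Ω}) fun w => P.L w.1 w.2.1 w.2.2)
    (extIntegral μb fun w => P.Lb w.1 w.2)

/-- The infimum over affinely relaxed occupation measures. -/
def affRelaxedValue (P : VarData n m I) (Ω : Set (Vec n)) (p : ℝ≥0∞) : EReal :=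
  ⨅ (μ : Measure (Vec n × Vec m × Mat m n)) (μb : Measure (Vec n × Vec m))
    (_ : P.IsAffOccupation Ω p μ μb ∧ P.RelaxedConstraints Ω μ μb), P.relaxedCost Ω μ μb

/-- The infimum over relaxed occupation measures. -/
def relaxedValue (P : VarData n m I) (Ω : Set (Vec n)) (p : ℝ≥0∞) : EReal :=
  ⨅ (μ : Measure (Vec n × Vec m × Mat m n)) (μb : Measure (Vec n × Vec m))
    (_ : P.IsOccupation Ω p μ μb ∧ P.RelaxedConstraints Ω μ μb), P.relaxedCost Ω μ μb

/-! ### Convex underestimators -/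

/-- `Q` is obtained from `P` by enlarging `Y`, `Z` to convex sets and replacing
`L, B i, C i, L_∂, B_∂ i, C_∂ i` by convex functions which on the admissible points of `P` are
underestimators. The functions `A i`, `A_∂ i` are kept. -/
structure IsConvexUnderestimator (Q P : VarData n m I) (Ω : Set (Vec n)) : Prop where
  subset_Y : P.Y ⊆ Q.Y
  subset_Z : P.Z ⊆ Q.Z
  convex_Y : Convex ℝ Q.Y
  convex_Z : Convex ℝ Q.Z
  A_eq : Q.A = P.A
  Ab_eq : Q.Ab = P.Ab
  convex_L : ∀ x ∈ Ω, ConvexOn ℝ (Q.Y ×ˢ Q.Z) fun q => Q.L x q.1 q.2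
  convex_B : ∀ i, ∀ x ∈ Ω, ConvexOn ℝ (Q.Y ×ˢ Q.Z) fun q => Q.B i x q.1 q.2
  convex_C : ∀ i, ∀ x ∈ Ω, ConvexOn ℝ (Q.Y ×ˢ Q.Z) fun q => Q.C i x q.1 q.2
  convex_Lb : ∀ x ∈ frontier Ω, ConvexOn ℝ Q.Y (Q.Lb x)
  convex_Bb : ∀ i, ∀ x ∈ frontier Ω, ConvexOn ℝ Q.Y (Q.Bb i x)
  convex_Cb : ∀ i, ∀ x ∈ frontier Ω, ConvexOn ℝ Q.Y (Q.Cb i x)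
  le_bulk : ∀ x ∈ Ω, ∀ y ∈ P.Y, ∀ z ∈ P.Z, P.Admissible x y z →
    Q.L x y z ≤ P.L x y z ∧ ∀ i, Q.B i x y z ≤ P.B i x y z ∧ Q.C i x y z ≤ P.C i x y z
  le_bdry : ∀ x ∈ frontier Ω, ∀ y ∈ P.Y, P.AdmissibleBdry x y →
    Q.Lb x y ≤ P.Lb x y ∧ ∀ i, Q.Bb i x y ≤ P.Bb i x y ∧ Q.Cb i x y ≤ P.Cb i x y

end VarData

/-- If `S` is relatively closed in `U` and `μ` is a measure on `U`, then `μ` is carried by `S` if and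
only if its support as a measure on `U` is contained in `S`. -/
theorem carried_iff_support {X : Type*} [TopologicalSpace X] [SecondCountableTopology X]
    [MeasurableSpace X] (μ : Measure X) {U F : Set X} (hF : IsClosed F) (hU : ∀ᵐ w ∂μ, w ∈ U) :
    (∀ᵐ w ∂μ, w ∈ U ∩ F) ↔ μ.support ∩ U ⊆ U ∩ F := by
  constructor
  · rintro h x ⟨hx, hxU⟩
    refine ⟨hxU, Measure.support_subset_of_isClosed hF ?_ hx⟩
    filter_upwards [h] with w hw using hw.2
  · intro h
    filter_upwards [hU, (Measure.support_mem_ae : μ.support ∈ ae μ)] with w h1 h2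
    exact h ⟨h2, h1⟩

end OccMeas

end

/-! The two inequalities on the right say that relaxing enlarges the admissible set. A feasible `y`
with weak derivative `G` and trace `t` gives the push-forward of Lebesgue measure on `Ω` under `x ↦
(x, y x, G x)` and that of surface measure under `x ↦ (x, t x)`. All costs and constraints keep
their values, and the Liouville equation becomes the Gauss-Green formula for `x ↦ φ (x, y x)`.

For the left inequality, let `(μ, μb)` be admissible for the affine relaxation. Testing with `φ₁`
alone involves only the first marginals. Test functions supported in `Ω` do not see `μb`, so the
first marginal of `μ` has vanishing derivatives in `Ω`. As `Ω` is connected, that marginal is a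
multiple of Lebesgue measure, and the prescribed mass makes the factor one. Comparison with
Gauss-Green then shows that the first marginal of `μb` is surface measure, because the unit normal
never vanishes. Both measures can therefore be disintegrated over `Ω` and `∂Ω`, and the conditional
means define `y`, `G` and `t`. The test functions `φ₂` enter linearly in `y` and `z`, so the
Liouville equation passes to the means and becomes a Gauss-Green formula for `(y, G, t)`. It forces
`G` to be the weak derivative of `y` and `t` to be its trace. Jensen's inequality gives the rest:
the means stay in the convex sets cut out by affine equations and convex inequalities, and the
convex underestimators evaluated at the means integrate to at most the original integrands.

Three bodies of analysis carry this. The Gauss-Green formula on a Lipschitz domain comes from the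
area formula for Lipschitz graphs (`IsGraphMap.map_withDensity`), the flattening of a graph
(`IsFrame.integral_fderiv_above`) and a partition of unity (`gauss_green`). It extends to `Φ (x, y
x)` for Sobolev `y` (`integral_totalD`), where a vector field transversal to the boundary controls
the growth of traces (`lintegral_trace_lt_top`). The identification of `t` with the trace
(`IsGreenTriple.isTrace`) uses density of smooth functions up to the boundary
(`exists_contDiff_approx`) and the trace inequality (`exists_trace_le`). Finally, `Y`, `Z` and the
constraint sets need be neither closed nor measurable, so barycenters and Jensen's inequality are
proved for arbitrary convex sets (`integral_mem_of_convex`), and push-forwards are shown to be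
carried by arbitrary sets (`ae_map_of_ae`). -/

noncomputable section

namespace OccMeas

/-! ### The area formula for Lipschitz graphs -/

/-- If the distances of `f` on `A` are at most `C` times those of `g`, the Hausdorff measure of
`f '' A` is at most `C ^ d` times the one of `g '' A`. -/
theorem euclideanHausdorffMeasure_image_le_of_dist_le {W X Y : Type*} [MetricSpace X]
    [MeasurableSpace X] [BorelSpace X] [MetricSpace Y] [MeasurableSpace Y] [BorelSpace Y]
    (f : W → Y) (g : W → X) (A : Set W) (C : NNReal) (d : ℕ)
    (h : ∀ w ∈ A, ∀ w' ∈ A, dist (f w) (f w') ≤ C * dist (g w) (g w')) :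
    Measure.euclideanHausdorffMeasure d (f '' A)
      ≤ (C : ℝ≥0∞) ^ d * Measure.euclideanHausdorffMeasure d (g '' A) := by
  rcases A.eq_empty_or_nonempty with rfl | ⟨a₀, ha₀⟩
  · simp
  have : Nonempty W := ⟨a₀⟩
  -- `g` need not be injective on `A`, but the hypothesis makes `f` constant on its fibres there. So
  -- `f` after a section of `g` is `C`-Lipschitz on `g '' A` and still covers `f '' A`.
  set r := Function.invFunOn g A
  have hr : ∀ x ∈ g '' A, r x ∈ A ∧ g (r x) = x := fun x hx => Function.invFunOn_pos hx
  have hL : LipschitzOnWith C (f ∘ r) (g '' A) := by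
    refine LipschitzOnWith.of_dist_le_mul fun x hx y hy => ?_
    have := h _ (hr x hx).1 _ (hr y hy).1
    rwa [(hr x hx).2, (hr y hy).2] at this
  have himg : f '' A ⊆ (f ∘ r) '' (g '' A) := by
    rintro _ ⟨w, hw, rfl⟩
    refine ⟨g w, ⟨w, hw, rfl⟩, ?_⟩
    have hm := hr (g w) ⟨w, hw, rfl⟩
    have := h _ hm.1 _ hw
    rw [hm.2, dist_self, mul_zero] at this
    exact dist_le_zero.mp this
  rw [Measure.euclideanHausdorffMeasure_def, Measure.euclideanHausdorffMeasure_def,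
    Measure.smul_apply, Measure.smul_apply, mul_smul_comm]
  have := (measure_mono himg).trans (hL.hausdorffMeasure_image_le (d := d) (Nat.cast_nonneg d))
  rw [ENNReal.rpow_natCast] at this
  gcongr

/-- A linear map whose norm is the one of the graph of the linear form `⟨a, ·⟩`. -/
def graphShear {k : ℕ} (a : Vec k) : Vec k →ₗ[ℝ] Vec k :=
  LinearMap.transvection ((1 / (1 + √(1 + ‖a‖ ^ 2))) • (innerₛₗ ℝ a)) a

/-- `graphShear a` is the positive square root of `1 + a aᵀ`: with `s² = 1 + ‖a‖²`, the coefficient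
`c = 1 / (1 + s)` solves `2 c + c² ‖a‖² = 1`. -/
theorem norm_graphShear_sq {k : ℕ} (a w : Vec k) :
    ‖graphShear a w‖ ^ 2 = ‖w‖ ^ 2 + inner ℝ a w ^ 2 := by
  have hs : √(1 + ‖a‖ ^ 2) ^ 2 = 1 + ‖a‖ ^ 2 := Real.sq_sqrt (by positivity)
  have hs0 : 0 ≤ √(1 + ‖a‖ ^ 2) := Real.sqrt_nonneg _
  set s := √(1 + ‖a‖ ^ 2)
  have e : graphShear a w = w + (1 / (1 + s) * inner ℝ a w) • a := by
    simp [graphShear, LinearMap.transvection.apply, s]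
  rw [e, norm_add_sq_real, norm_smul, mul_pow, Real.norm_eq_abs, sq_abs, inner_smul_right,
    real_inner_comm]
  have h1 : 1 + s ≠ 0 := by positivity
  field_simp
  have : ‖a‖ ^ 2 = s ^ 2 - 1 := by linarith
  rw [this]; ring

/-- A transvection has determinant `1 + c ‖a‖² = 1 + (s² - 1) / (1 + s) = s`. This is the area
factor of a graph of slope `a`, so an affine graph can be replaced by a linear map of `ℝᵏ` with the
same metric and a computable volume factor. -/
theorem det_graphShear {k : ℕ} (a : Vec k) :
    LinearMap.det (graphShear a) = √(1 + ‖a‖ ^ 2) := by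
  have hs : √(1 + ‖a‖ ^ 2) ^ 2 = 1 + ‖a‖ ^ 2 := Real.sq_sqrt (by positivity)
  have hs0 : 0 ≤ √(1 + ‖a‖ ^ 2) := Real.sqrt_nonneg _
  rw [graphShear, LinearMap.transvection.det]
  set s := √(1 + ‖a‖ ^ 2)
  simp only [LinearMap.smul_apply, innerₛₗ_apply_apply, real_inner_self_eq_norm_sq, smul_eq_mul]
  have h1 : 1 + s ≠ 0 := by positivity
  field_simp
  linarith

/-- `F` behaves metrically like the graph map of `h`. -/
def IsGraphMap {k N : ℕ} (h : Vec k → ℝ) (F : Vec k → Vec N) : Prop :=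
  ∀ w w', ‖F w - F w'‖ ^ 2 = ‖w - w'‖ ^ 2 + (h w - h w') ^ 2

/-- The area density of the graph of `h`. -/
def areaDensity {k : ℕ} (h : Vec k → ℝ) (w : Vec k) : ℝ := √(1 + ‖fderiv ℝ h w‖ ^ 2)

/-- With `P`, `q` the two lengths and `t`, `b` the increments of `h` and of its affine model, `P² -
q² = t² - b² = (t - b)(t + b)`. As `|t + b| ≤ P + q`, this gives `|P - q| ≤ |t - b|`, which is at
most `ε ‖w - w'‖ ≤ ε q`. -/
theorem IsGraphMap.dist_graphShear {k N : ℕ} {h : Vec k → ℝ} {F : Vec k → Vec N}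
    (hF : IsGraphMap h F) {a : Vec k} {ε : ℝ} (hε : 0 ≤ ε) {w w' : Vec k}
    (hw : |h w - h w' - inner ℝ a (w - w')| ≤ ε * ‖w - w'‖) :
    ‖F w - F w'‖ ≤ (1 + ε) * ‖graphShear a w - graphShear a w'‖ ∧
    (1 - ε) * ‖graphShear a w - graphShear a w'‖ ≤ ‖F w - F w'‖ := by
  rw [← map_sub]
  set d := w - w'
  set q := ‖graphShear a d‖
  have hq : q ^ 2 = ‖d‖ ^ 2 + inner ℝ a d ^ 2 := norm_graphShear_sq a d
  have hp := hF w w'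
  set P := ‖F w - F w'‖
  have hq0 : 0 ≤ q := norm_nonneg _
  have hP0 : 0 ≤ P := norm_nonneg _
  have hd0 : 0 ≤ ‖d‖ := norm_nonneg _
  set t := h w - h w'
  set b : ℝ := inner ℝ a d
  have hdq : ‖d‖ ≤ q := by nlinarith [sq_nonneg b]
  have hbq : |b| ≤ q := abs_le_of_sq_le_sq (by nlinarith) hq0
  have hdP : ‖d‖ ≤ P := by nlinarith [sq_nonneg t]
  have htP : |t| ≤ P := abs_le_of_sq_le_sq (by nlinarith) hP0
  have key : |P - q| ≤ ε * ‖d‖ := by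
    rcases eq_or_lt_of_le (add_nonneg hP0 hq0) with h0 | h0
    · have h1 : P = 0 := by linarith
      have h2 : q = 0 := by linarith
      rw [h1, h2]; simp; positivity
    have h1 : (P - q) * (P + q) = (t - b) * (t + b) := by nlinarith
    have h2 : |t + b| ≤ P + q := (abs_add_le _ _).trans (add_le_add htP hbq)
    have h3 : |P - q| * (P + q) ≤ ε * ‖d‖ * (P + q) := by
      calc |P - q| * (P + q) = |(P - q) * (P + q)| := by rw [abs_mul, abs_of_pos h0]
        _ = |t - b| * |t + b| := by rw [h1, abs_mul]
        _ ≤ ε * ‖d‖ * (P + q) := mul_le_mul hw h2 (abs_nonneg _) (by positivity)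
    exact le_of_mul_le_mul_right h3 h0
  have h4 := abs_le.mp key
  have h5 : ε * ‖d‖ ≤ ε * q := by gcongr
  constructor <;> nlinarith

theorem abs_sqrt_one_add_sq_sub_le (a b : ℝ) : |√(1 + a ^ 2) - √(1 + b ^ 2)| ≤ |a - b| := by
  have ha : √(1 + a ^ 2) ^ 2 = 1 + a ^ 2 := Real.sq_sqrt (by positivity)
  have hb : √(1 + b ^ 2) ^ 2 = 1 + b ^ 2 := Real.sq_sqrt (by positivity)
  have ha1 : |a| ≤ √(1 + a ^ 2) := Real.abs_le_sqrt (by linarith)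
  have hb1 : |b| ≤ √(1 + b ^ 2) := Real.abs_le_sqrt (by linarith)
  have hap : 0 < √(1 + a ^ 2) := Real.sqrt_pos.mpr (by positivity)
  have hbp : 0 < √(1 + b ^ 2) := Real.sqrt_pos.mpr (by positivity)
  set x := √(1 + a ^ 2)
  set y := √(1 + b ^ 2)
  have h1 : (x - y) * (x + y) = (a - b) * (a + b) := by nlinarith
  have h3 : |x - y| * (x + y) ≤ |a - b| * (x + y) := by
    calc |x - y| * (x + y) = |(x - y) * (x + y)| := by
          rw [abs_mul, abs_of_pos (by positivity : 0 < x + y)]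
      _ = |a - b| * |a + b| := by rw [h1, abs_mul]
      _ ≤ |a - b| * (x + y) := by
        gcongr; exact (abs_add_le _ _).trans (add_le_add ha1 hb1)
  exact le_of_mul_le_mul_right h3 (by positivity)

theorem one_le_areaDensity {k : ℕ} (h : Vec k → ℝ) (w : Vec k) : 1 ≤ areaDensity h w :=
  Real.one_le_sqrt.mpr (by nlinarith [sq_nonneg ‖fderiv ℝ h w‖])

theorem measurable_areaDensity {k : ℕ} (h : Vec k → ℝ) : Measurable (areaDensity h) := by
  unfold areaDensity
  have := measurable_fderiv ℝ h
  fun_prop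

/-- On a set where `h` is nearly affine with slope `a`, the area of the graph is nearly
`√(1 + |a|²)` times the volume of the set. -/
theorem IsGraphMap.area_bounds {k N : ℕ} {h : Vec k → ℝ} {F : Vec k → Vec N}
    (hF : IsGraphMap h F) {a : Vec k} {ε : NNReal} {A : Set (Vec k)}
    (hA : ∀ w ∈ A, ∀ w' ∈ A, |h w - h w' - inner ℝ a (w - w')| ≤ ε * ‖w - w'‖) :
    Measure.euclideanHausdorffMeasure k (F '' A)
      ≤ ((1 + ε : NNReal) : ℝ≥0∞) ^ k * (ENNReal.ofReal √(1 + ‖a‖ ^ 2) * volume A) ∧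
    (ε < 1 → ENNReal.ofReal √(1 + ‖a‖ ^ 2) * volume A
      ≤ (((1 - ε)⁻¹ : NNReal) : ℝ≥0∞) ^ k * Measure.euclideanHausdorffMeasure k (F '' A)) := by
  -- The model set lies in `ℝᵏ` itself, where `k`-dimensional Hausdorff measure is Lebesgue measure
  -- and the determinant gives its size.
  have hvol : Measure.euclideanHausdorffMeasure k (graphShear a '' A)
      = ENNReal.ofReal √(1 + ‖a‖ ^ 2) * volume A := by
    rw [EuclideanSpace.euclideanHausdorffMeasure_eq_volume, Measure.addHaar_image_linearMap,
      det_graphShear, abs_of_nonneg (Real.sqrt_nonneg _)]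
  rw [← hvol]
  constructor
  · refine euclideanHausdorffMeasure_image_le_of_dist_le F (graphShear a) A (1 + ε) k ?_
    intro w hw w' hw'
    rw [dist_eq_norm, dist_eq_norm]
    simpa using (hF.dist_graphShear ε.2 (hA w hw w' hw')).1
  · intro hε
    refine euclideanHausdorffMeasure_image_le_of_dist_le (graphShear a) F A (1 - ε)⁻¹ k ?_
    intro w hw w' hw'
    rw [dist_eq_norm, dist_eq_norm]
    have h1 := (hF.dist_graphShear ε.2 (hA w hw w' hw')).2
    have h2 : (0 : ℝ) < 1 - ε := by
      have : (ε : ℝ) < 1 := by exact_mod_cast hε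
      linarith
    rw [NNReal.coe_inv, NNReal.coe_sub hε.le, NNReal.coe_one, inv_mul_eq_div, le_div_iff₀ h2]
    change (1 - (ε : ℝ)) * _ ≤ _ at h1
    linarith

/-- Making the cover disjoint reduces the comparison to pieces. Local estimates with multiplicative
errors then add up without loss. -/
theorem measure_le_of_countable_cover {X : Type*} [MeasurableSpace X] {ν ρ : Measure X}
    {B : ℕ → Set X} (hB : ∀ i, MeasurableSet (B i)) (hcov : ν (⋃ i, B i)ᶜ = 0)
    (h : ∀ i, ∀ A ⊆ B i, MeasurableSet A → ν A ≤ ρ A) : ν ≤ ρ := by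
  refine Measure.le_iff.mpr fun A hA => ?_
  calc ν A = ν (A ∩ ⋃ i, B i) := by
        refine (measure_inter_conull hcov).symm
    _ = ν (⋃ i, A ∩ disjointed B i) := by rw [← iUnion_disjointed, inter_iUnion]
    _ ≤ ∑' i, ν (A ∩ disjointed B i) := measure_iUnion_le _
    _ ≤ ∑' i, ρ (A ∩ disjointed B i) := ENNReal.tsum_le_tsum fun i =>
        h i _ (inter_subset_right.trans (disjointed_subset B i))
          (hA.inter (MeasurableSet.disjointed hB i))
    _ = ρ (⋃ i, A ∩ disjointed B i) := by
        refine (measure_iUnion ?_ fun i => hA.inter (MeasurableSet.disjointed hB i)).symm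
        exact fun i j hij => (disjoint_disjointed B hij).mono inter_subset_right inter_subset_right
    _ ≤ ρ A := measure_mono (iUnion_subset fun i => inter_subset_left)

theorem IsGraphMap.dist_le {k N : ℕ} {h : Vec k → ℝ} {F : Vec k → Vec N} (hF : IsGraphMap h F)
    (w w' : Vec k) : dist w w' ≤ dist (F w) (F w') := by
  rw [dist_eq_norm, dist_eq_norm]
  refine abs_le_of_sq_le_sq' ?_ (norm_nonneg _) |>.2
  rw [hF]; nlinarith [sq_nonneg (h w - h w')]

theorem IsGraphMap.lipschitz {k N : ℕ} {h : Vec k → ℝ} {F : Vec k → Vec N} (hF : IsGraphMap h F)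
    {K : NNReal} (hh : LipschitzWith K h) : LipschitzWith (1 + K) F := by
  refine LipschitzWith.of_dist_le_mul fun w w' => ?_
  have h1 := hh.dist_le_mul w w'
  rw [Real.dist_eq, dist_eq_norm] at h1
  rw [dist_eq_norm, dist_eq_norm]
  refine abs_le_of_sq_le_sq' ?_ (by positivity) |>.2
  rw [hF]
  have h2 := sq_le_sq' (by linarith [neg_abs_le (h w - h w'), le_abs_self (h w - h w')])
    (le_trans (le_abs_self _) h1)
  push_cast
  nlinarith [sq_nonneg ‖w - w'‖, K.2, mul_nonneg K.2 (sq_nonneg ‖w - w'‖)]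

theorem IsGraphMap.isClosedEmbedding {k N : ℕ} {h : Vec k → ℝ} {F : Vec k → Vec N}
    (hF : IsGraphMap h F) {K : NNReal} (hh : LipschitzWith K h) : IsClosedEmbedding F := by
  have ha : AntilipschitzWith 1 F :=
    AntilipschitzWith.of_le_mul_dist fun w w' => by simpa using hF.dist_le w w'
  exact ha.isClosedEmbedding (hF.lipschitz hh).uniformContinuous

/-- The slope of a real function, as a vector. -/
def slope {k : ℕ} (h : Vec k → ℝ) (w : Vec k) : Vec k :=
  (InnerProductSpace.toDual ℝ (Vec k)).symm (fderiv ℝ h w)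

theorem inner_slope {k : ℕ} (h : Vec k → ℝ) (w v : Vec k) :
    inner ℝ (slope h w) v = fderiv ℝ h w v := by
  simp [slope]

/-- A countable cover of the differentiability set of `h` by sets on which `h` is almost affine. -/
theorem exists_cover_almost_affine {k : ℕ} (h : Vec k → ℝ) {ε : NNReal} (hε : 0 < ε) :
    ∃ (B : ℕ → Set (Vec k)) (a : ℕ → Vec k), (∀ i, MeasurableSet (B i)) ∧
      {w | DifferentiableAt ℝ h w} ⊆ ⋃ i, B i ∧
      (∀ i, ∀ w ∈ B i, ∀ w' ∈ B i, |h w - h w' - inner ℝ (a i) (w - w')| ≤ ε * ‖w - w'‖) ∧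
      ∀ i, ∀ w ∈ B i, |areaDensity h w - √(1 + ‖a i‖ ^ 2)| ≤ ε := by
  set d := TopologicalSpace.denseSeq (Vec k →L[ℝ] ℝ)
  -- The slope attached to a piece will be the derivative at some other point of the same `D i`.
  -- Keeping derivatives within `ε / 2` of a common `d i` makes it `ε`-close to every derivative on
  -- the piece.
  set D : ℕ → Set (Vec k) := fun i =>
    {w | DifferentiableAt ℝ h w} ∩ {w | ‖fderiv ℝ h w - d i‖ < ε / 2}
  have hDm : ∀ i, MeasurableSet (D i) := fun i => by
    refine (measurableSet_of_differentiableAt ℝ h).inter ?_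
    have := measurable_fderiv ℝ h
    exact measurableSet_lt (by fun_prop) measurable_const
  have hpart : ∀ i, ∃ (t : ℕ → Set (Vec k)) (A : ℕ → Vec k →L[ℝ] ℝ),
      Pairwise (Function.onFun Disjoint t) ∧ (∀ n, MeasurableSet (t n)) ∧ (D i ⊆ ⋃ n, t n) ∧
      (∀ n, ApproximatesLinearOn h (A n) (D i ∩ t n) ε) ∧
      ((D i).Nonempty → ∀ n, ∃ y ∈ D i, A n = fderiv ℝ h y) := fun i =>
    exists_partition_approximatesLinearOn_of_hasFDerivWithinAt h (D i) (fderiv ℝ h)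
      (fun x hx => hx.1.hasFDerivAt.hasFDerivWithinAt) (fun _ => ε) (fun _ => hε.ne')
  choose t A h1 h2 h3 h4 h5 using hpart
  let u := fun q : ℕ => Nat.unpair q
  refine ⟨fun q => D (u q).1 ∩ t (u q).1 (u q).2,
    fun q => (InnerProductSpace.toDual ℝ (Vec k)).symm (A (u q).1 (u q).2),
    fun q => (hDm _).inter (h2 _ _), ?_, ?_, ?_⟩
  · intro w hw
    obtain ⟨i, hi⟩ := (TopologicalSpace.denseRange_denseSeq (Vec k →L[ℝ] ℝ)).exists_dist_lt
      (fderiv ℝ h w) (show (0 : ℝ) < ε / 2 by positivity)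
    have hwD : w ∈ D i := ⟨hw, by simpa [dist_eq_norm] using hi⟩
    obtain ⟨n, hn⟩ := mem_iUnion.mp (h3 i hwD)
    refine mem_iUnion.mpr ⟨Nat.pair i n, ?_⟩
    simp only [u, Nat.unpair_pair]
    exact ⟨hwD, hn⟩
  · intro q w hw w' hw'
    have := h4 (u q).1 (u q).2 w hw w' hw'
    simpa using this
  · intro q w hw
    obtain ⟨y, hy, hye⟩ := h5 (u q).1 ⟨w, hw.1⟩ (u q).2
    rw [LinearIsometryEquiv.norm_map, hye]
    refine (abs_sqrt_one_add_sq_sub_le _ _).trans ((abs_norm_sub_norm_le _ _).trans ?_)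
    have e1 : ‖fderiv ℝ h w - d (u q).1‖ < ε / 2 := hw.1.2
    have e2 : ‖fderiv ℝ h y - d (u q).1‖ < ε / 2 := hy.2
    calc ‖fderiv ℝ h w - fderiv ℝ h y‖
        = ‖(fderiv ℝ h w - d (u q).1) - (fderiv ℝ h y - d (u q).1)‖ := by congr 1; abel
      _ ≤ _ := norm_sub_le _ _
      _ ≤ ε := by linarith

/-- By Rademacher's theorem almost every point lies in a piece where `h` is almost affine. There the
pulled back Hausdorff measure and the density differ by factors tending to `1` with `ε`, so the
measures agree in the limit. -/
theorem IsGraphMap.comap_euclideanHausdorffMeasure {k N : ℕ} {h : Vec k → ℝ} {F : Vec k → Vec N}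
    (hF : IsGraphMap h F) {K : NNReal} (hh : LipschitzWith K h) :
    (Measure.euclideanHausdorffMeasure k).comap F
      = volume.withDensity fun w => ENNReal.ofReal (areaDensity h w) := by
  have hemb := (hF.isClosedEmbedding hh).measurableEmbedding
  set ν := (Measure.euclideanHausdorffMeasure k : Measure (Vec N)).comap F with hν
  set J : Vec k → ℝ≥0∞ := fun w => ENNReal.ofReal (areaDensity h w)
  have hJm : Measurable J := (measurable_areaDensity h).ennreal_ofReal
  have hνA : ∀ A, ν A = Measure.euclideanHausdorffMeasure k (F '' A) :=
    fun A => hemb.comap_apply _ A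
  have hnull : ∀ A, volume A = 0 → ν A = 0 := by
    intro A hA
    have h1 := euclideanHausdorffMeasure_image_le_of_dist_le F id A (1 + K) k
      (fun w _ w' _ => (hF.lipschitz hh).dist_le_mul w w')
    rw [image_id, EuclideanSpace.euclideanHausdorffMeasure_eq_volume, hA, mul_zero] at h1
    rw [hνA]; exact le_antisymm h1 zero_le
  have hdiff : volume {w | DifferentiableAt ℝ h w}ᶜ = 0 := hh.ae_differentiableAt
  have main : ∀ ε : NNReal, 0 < ε → ε < 1 →
      ν ≤ (((1 + ε : NNReal) : ℝ≥0∞) ^ k * ((1 + ε : NNReal) : ℝ≥0∞)) • volume.withDensity J ∧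
      volume.withDensity J
        ≤ (((1 + ε : NNReal) : ℝ≥0∞) * (((1 - ε)⁻¹ : NNReal) : ℝ≥0∞) ^ k) • ν := by
    intro ε hε hε1
    obtain ⟨B, a, hB, hcov, haff, hJ⟩ := exists_cover_almost_affine h hε
    have hc : volume (⋃ i, B i)ᶜ = 0 := measure_mono_null (compl_subset_compl.mpr hcov) hdiff
    constructor
    · refine measure_le_of_countable_cover hB (hnull _ hc) fun i A hAB hA => ?_
      rw [hνA, Measure.smul_apply, smul_eq_mul, withDensity_apply _ hA, mul_assoc]
      refine ((hF.area_bounds (a := a i) (ε := ε)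
        fun w hw w' hw' => haff i w (hAB hw) w' (hAB hw')).1).trans ?_
      refine mul_le_mul_right ?_ _
      rw [← setLIntegral_const, ← lintegral_const_mul _ hJm]
      refine setLIntegral_mono (by fun_prop) fun w hw => ?_
      rw [← ENNReal.ofReal_coe_nnreal, ← ENNReal.ofReal_mul (NNReal.coe_nonneg _)]
      refine ENNReal.ofReal_le_ofReal ?_
      -- The density is at least `1`, so the additive error `ε` is absorbed by one more factor `1 +
      -- ε`.
      have e1 := (abs_le.mp (hJ i w (hAB hw))).1
      have e2 := one_le_areaDensity h w
      have e3 : (0 : ℝ) < ε := hε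
      push_cast
      nlinarith
    · refine measure_le_of_countable_cover hB ?_ fun i A hAB hA => ?_
      · exact withDensity_absolutelyContinuous _ _ hc
      rw [Measure.smul_apply, smul_eq_mul, withDensity_apply _ hA, mul_assoc, hνA]
      refine le_trans ?_ (mul_le_mul_right ((hF.area_bounds (a := a i) (ε := ε)
        fun w hw w' hw' => haff i w (hAB hw) w' (hAB hw')).2 hε1) _)
      rw [← setLIntegral_const, ← lintegral_const_mul _ (by fun_prop)]
      refine setLIntegral_mono (by fun_prop) fun w hw => ?_
      rw [← ENNReal.ofReal_coe_nnreal, ← ENNReal.ofReal_mul (NNReal.coe_nonneg _)]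
      refine ENNReal.ofReal_le_ofReal ?_
      have e1 := (abs_le.mp (hJ i w (hAB hw))).2
      have e2 : 1 ≤ √(1 + ‖a i‖ ^ 2) := Real.one_le_sqrt.mpr (by nlinarith [sq_nonneg ‖a i‖])
      have e3 : (0 : ℝ) < ε := hε
      push_cast
      nlinarith
  have hlim0 : Tendsto (fun ε : NNReal => ε) (𝓝[>] 0) (𝓝 0) := tendsto_nhdsWithin_of_tendsto_nhds tendsto_id
  have hev : ∀ᶠ ε : NNReal in 𝓝[>] 0, 0 < ε ∧ ε < 1 :=
    (eventually_mem_nhdsWithin).and (hlim0.eventually_lt_const one_pos)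
  refine le_antisymm (Measure.le_iff.mpr fun A hA => ?_) (Measure.le_iff.mpr fun A hA => ?_)
  · have hl : Tendsto (fun ε : NNReal => ((((1 + ε) ^ k * (1 + ε) : NNReal)) : ℝ≥0∞)
        * volume.withDensity J A) (𝓝[>] 0) (𝓝 ((((1 + 0) ^ k * (1 + 0) : NNReal)) *
          volume.withDensity J A)) := by
      refine ENNReal.Tendsto.mul_const (ENNReal.tendsto_coe.mpr ?_) (Or.inl (by simp))
      exact ((hlim0.const_add 1).pow k).mul (hlim0.const_add 1)
    simp only [add_zero, one_pow, mul_one, ENNReal.coe_one, one_mul] at hl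
    refine ge_of_tendsto hl (hev.mono fun ε hε => ?_)
    have := (main ε hε.1 hε.2).1 A
    simpa using this
  · have hl : Tendsto (fun ε : NNReal => ((((1 + ε) * ((1 - ε)⁻¹) ^ k : NNReal)) : ℝ≥0∞)
        * ν A) (𝓝[>] 0) (𝓝 ((((1 + 0) * ((1 - 0)⁻¹) ^ k : NNReal)) * ν A)) := by
      refine ENNReal.Tendsto.mul_const (ENNReal.tendsto_coe.mpr ?_) (Or.inl (by simp))
      have e : Tendsto (fun ε : NNReal => 1 - ε) (𝓝[>] 0) (𝓝 (1 - 0)) :=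
        tendsto_const_nhds.sub hlim0
      exact (hlim0.const_add 1).mul ((e.inv₀ (by simp)).pow k)
    simp only [add_zero, tsub_zero, inv_one, one_pow, mul_one, ENNReal.coe_one, one_mul] at hl
    refine ge_of_tendsto hl (hev.mono fun ε hε => ?_)
    have := (main ε hε.1 hε.2).2 A
    simpa only [Measure.smul_apply, smul_eq_mul, ENNReal.coe_mul, ENNReal.coe_pow] using this

/-- The area formula for Lipschitz graphs. -/
theorem IsGraphMap.map_withDensity {k N : ℕ} {h : Vec k → ℝ} {F : Vec k → Vec N}
    (hF : IsGraphMap h F) {K : NNReal} (hh : LipschitzWith K h) :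
    (volume.withDensity fun w => ENNReal.ofReal (areaDensity h w)).map F
      = (Measure.euclideanHausdorffMeasure k).restrict (range F) := by
  rw [← hF.comap_euclideanHausdorffMeasure hh,
    (hF.isClosedEmbedding hh).measurableEmbedding.map_comap]

end OccMeas

end

noncomputable section

namespace OccMeas

/-! ### Graph coordinates and the Gauss-Green formula above a graph -/

/-- `ι` parametrizes isometrically the hyperplane orthogonal to the unit vector `e`. -/
structure IsFrame {k : ℕ} (e : Vec (k + 1)) (ι : Vec k →ₗᵢ[ℝ] Vec (k + 1)) : Prop where
  norm : ‖e‖ = 1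
  perp : ∀ w, inner ℝ (ι w) e = 0
  decomp : ∀ x, ∃ w, x = ι w + (inner ℝ x e : ℝ) • e
  measurePreserving : MeasurePreserving (fun q : Vec k × ℝ => ι q.1 + q.2 • e)
    ((volume : Measure (Vec k)).prod (volume : Measure ℝ)) volume

theorem exists_isFrame {k : ℕ} {e : Vec (k + 1)} (he : ‖e‖ = 1) :
    ∃ ι : Vec k →ₗᵢ[ℝ] Vec (k + 1), IsFrame e ι := by
  have ho : Orthonormal ℝ (({0} : Set (Fin (k + 1))).domRestrict fun _ => e) := by
    constructor
    · rintro ⟨i, hi⟩; exact he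
    · rintro ⟨i, hi⟩ ⟨j, hj⟩ hij
      exact absurd (Subtype.ext ((mem_singleton_iff.mp hi).trans (mem_singleton_iff.mp hj).symm)) hij
  obtain ⟨b, hb⟩ := ho.exists_orthonormalBasis_extension_of_card_eq (by simp)
  have hb0 : b 0 = e := hb 0 rfl
  set T : Vec k × ℝ → Vec (k + 1) := fun q =>
    b.repr.symm (WithLp.toLp 2 (Fin.cons q.2 q.1 : Fin (k + 1) → ℝ)) with hT
  let ι₀ : Vec k →ₗ[ℝ] Vec (k + 1) :=
    { toFun := fun w => ∑ i, w i • b i.succ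
      map_add' := fun w w' => by simp [add_smul, Finset.sum_add_distrib]
      map_smul' := fun c w => by simp [Finset.smul_sum, smul_smul] }
  have hTι : ∀ q, T q = ι₀ q.1 + q.2 • e := by
    intro q
    rw [hT]
    change b.repr.symm _ = _
    rw [← b.sum_repr_symm, Fin.sum_univ_succ]
    simp [ι₀, hb0, add_comm]
  have hnorm : ∀ w, ‖ι₀ w‖ = ‖w‖ := by
    intro w
    have h1 := hTι (w, 0)
    simp only [zero_smul, add_zero] at h1
    rw [← h1, hT]
    simp only [LinearIsometryEquiv.norm_map]
    rw [EuclideanSpace.norm_eq, EuclideanSpace.norm_eq, Fin.sum_univ_succ]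
    simp
  refine ⟨⟨ι₀, hnorm⟩, he, ?_, ?_, ?_⟩
  · intro w
    change inner ℝ (∑ i, w i • b i.succ) e = 0
    rw [sum_inner]
    refine Finset.sum_eq_zero fun i _ => ?_
    rw [inner_smul_left, ← hb0, b.inner_eq_ite]
    simp [Fin.succ_ne_zero]
  · intro x
    refine ⟨WithLp.toLp 2 fun i => inner ℝ (b i.succ) x, ?_⟩
    change x = (∑ i, _) + _
    conv_lhs => rw [← b.sum_repr' x, Fin.sum_univ_succ]
    simp [hb0, add_comm, real_inner_comm]
  -- In coordinates of an orthonormal basis starting with `e`, the map sends `(w, s)` to `(s, w)`: a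
  -- chain of measure-preserving identifications.
  · have hTm : MeasurePreserving T ((volume : Measure (Vec k)).prod (volume : Measure ℝ)) volume := by
      have h1 := (EuclideanSpace.volume_preserving_symm_measurableEquiv_toLp (Fin k)).prod
        (MeasurePreserving.id (volume : Measure ℝ))
      have h2 := Measure.measurePreserving_swap (μ := (volume : Measure (Fin k → ℝ)))
        (ν := (volume : Measure ℝ))
      have h3 := (volume_preserving_piFinSuccAbove (fun _ : Fin (k + 1) => ℝ) 0).symm
      have h4 := (EuclideanSpace.volume_preserving_symm_measurableEquiv_toLp (Fin (k + 1))).symm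
      have h5 := b.measurePreserving_repr_symm
      have := h5.comp (h4.comp (h3.comp (h2.comp h1)))
      convert! this using 1
      funext q
      simp only [hT, Function.comp]
      congr 2
      funext i
      refine Fin.cases ?_ (fun j => ?_) i
      · simp [MeasurableEquiv.piFinSuccAbove]
      · simp [MeasurableEquiv.piFinSuccAbove]
    convert! hTm using 1
    funext q
    exact (hTι q).symm

variable {k : ℕ} {e : Vec (k + 1)} {ι : Vec k →ₗᵢ[ℝ] Vec (k + 1)}

theorem IsFrame.inner_e (hf : IsFrame e ι) (w : Vec k) (s : ℝ) :
    inner ℝ (ι w + s • e) e = s := by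
  rw [inner_add_left, hf.perp, inner_smul_left, real_inner_self_eq_norm_sq, hf.norm]; simp

theorem IsFrame.norm_sq (hf : IsFrame e ι) (w : Vec k) (s : ℝ) :
    ‖ι w + s • e‖ ^ 2 = ‖w‖ ^ 2 + s ^ 2 := by
  rw [norm_add_sq_real, inner_smul_right, hf.perp, norm_smul, hf.norm, ι.norm_map]
  simp

/-- The parametrization of the graph of `h` in the direction `e`. -/
def graphPt (e : Vec (k + 1)) (ι : Vec k →ₗᵢ[ℝ] Vec (k + 1)) (h : Vec k → ℝ) (w : Vec k) :
    Vec (k + 1) := ι w + h w • e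

theorem IsFrame.isGraphMap (hf : IsFrame e ι) (h : Vec k → ℝ) : IsGraphMap h (graphPt e ι h) := by
  intro w w'
  rw [← hf.norm_sq]
  congr 2
  simp only [graphPt, map_sub, sub_smul]; abel

/-- A vertical shear translates each line, so it preserves volume however rough `h` is. It flattens
the region above the graph to a half-space. -/
theorem IsFrame.measurePreserving_skew (hf : IsFrame e ι) {h : Vec k → ℝ} (hh : Measurable h) :
    MeasurePreserving (fun q : Vec k × ℝ => ι q.1 + (q.2 + h q.1) • e)
      ((volume : Measure (Vec k)).prod (volume : Measure ℝ)) volume := by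
  have h1 := MeasurePreserving.skew_product (MeasurePreserving.id (volume : Measure (Vec k)))
    (μc := (volume : Measure ℝ)) (μd := volume) (g := fun w r => r + h w) (by fun_prop)
    (ae_of_all _ fun w => (measurePreserving_add_right volume (h w)).map_eq)
  exact hf.measurePreserving.comp h1

/-- Integration by parts against the constant `1`. The Lipschitz version is needed because a smooth
function composed with a Lipschitz graph is only Lipschitz. -/
theorem integral_lineDeriv_eq_zero {f : Vec k → ℝ} {C : NNReal} (hf : LipschitzWith C f)
    (hc : HasCompactSupport f) (v : Vec k) : ∫ x, lineDeriv ℝ f x v = 0 := by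
  have := (LipschitzWith.const (1 : ℝ)).integral_lineDeriv_mul_eq (μ := volume) hf hc (-v)
  simpa [lineDeriv] using this.symm

/-- The Gauss-Green formula for the region above a Lipschitz graph. -/
theorem IsFrame.integral_fderiv_above (hf : IsFrame e ι) {h : Vec k → ℝ} {K : NNReal}
    (hh : LipschitzWith K h) {φ : Vec (k + 1) → ℝ} (hφ : ContDiff ℝ 1 φ)
    (hc : HasCompactSupport φ) {U : Set (Vec (k + 1))} (hUm : MeasurableSet U)
    (hU : ∀ w s, ι w + s • e ∈ U ↔ h w < s) (v : Vec k) (α : ℝ) :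
    ∫ x in U, fderiv ℝ φ x (ι v + α • e)
      = ∫ w, φ (graphPt e ι h w) * (fderiv ℝ h w v - α) := by
  set Θ : Vec k × ℝ → Vec (k + 1) := fun q => ι q.1 + (q.2 + h q.1) • e with hΘ
  have hΘm : MeasurePreserving Θ ((volume : Measure (Vec k)).prod (volume : Measure ℝ)) volume :=
    hf.measurePreserving_skew hh.continuous.measurable
  have hpre : Θ ⁻¹' U = univ ×ˢ Ioi 0 := by
    ext ⟨w, r⟩
    simp [hΘ, hU]
  have hdc : ∀ u, Continuous fun x => fderiv ℝ φ x u := fun u =>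
    (hφ.continuous_fderiv (by norm_num)).clm_apply continuous_const
  have hdsupp : ∀ u, HasCompactSupport fun x => fderiv ℝ φ x u := fun u =>
    hc.fderiv_apply (𝕜 := ℝ) u
  have hint : ∀ u, Integrable (fun q => fderiv ℝ φ (Θ q) u)
      ((volume : Measure (Vec k)).prod (volume : Measure ℝ)) := fun u =>
    hΘm.integrable_comp_of_integrable ((hdc u).integrable_of_hasCompactSupport (hdsupp u))
  have hon : ∀ u, IntegrableOn (fun q => fderiv ℝ φ (Θ q) u) (univ ×ˢ Ioi 0)
      ((volume : Measure (Vec k)).prod (volume : Measure ℝ)) := fun u => (hint u).integrableOn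
  have hchange : ∀ u, ∫ x in U, fderiv ℝ φ x u
      = ∫ q in univ ×ˢ Ioi 0, fderiv ℝ φ (Θ q) u
          ∂((volume : Measure (Vec k)).prod (volume : Measure ℝ)) := by
    intro u
    have := setIntegral_map (μ := (volume : Measure (Vec k)).prod (volume : Measure ℝ)) hUm
      (hdc u).aestronglyMeasurable hΘm.measurable.aemeasurable
    rwa [hΘm.map_eq, hpre] at this
  -- the vertical derivative
  have hvert : ∀ w, ∫ r in Ioi (0 : ℝ), fderiv ℝ φ (Θ (w, r)) e = -φ (graphPt e ι h w) := by
    intro w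
    have hcl : IsClosedEmbedding fun r : ℝ => Θ (w, r) := by
      have hi : Isometry fun r : ℝ => Θ (w, r) := by
        refine Isometry.of_dist_eq fun r r' => ?_
        rw [dist_eq_norm, hΘ]
        simp only [add_sub_add_left_eq_sub, ← sub_smul, add_sub_add_right_eq_sub]
        rw [norm_smul, hf.norm, mul_one, Real.dist_eq, Real.norm_eq_abs]
      exact hi.isClosedEmbedding
    have hder : ∀ r, HasDerivAt (fun r : ℝ => φ (Θ (w, r))) (fderiv ℝ φ (Θ (w, r)) e) r := by
      intro r
      have h1 : HasDerivAt (fun r : ℝ => Θ (w, r)) e r := by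
        have := (((hasDerivAt_id r).add_const (h w)).smul_const e).const_add (ι w)
        simpa [hΘ] using this
      exact ((hφ.differentiable (by norm_num)) _).hasFDerivAt.comp_hasDerivAt r h1
    have hcd : ContDiff ℝ 1 fun r : ℝ => φ (Θ (w, r)) := by
      refine hφ.comp ?_
      simp only [hΘ]
      fun_prop
    have := (hc.comp_isClosedEmbedding hcl).integral_Ioi_deriv_eq hcd 0
    rw [← show φ (Θ (w, 0)) = φ (graphPt e ι h w) by simp [hΘ, graphPt]]
    rw [← this]
    exact integral_congr_ae (ae_of_all _ fun r => (hder r).deriv.symm)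
  have hE : ∫ x in U, fderiv ℝ φ x e = ∫ w, -φ (graphPt e ι h w) := by
    rw [hchange, setIntegral_prod _ (hon e), Measure.restrict_univ]
    exact integral_congr_ae (ae_of_all _ hvert)
  -- the horizontal derivatives
  have hdh : ∀ w, |fderiv ℝ h w v| ≤ K * ‖v‖ := fun w =>
    ((fderiv ℝ h w).le_opNorm v).trans
      (mul_le_mul_of_nonneg_right (norm_fderiv_le_of_lipschitz ℝ hh) (norm_nonneg v))
  have hdhm : Measurable fun w => fderiv ℝ h w v := measurable_fderiv_apply_const ℝ h v
  have hint2 : Integrable (fun q : Vec k × ℝ => fderiv ℝ h q.1 v * fderiv ℝ φ (Θ q) e)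
      ((volume : Measure (Vec k)).prod (volume : Measure ℝ)) :=
    (hint e).bdd_mul (c := K * ‖v‖) (hdhm.comp measurable_fst).aestronglyMeasurable
      (ae_of_all _ fun q => hdh q.1)
  obtain ⟨Cφ, hCφ⟩ := hφ.lipschitzWith_of_hasCompactSupport hc (by norm_num)
  -- On the translated graph at height `r`, the integrand is the derivative along `v` of the
  -- compactly supported Lipschitz function `w ↦ φ (Θ (w, r))`. This trades the horizontal
  -- derivative for the vertical one, whose line integrals are known.
  have hslice : ∀ r : ℝ, ∫ w, (fderiv ℝ φ (Θ (w, r)) (ι v)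
      + fderiv ℝ h w v * fderiv ℝ φ (Θ (w, r)) e) = 0 := by
    intro r
    have hgm : IsGraphMap (fun w => r + h w) (graphPt e ι fun w => r + h w) := hf.isGraphMap _
    have hL : LipschitzWith K fun w => r + h w := by
      refine LipschitzWith.of_dist_le_mul fun w w' => ?_
      rw [dist_add_left]; exact hh.dist_le_mul w w'
    have hz := integral_lineDeriv_eq_zero (hCφ.comp (hgm.lipschitz hL))
      (hc.comp_isClosedEmbedding (hgm.isClosedEmbedding hL)) v
    rw [← hz]
    refine integral_congr_ae ?_
    filter_upwards [hh.ae_differentiableAt] with w hw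
    have h1 : HasFDerivAt (graphPt e ι fun w => r + h w)
        (ι.toContinuousLinearMap + (fderiv ℝ h w).smulRight e) w := by
      refine HasFDerivAt.add ι.toContinuousLinearMap.hasFDerivAt ?_
      exact (hw.hasFDerivAt.const_add r).smul_const e
    have h2 := ((hφ.differentiable (by norm_num)) _).hasFDerivAt.comp w h1
    rw [(h2.hasLineDerivAt v).lineDeriv]
    simp [hΘ, graphPt]
  have hH : ∫ x in U, fderiv ℝ φ x (ι v) = ∫ w, φ (graphPt e ι h w) * fderiv ℝ h w v := by
    have hsum : ∫ q in univ ×ˢ Ioi 0, (fderiv ℝ φ (Θ q) (ι v)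
        + fderiv ℝ h q.1 v * fderiv ℝ φ (Θ q) e)
          ∂((volume : Measure (Vec k)).prod (volume : Measure ℝ)) = 0 := by
      rw [← Measure.prod_restrict, Measure.restrict_univ, integral_prod_symm]
      · simp [hslice]
      · have := ((hint (ι v)).add hint2).integrableOn (s := univ ×ˢ Ioi 0)
        rwa [IntegrableOn, ← Measure.prod_restrict, Measure.restrict_univ] at this
    rw [integral_add (hon (ι v)) hint2.integrableOn] at hsum
    rw [hchange, eq_neg_of_add_eq_zero_left hsum, setIntegral_prod _ hint2.integrableOn,
      Measure.restrict_univ, ← integral_neg]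
    refine integral_congr_ae (ae_of_all _ fun w => ?_)
    simp only [integral_const_mul, hvert w]
    ring
  have hgc := (hf.isGraphMap h).isClosedEmbedding hh
  have hφi : Integrable fun w => φ (graphPt e ι h w) :=
    (hφ.continuous.comp hgc.continuous).integrable_of_hasCompactSupport
      (hc.comp_isClosedEmbedding hgc)
  have i1 : Integrable fun w => φ (graphPt e ι h w) * fderiv ℝ h w v := by
    simpa only [mul_comm] using hφi.bdd_mul (c := K * ‖v‖) hdhm.aestronglyMeasurable
      (ae_of_all _ fun w => hdh w)
  have hsplit : ∀ x, fderiv ℝ φ x (ι v + α • e) = fderiv ℝ φ x (ι v) + α * fderiv ℝ φ x e := by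
    intro x; simp
  simp_rw [hsplit, mul_sub]
  rw [integral_add, integral_const_mul, hH, hE, integral_sub i1 (hφi.mul_const α),
    integral_neg, integral_mul_const]
  · ring
  · exact ((hdc _).integrable_of_hasCompactSupport (hdsupp _)).integrableOn
  · exact (((hdc _).integrable_of_hasCompactSupport (hdsupp _)).const_mul α).integrableOn

end OccMeas

end

noncomputable section

namespace OccMeas

/-! ### Measurability of the exterior normal -/

/-- For fixed `ε` and `δ`, a violation is witnessed by some `w` through strict inequalities
continuous in `(x, ν)`, so the violating pairs form an open set. The values `1 / (i + 1)` suffice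
for both parameters. -/
theorem measurableSet_isExteriorNormal {n : ℕ} {Ω : Set (Vec n)} :
    MeasurableSet {q : Vec n × Vec n | IsExteriorNormal Ω q.1 q.2} := by
  have hpos : ∀ m : ℕ, (0 : ℝ) < 1 / ((m : ℝ) + 1) := fun m => Nat.one_div_pos_of_nat
  have e : {q : Vec n × Vec n | IsExteriorNormal Ω q.1 q.2}
      = {q | ‖q.2‖ = 1} ∩ ⋂ i : ℕ, ⋃ l : ℕ,
        (({q : Vec n × Vec n | ∃ w ∈ Ω, dist w q.1 < 1 / ((l : ℝ) + 1) ∧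
            1 / ((i : ℝ) + 1) * ‖w - q.1‖ < inner ℝ (w - q.1) q.2}
          ∪ {q | ∃ w ∈ Ωᶜ, dist w q.1 < 1 / ((l : ℝ) + 1) ∧
            inner ℝ (w - q.1) q.2 < -(1 / ((i : ℝ) + 1) * ‖w - q.1‖)})ᶜ) := by
    ext ⟨x, ν⟩
    simp only [IsExteriorNormal, mem_ofPred_eq, mem_inter_iff, mem_iInter, mem_iUnion,
      mem_compl_iff, mem_union, not_or, not_exists, not_and, not_lt, Metric.mem_ball]
    refine and_congr_right fun _ => ⟨fun H i => ?_, fun H ε hε => ?_⟩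
    · obtain ⟨δ, hδ, h⟩ := H _ (hpos i)
      obtain ⟨l, hl⟩ := exists_nat_one_div_lt hδ
      refine ⟨l, fun w hw hd => ?_, fun w hw hd => ?_⟩
      · by_contra! hc
        exact (h w (hd.trans hl)).1 hc hw
      · by_contra! hc
        exact hw ((h w (hd.trans hl)).2 hc)
    · obtain ⟨i, hi⟩ := exists_nat_one_div_lt hε
      obtain ⟨l, h1, h2⟩ := H i
      refine ⟨_, hpos l, fun w hd => ⟨fun hc hw => ?_, fun hc => ?_⟩⟩
      · have := h1 w hw hd
        nlinarith [norm_nonneg (w - x)]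
      · by_contra hw
        have := h2 w hw hd
        nlinarith [norm_nonneg (w - x)]
  rw [e]
  refine (measurableSet_eq_fun (by fun_prop) measurable_const).inter
    (MeasurableSet.iInter fun i => MeasurableSet.iUnion fun l => (IsOpen.union ?_ ?_).measurableSet.compl)
  · have : {q : Vec n × Vec n | ∃ w ∈ Ω, dist w q.1 < 1 / ((l : ℝ) + 1) ∧
            1 / ((i : ℝ) + 1) * ‖w - q.1‖ < inner ℝ (w - q.1) q.2}
        = ⋃ w ∈ Ω, ({q | dist w q.1 < 1 / ((l : ℝ) + 1)} ∩
            {q | 1 / ((i : ℝ) + 1) * ‖w - q.1‖ < inner ℝ (w - q.1) q.2}) := by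
      ext q; simp [and_left_comm]
    rw [this]
    exact isOpen_biUnion fun w _ => (isOpen_lt (by fun_prop) (by fun_prop)).inter
      (isOpen_lt (by fun_prop) (by fun_prop))
  · have : {q : Vec n × Vec n | ∃ w ∈ Ωᶜ, dist w q.1 < 1 / ((l : ℝ) + 1) ∧
            inner ℝ (w - q.1) q.2 < -(1 / ((i : ℝ) + 1) * ‖w - q.1‖)}
        = ⋃ w ∈ Ωᶜ, ({q | dist w q.1 < 1 / ((l : ℝ) + 1)} ∩
            {q | inner ℝ (w - q.1) q.2 < -(1 / ((i : ℝ) + 1) * ‖w - q.1‖)}) := by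
      ext q; simp [and_left_comm]
    rw [this]
    exact isOpen_biUnion fun w _ => (isOpen_lt (by fun_prop) (by fun_prop)).inter
      (isOpen_lt (by fun_prop) (by fun_prop))

/-- A preimage is, up to the dummy value, the projection of a Borel set of pairs `(x, ν)`.
Uniqueness of the normal makes the projection injective there, so the image is Borel by the
Lusin-Souslin theorem. -/
theorem measurable_exteriorNormal {n : ℕ} (Ω : Set (Vec n)) : Measurable (exteriorNormal Ω) := by
  have himg : ∀ s : Set (Vec n), MeasurableSet s →
      MeasurableSet {x | ∃ ν ∈ s, IsExteriorNormal Ω x ν} := by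
    intro s hs
    have h1 : MeasurableSet ({q : Vec n × Vec n | IsExteriorNormal Ω q.1 q.2} ∩ Prod.snd ⁻¹' s) :=
      measurableSet_isExteriorNormal.inter (measurable_snd hs)
    have h2 := h1.image_of_measurable_injOn measurable_fst (by
      rintro ⟨x, ν⟩ ⟨h, -⟩ ⟨x', ν'⟩ ⟨h', -⟩ (hx : x = x')
      subst hx
      exact Prod.ext rfl (h.unique h'))
    convert h2 using 1
    ext x
    simp only [mem_ofPred_eq, mem_image, mem_inter_iff, mem_preimage, Prod.exists, exists_and_right,
      exists_eq_right]
    exact ⟨fun ⟨ν, h, h'⟩ => ⟨ν, h', h⟩, fun ⟨ν, h, h'⟩ => ⟨ν, h', h⟩⟩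
  intro s hs
  have hD := himg univ MeasurableSet.univ
  have : exteriorNormal Ω ⁻¹' s = {x | ∃ ν ∈ s, IsExteriorNormal Ω x ν}
      ∪ ({x | ∃ ν ∈ univ, IsExteriorNormal Ω x ν}ᶜ ∩ {_x | (0 : Vec n) ∈ s}) := by
    ext x
    by_cases h : ∃ ν, IsExteriorNormal Ω x ν
    · obtain ⟨ν, hν⟩ := h
      simp only [mem_preimage, hν.exteriorNormal_eq, mem_union, mem_ofPred_eq, mem_inter_iff,
        mem_compl_iff]
      constructor
      · exact fun hs => Or.inl ⟨ν, hs, hν⟩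
      · rintro (⟨ν', hs', hν'⟩ | ⟨hn, -⟩)
        · rwa [hν.unique hν']
        · exact absurd ⟨ν, trivial, hν⟩ hn
    · have h0 : exteriorNormal Ω x = 0 := by rw [exteriorNormal, dif_neg h]
      simp only [mem_preimage, h0, mem_union, mem_ofPred_eq, mem_inter_iff, mem_compl_iff]
      constructor
      · exact fun hs => Or.inr ⟨fun ⟨ν, _, hν⟩ => h ⟨ν, hν⟩, hs⟩
      · rintro (⟨ν, _, hν⟩ | ⟨_, hs⟩)
        · exact absurd ⟨ν, hν⟩ h
        · exact hs
  rw [this]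
  exact (himg s hs).union (hD.compl.inter (MeasurableSet.const _))

theorem norm_exteriorNormal_le {n : ℕ} (Ω : Set (Vec n)) (x : Vec n) :
    ‖exteriorNormal Ω x‖ ≤ 1 := by
  by_cases h : ∃ ν, IsExteriorNormal Ω x ν
  · obtain ⟨ν, hν⟩ := h
    rw [hν.exteriorNormal_eq, hν.1]
  · rw [exteriorNormal, dif_neg h]; simp

/-! ### Charts of a Lipschitz boundary -/

/-- In the ball `B(x₀, r)`, the set `Ω` is the part strictly above the graph of `g`. -/
structure IsChart {k : ℕ} (Ω : Set (Vec (k + 1))) (x₀ : Vec (k + 1)) (r : ℝ) (K : NNReal)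
    (e : Vec (k + 1)) (ι : Vec k →ₗᵢ[ℝ] Vec (k + 1)) (g : Vec (k + 1) → ℝ) : Prop where
  frame : IsFrame e ι
  lip : LipschitzWith K g
  inv : ∀ (x : Vec (k + 1)) (s : ℝ), g (x + s • e) = g x
  pos : 0 < r
  mem_iff : ∀ x ∈ Metric.ball x₀ r, (x ∈ Ω ↔ g x < inner ℝ x e)

theorem HasLipschitzBoundary.exists_isChart {k : ℕ} {Ω : Set (Vec (k + 1))}
    (h : HasLipschitzBoundary Ω) {x₀ : Vec (k + 1)} (hx : x₀ ∈ frontier Ω) :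
    ∃ r K e ι g, IsChart Ω x₀ r K e ι g := by
  obtain ⟨e, he, K, g, hg, hinv, r, hr, H⟩ := h x₀ hx
  obtain ⟨ι, hι⟩ := exists_isFrame he
  exact ⟨r, K, e, ι, g, hι, hg, hinv, hr, H⟩

variable {k : ℕ} {Ω : Set (Vec (k + 1))} {x₀ : Vec (k + 1)} {r : ℝ} {K : NNReal}
    {e : Vec (k + 1)} {ι : Vec k →ₗᵢ[ℝ] Vec (k + 1)} {g : Vec (k + 1) → ℝ}

theorem IsChart.mem_frontier_iff (hc : IsChart Ω x₀ r K e ι g) (hΩ : IsOpen Ω)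
    {x : Vec (k + 1)} (hx : x ∈ Metric.ball x₀ r) : x ∈ frontier Ω ↔ g x = inner ℝ x e := by
  have hgc := hc.lip.continuous
  rw [hΩ.frontier_eq, Set.mem_sdiff, hc.mem_iff x hx, not_lt]
  constructor
  · rintro ⟨hcl, hle⟩
    refine le_antisymm ?_ hle
    by_contra! hlt
    have hop : IsOpen (Metric.ball x₀ r ∩ {y | inner ℝ y e < g y}) :=
      Metric.isOpen_ball.inter (isOpen_lt (by fun_prop) hgc)
    obtain ⟨y, ⟨hy1, hy2⟩, hy3⟩ := mem_closure_iff.mp hcl _ hop ⟨hx, hlt⟩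
    exact lt_asymm hy2 ((hc.mem_iff y hy1).mp hy3)
  · intro heq
    refine ⟨?_, heq.ge⟩
    -- `g` is constant along `e`, so moving up from a point of the graph enters `Ω` at once.
    have ht : Tendsto (fun t : ℝ => x + t • e) (𝓝[>] 0) (𝓝 x) := by
      have : Tendsto (fun t : ℝ => x + t • e) (𝓝 0) (𝓝 (x + (0 : ℝ) • e)) :=
        Continuous.tendsto (by fun_prop) 0
      rw [zero_smul, add_zero] at this
      exact this.mono_left nhdsWithin_le_nhds
    refine mem_closure_of_tendsto ht ?_
    filter_upwards [ht (Metric.isOpen_ball.mem_nhds hx), self_mem_nhdsWithin] with t hb hpos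
    rw [hc.mem_iff _ hb, hc.inv, heq, inner_add_left, inner_smul_left,
      real_inner_self_eq_norm_sq, hc.frame.norm]
    have : (0 : ℝ) < t := hpos
    simpa

theorem IsChart.g_frame (hc : IsChart Ω x₀ r K e ι g) (w : Vec k) (s : ℝ) :
    g (ι w + s • e) = (g ∘ ι) w := hc.inv _ _

theorem IsChart.lip_comp (hc : IsChart Ω x₀ r K e ι g) : LipschitzWith K (g ∘ ι) := by
  simpa using hc.lip.comp ι.lipschitz

theorem IsChart.mem_range_iff (hc : IsChart Ω x₀ r K e ι g) (x : Vec (k + 1)) :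
    x ∈ range (graphPt e ι (g ∘ ι)) ↔ g x = inner ℝ x e := by
  constructor
  · rintro ⟨w, rfl⟩
    rw [graphPt, hc.frame.inner_e, hc.inv]; rfl
  · intro h
    obtain ⟨w, hw⟩ := hc.frame.decomp x
    refine ⟨w, ?_⟩
    have h1 := hc.g_frame w (inner ℝ x e)
    rw [← hw, h] at h1
    rw [graphPt, ← h1, ← hw]

theorem IsChart.frontier_inter (hc : IsChart Ω x₀ r K e ι g) (hΩ : IsOpen Ω) :
    frontier Ω ∩ Metric.ball x₀ r = range (graphPt e ι (g ∘ ι)) ∩ Metric.ball x₀ r := by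
  ext x
  refine and_congr_left fun hx => ?_
  rw [hc.mem_frontier_iff hΩ hx, hc.mem_range_iff]

theorem surfaceMeasure_succ (Ω : Set (Vec (k + 1))) :
    surfaceMeasure Ω = (Measure.euclideanHausdorffMeasure k).restrict (frontier Ω) := rfl

/-- Inside the ball the boundary is the graph, so the area formula turns surface measure into a
weighted Lebesgue measure on the parameter space. -/
theorem IsChart.surfaceMeasure_restrict (hc : IsChart Ω x₀ r K e ι g) (hΩ : IsOpen Ω) :
    (surfaceMeasure Ω).restrict (Metric.ball x₀ r)
      = ((volume.withDensity fun w => ENNReal.ofReal (areaDensity (g ∘ ι) w)).map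
          (graphPt e ι (g ∘ ι))).restrict (Metric.ball x₀ r) := by
  rw [(hc.frame.isGraphMap _).map_withDensity hc.lip_comp, surfaceMeasure_succ,
    Measure.restrict_restrict Metric.isOpen_ball.measurableSet,
    Measure.restrict_restrict Metric.isOpen_ball.measurableSet, inter_comm, hc.frontier_inter hΩ,
    inter_comm]

theorem areaDensity_le (h : Vec k → ℝ) {K : NNReal} (hh : LipschitzWith K h) (w : Vec k) :
    areaDensity h w ≤ √(1 + (K : ℝ) ^ 2) := by
  refine Real.sqrt_le_sqrt ?_
  have := norm_fderiv_le_of_lipschitz ℝ hh (x₀ := w)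
  gcongr

/-- The graph map does not decrease distances, so the parameters of a ball form a bounded set, and
the area density is bounded by the Lipschitz constant. -/
theorem IsChart.surfaceMeasure_ball_lt_top (hc : IsChart Ω x₀ r K e ι g) (hΩ : IsOpen Ω) :
    surfaceMeasure Ω (Metric.ball x₀ r) < ⊤ := by
  have hF := hc.frame.isGraphMap (g ∘ ι)
  have hemb := (hF.isClosedEmbedding hc.lip_comp).measurableEmbedding
  have h1 : surfaceMeasure Ω (Metric.ball x₀ r)
      = (surfaceMeasure Ω).restrict (Metric.ball x₀ r) (Metric.ball x₀ r) := by
    rw [Measure.restrict_apply_self]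
  rw [h1, hc.surfaceMeasure_restrict hΩ, Measure.restrict_apply_self,
    hemb.map_apply, withDensity_apply _ (hemb.measurable Metric.isOpen_ball.measurableSet)]
  have hb : Bornology.IsBounded (graphPt e ι (g ∘ ι) ⁻¹' Metric.ball x₀ r) := by
    rw [Metric.isBounded_iff]
    obtain ⟨C, hC⟩ := Metric.isBounded_iff.mp (Metric.isBounded_ball (x := x₀) (r := r))
    exact ⟨C, fun w hw w' hw' => (hF.dist_le w w').trans (hC hw hw')⟩
  refine (setLIntegral_mono measurable_const fun w _ =>
    ENNReal.ofReal_le_ofReal (areaDensity_le _ hc.lip_comp w)).trans_lt ?_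
  rw [setLIntegral_const]
  exact ENNReal.mul_lt_top ENNReal.ofReal_lt_top hb.measure_lt_top

/-- Integration against the surface measure in a chart. -/
theorem IsChart.integral_surfaceMeasure (hc : IsChart Ω x₀ r K e ι g) (hΩ : IsOpen Ω)
    {f : Vec (k + 1) → ℝ} (hf : ∀ x, x ∉ Metric.ball x₀ r → f x = 0) :
    ∫ x, f x ∂(surfaceMeasure Ω)
      = ∫ w, areaDensity (g ∘ ι) w * f (graphPt e ι (g ∘ ι) w) := by
  have hemb := ((hc.frame.isGraphMap (g ∘ ι)).isClosedEmbedding hc.lip_comp).measurableEmbedding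
  rw [← setIntegral_eq_integral_of_forall_compl_eq_zero (s := Metric.ball x₀ r) hf,
    hc.surfaceMeasure_restrict hΩ, setIntegral_eq_integral_of_forall_compl_eq_zero hf,
    hemb.integral_map]
  have := integral_withDensity_eq_integral_smul (μ := volume)
    (f := fun w => (areaDensity (g ∘ ι) w).toNNReal)
    (measurable_areaDensity (g ∘ ι)).real_toNNReal (fun w => f (graphPt e ι (g ∘ ι) w))
  refine Eq.trans this (integral_congr_ae (ae_of_all _ fun w => ?_))
  simp only [NNReal.smul_def]
  rw [Real.coe_toNNReal _ (zero_le_one.trans (one_le_areaDensity _ w)), smul_eq_mul]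

theorem norm_slope (h : Vec k → ℝ) (w : Vec k) : ‖slope h w‖ = ‖fderiv ℝ h w‖ := by
  simp [slope]

/-- The exterior normal at a point of the graph above which `h` is differentiable. -/
theorem IsChart.isExteriorNormal (hc : IsChart Ω x₀ r K e ι g) {w : Vec k}
    (hw : DifferentiableAt ℝ (g ∘ ι) w) (hb : graphPt e ι (g ∘ ι) w ∈ Metric.ball x₀ r) :
    IsExteriorNormal Ω (graphPt e ι (g ∘ ι) w)
      ((areaDensity (g ∘ ι) w)⁻¹ • (ι (slope (g ∘ ι) w) - e)) := by
  set h := g ∘ ι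
  have hJ : 1 ≤ areaDensity h w := one_le_areaDensity h w
  set J := areaDensity h w with hJd
  have hJ0 : 0 < J := by linarith
  have hn : ‖ι (slope h w) - e‖ = J := by
    have := hc.frame.norm_sq (slope h w) (-1)
    rw [neg_one_smul, ← sub_eq_add_neg, norm_slope] at this
    rw [hJd, areaDensity, ← Real.sqrt_sq (norm_nonneg (ι (slope h w) - e)), this]
    congr 1; ring
  refine ⟨by rw [norm_smul, hn, Real.norm_of_nonneg (by positivity)]; field_simp, ?_⟩
  intro ε hε
  have hlo := hw.hasFDerivAt.isLittleO.def hε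
  obtain ⟨δ₁, hδ₁, hball⟩ := Metric.eventually_nhds_iff.mp hlo
  obtain ⟨δ₂, hδ₂, hball2⟩ := Metric.isOpen_ball.mem_nhds hb |> Metric.mem_nhds_iff.mp
  refine ⟨min δ₁ δ₂, lt_min hδ₁ hδ₂, fun y hy => ?_⟩
  obtain ⟨w', hw'⟩ := hc.frame.decomp y
  set s : ℝ := inner ℝ y e
  set F := graphPt e ι h w with hF
  have hyF : y - F = ι (w' - w) + (s - h w) • e := by
    rw [hw', hF, graphPt, map_sub, sub_smul]; abel
  have hdist : dist w' w ≤ ‖y - F‖ := by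
    rw [hyF, dist_eq_norm]
    refine abs_le_of_sq_le_sq' ?_ (norm_nonneg _) |>.2
    rw [hc.frame.norm_sq]; nlinarith [sq_nonneg (s - h w)]
  have hyd : ‖y - F‖ < min δ₁ δ₂ := by rwa [← dist_eq_norm]
  have h1 := hball (hdist.trans_lt (hyd.trans_le (min_le_left _ _)))
  have hmem : y ∈ Metric.ball x₀ r := hball2 (by
    rw [Metric.mem_ball, dist_eq_norm]; exact hyd.trans_le (min_le_right _ _))
  have hyΩ : y ∈ Ω ↔ h w' < s := by
    rw [hc.mem_iff y hmem]
    have := hc.g_frame w' s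
    rw [← hw'] at this
    rw [this]
  -- Against the candidate normal, `y - F` measures the height of `y` below the tangent plane,
  -- divided by `J`. Membership in `Ω` compares the height with `h` instead, and differentiability
  -- makes the two differ by at most `ε ‖y - F‖`. As `J ≥ 1`, multiplying by `J` does no harm.
  have hin : inner ℝ (y - F) (J⁻¹ • (ι (slope h w) - e))
      = J⁻¹ * (fderiv ℝ h w (w' - w) - (s - h w)) := by
    rw [inner_smul_right, hyF, inner_sub_right, hc.frame.inner_e, inner_add_left,
      ι.inner_map_map, inner_smul_left, real_inner_comm _ e, hc.frame.perp,
      real_inner_comm, inner_slope]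
    simp
  rw [hin, hyΩ]
  rw [Real.norm_eq_abs] at h1
  have h2 : |h w' - h w - fderiv ℝ h w (w' - w)| ≤ ε * ‖y - F‖ :=
    h1.trans (mul_le_mul_of_nonneg_left (by rwa [← dist_eq_norm]) hε.le)
  have h3 := abs_le.mp h2
  have h4 : 0 ≤ ε * ‖y - F‖ := by positivity
  constructor
  · intro hlt
    rw [inv_mul_eq_div, lt_div_iff₀ hJ0] at hlt
    have : ε * ‖y - F‖ ≤ ε * ‖y - F‖ * J := le_mul_of_one_le_right h4 hJ
    linarith
  · intro hlt
    rw [inv_mul_eq_div, div_lt_iff₀ hJ0] at hlt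
    have : ε * ‖y - F‖ ≤ ε * ‖y - F‖ * J := le_mul_of_one_le_right h4 hJ
    nlinarith

/-- A property of the points of the graph above differentiability points of `h` holds
`σ`-almost everywhere in the chart. -/
theorem IsChart.ae_of_graph (hc : IsChart Ω x₀ r K e ι g) (hΩ : IsOpen Ω)
    {p : Vec (k + 1) → Prop} (hp : ∀ w, DifferentiableAt ℝ (g ∘ ι) w →
      graphPt e ι (g ∘ ι) w ∈ Metric.ball x₀ r → p (graphPt e ι (g ∘ ι) w)) :
    ∀ᵐ x ∂(surfaceMeasure Ω), x ∈ Metric.ball x₀ r → p x := by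
  rw [← ae_restrict_iff' Metric.isOpen_ball.measurableSet, hc.surfaceMeasure_restrict hΩ,
    ae_restrict_iff' Metric.isOpen_ball.measurableSet]
  have hemb := ((hc.frame.isGraphMap (g ∘ ι)).isClosedEmbedding hc.lip_comp).measurableEmbedding
  rw [hemb.ae_map_iff]
  refine withDensity_absolutelyContinuous _ _ ?_
  filter_upwards [hc.lip_comp.ae_differentiableAt] with w hw hb using hp w hw hb

/-- The Gauss-Green formula for functions supported in a chart. -/
theorem IsChart.gauss_green (hc : IsChart Ω x₀ r K e ι g) (hΩ : IsOpen Ω)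
    {φ : Vec (k + 1) → ℝ} (hφ : ContDiff ℝ 1 φ) (hcs : HasCompactSupport φ)
    (hsupp : tsupport φ ⊆ Metric.ball x₀ r) (j : Fin (k + 1)) :
    ∫ x in Ω, pderiv j φ x = ∫ x, φ x * exteriorNormal Ω x j ∂(surfaceMeasure Ω) := by
  set h := g ∘ ι
  set U : Set (Vec (k + 1)) := {x | g x < inner ℝ x e}
  have hUm : MeasurableSet U := (isOpen_lt hc.lip.continuous (by fun_prop)).measurableSet
  have hU : ∀ w s, ι w + s • e ∈ U ↔ h w < s := by
    intro w s
    change g _ < inner ℝ _ e ↔ _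
    rw [hc.frame.inner_e, hc.g_frame]
  -- `Ω` and the full region above the graph differ only outside the ball, where the derivative of
  -- `φ` vanishes.
  have hΩU : ∫ x in Ω, pderiv j φ x = ∫ x in U, pderiv j φ x := by
    rw [← integral_indicator hΩ.measurableSet, ← integral_indicator hUm]
    congr 1
    funext x
    by_cases hx : x ∈ Metric.ball x₀ r
    · have := hc.mem_iff x hx
      by_cases hxΩ : x ∈ Ω
      · rw [indicator_of_mem hxΩ, indicator_of_mem (s := U) (this.mp hxΩ)]
      · rw [indicator_of_notMem hxΩ, indicator_of_notMem (s := U) fun hu => hxΩ (this.mpr hu)]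
    · have hz : pderiv j φ x = 0 := by
        have : x ∉ tsupport (fderiv ℝ φ) := fun h' => hx (hsupp (tsupport_fderiv_subset ℝ h'))
        rw [pderiv, image_eq_zero_of_notMem_tsupport this]; rfl
      simp [indicator, hz]
  -- Splitting the `j`-th unit vector as `ι v + α • e` gives the normal component `(fderiv ℝ h w v -
  -- α) / J`. The area density cancels `J` and leaves the boundary term of the graph formula.
  obtain ⟨v, hv⟩ := hc.frame.decomp (EuclideanSpace.single j 1)
  set α : ℝ := inner ℝ (EuclideanSpace.single j (1 : ℝ)) e
  rw [hΩU, hc.integral_surfaceMeasure hΩ]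
  · have := hc.frame.integral_fderiv_above hc.lip_comp hφ hcs hUm hU v α
    rw [← hv] at this
    refine this.trans (integral_congr_ae ?_)
    filter_upwards [hc.lip_comp.ae_differentiableAt] with w hw
    by_cases hb : graphPt e ι h w ∈ Metric.ball x₀ r
    · have hJ := one_le_areaDensity h w
      have hcoord : ∀ u : Vec (k + 1), u j = inner ℝ (EuclideanSpace.single j (1 : ℝ)) u := by
        intro u; simp [EuclideanSpace.inner_single_left]
      rw [(hc.isExteriorNormal hw hb).exteriorNormal_eq, hcoord, inner_smul_right, hv,
        inner_sub_right, hc.frame.inner_e, inner_add_left, ι.inner_map_map, inner_smul_left,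
        real_inner_comm _ e, hc.frame.perp, real_inner_comm, inner_slope]
      have : areaDensity h w ≠ 0 := by positivity
      simp only [conj_trivial, mul_zero, add_zero]
      change _ = areaDensity h w * (_ * ((areaDensity h w)⁻¹ * (fderiv ℝ h w v - α)))
      field_simp
      rfl
    · have hz : φ (graphPt e ι h w) = 0 :=
        image_eq_zero_of_notMem_tsupport fun h' => hb (hsupp h')
      simp only [h] at hz
      simp [hz]
  · intro x hx
    rw [image_eq_zero_of_notMem_tsupport fun h' => hx (hsupp h'), zero_mul]

/-- Inward directions make a uniformly obtuse angle with the exterior normal. -/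
theorem IsChart.inner_exteriorNormal_le (hc : IsChart Ω x₀ r K e ι g) {w : Vec k}
    (hw : DifferentiableAt ℝ (g ∘ ι) w) (hb : graphPt e ι (g ∘ ι) w ∈ Metric.ball x₀ r) :
    (√(1 + (K : ℝ) ^ 2))⁻¹
      ≤ inner ℝ (-e) (exteriorNormal Ω (graphPt e ι (g ∘ ι) w)) := by
  rw [(hc.isExteriorNormal hw hb).exteriorNormal_eq, inner_smul_right, inner_neg_left,
    inner_sub_right, real_inner_comm, hc.frame.perp, real_inner_self_eq_norm_sq, hc.frame.norm]
  have h1 := one_le_areaDensity (g ∘ ι) w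
  have h2 := areaDensity_le (g ∘ ι) hc.lip_comp w
  have : (0 : ℝ) < areaDensity (g ∘ ι) w := by linarith
  simp only [one_pow, zero_sub, neg_neg, mul_one]
  gcongr

end OccMeas

end

noncomputable section

namespace OccMeas

/-! ### Global Gauss-Green formula -/

/-- A finite family of charts covering `∂Ω`, with a smooth partition of unity on `closure Ω`
subordinate to the balls of the charts and to `Ω`. -/
structure LipAtlas {k : ℕ} (Ω : Set (Vec (k + 1))) where
  ix : Type
  fin : Fintype ix
  x₀ : ix → Vec (k + 1)
  r : ix → ℝ
  K : ix → NNReal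
  e : ix → Vec (k + 1)
  ι : ix → Vec k →ₗᵢ[ℝ] Vec (k + 1)
  g : ix → Vec (k + 1) → ℝ
  chart : ∀ i, IsChart Ω (x₀ i) (r i) (K i) (e i) (ι i) (g i)
  η : Option ix → Vec (k + 1) → ℝ
  smooth : ∀ i, ContDiff ℝ ∞ (η i)
  nonneg : ∀ i x, 0 ≤ η i x
  supp_none : tsupport (η none) ⊆ Ω
  supp_some : ∀ i, tsupport (η (some i)) ⊆ Metric.ball (x₀ i) (r i)
  sum_eq : ∀ x ∈ closure Ω, ∑ i, η i x = 1

attribute [instance] LipAtlas.fin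

variable {k : ℕ} {Ω : Set (Vec (k + 1))}

theorem exists_lipAtlas (hopen : IsOpen Ω) (hbdd : Bornology.IsBounded Ω)
    (hlip : HasLipschitzBoundary Ω) : Nonempty (LipAtlas Ω) := by
  have hcf : IsCompact (frontier Ω) :=
    hbdd.isCompact_closure.of_isClosed_subset isClosed_frontier frontier_subset_closure
  have hch : ∀ x : frontier Ω, ∃ r K e ι g, IsChart Ω (x : Vec (k + 1)) r K e ι g :=
    fun x => hlip.exists_isChart x.2
  choose r K e ι g hc using hch
  obtain ⟨t, ht⟩ := hcf.elim_finite_subcover (fun x : frontier Ω => Metric.ball (x : Vec (k + 1)) (r x))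
    (fun _ => Metric.isOpen_ball)
    fun x hx => mem_iUnion.mpr ⟨⟨x, hx⟩, Metric.mem_ball_self (hc ⟨x, hx⟩).pos⟩
  let N := t.card
  let u : Fin N → frontier Ω := fun i => (t.equivFin.symm i : frontier Ω)
  -- The index `none` stands for the interior patch `Ω`, the others for the boundary balls.
  let U : Option (Fin N) → Set (Vec (k + 1)) := fun o =>
    o.elim Ω fun i => Metric.ball (u i : Vec (k + 1)) (r (u i))
  have hUo : ∀ o, IsOpen (U o) := by
    rintro (_ | i)
    · exact hopen
    · exact Metric.isOpen_ball
  have hcov : closure Ω ⊆ ⋃ o, U o := by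
    intro x hx
    by_cases hxΩ : x ∈ Ω
    · exact mem_iUnion.mpr ⟨none, hxΩ⟩
    · have hxf : x ∈ frontier Ω := by rw [hopen.frontier_eq]; exact ⟨hx, hxΩ⟩
      obtain ⟨y, hy, hxy⟩ := mem_iUnion₂.mp (ht hxf)
      refine mem_iUnion.mpr ⟨some (t.equivFin ⟨y, hy⟩), ?_⟩
      simpa [U, u] using hxy
  obtain ⟨f, hf⟩ := SmoothPartitionOfUnity.exists_isSubordinate
    (modelWithCornersSelf ℝ (Vec (k + 1))) isClosed_closure U hUo hcov
  exact ⟨{ ix := Fin N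
           fin := inferInstance
           x₀ := fun i => u i
           r := fun i => r (u i)
           K := fun i => K (u i)
           e := fun i => e (u i)
           ι := fun i => ι (u i)
           g := fun i => g (u i)
           chart := fun i => hc (u i)
           η := fun o => f o
           smooth := fun o => (f o).contMDiff.contDiff
           nonneg := fun o x => f.nonneg o x
           supp_none := hf none
           supp_some := fun i => hf (some i)
           sum_eq := fun x hx => by
            rw [← finsum_eq_sum_of_fintype]; exact f.sum_eq_one hx }⟩

theorem LipAtlas.hasCompactSupport (a : LipAtlas Ω) (hbdd : Bornology.IsBounded Ω)
    (i : Option a.ix) : HasCompactSupport (a.η i) := by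
  refine Metric.isCompact_of_isClosed_isBounded (isClosed_tsupport _) ?_
  cases i with
  | none => exact hbdd.subset a.supp_none
  | some i => exact Metric.isBounded_ball.subset (a.supp_some i)

/-- The interior patch function is supported in the open set `Ω`, so it vanishes on the boundary. -/
theorem LipAtlas.sum_frontier (a : LipAtlas Ω) (hopen : IsOpen Ω) {x : Vec (k + 1)}
    (hx : x ∈ frontier Ω) : ∑ i, a.η (some i) x = 1 := by
  have h1 := a.sum_eq x (frontier_subset_closure hx)
  have h2 : a.η none x = 0 := image_eq_zero_of_notMem_tsupport fun h => by
    rw [hopen.frontier_eq] at hx; exact hx.2 (a.supp_none h)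
  rw [Fintype.sum_option, h2, zero_add] at h1
  exact h1

theorem LipAtlas.frontier_subset (a : LipAtlas Ω) (hopen : IsOpen Ω) :
    frontier Ω ⊆ ⋃ i, Metric.ball (a.x₀ i) (a.r i) := by
  intro x hx
  have h1 := a.sum_frontier hopen hx
  obtain ⟨i, -, hi⟩ := Finset.exists_ne_zero_of_sum_ne_zero (h1 ▸ one_ne_zero)
  exact mem_iUnion.mpr ⟨i, a.supp_some i (by
    by_contra h; exact hi (image_eq_zero_of_notMem_tsupport h))⟩

theorem ae_mem_frontier {n : ℕ} (Ω : Set (Vec n)) :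
    ∀ᵐ x ∂(surfaceMeasure Ω), x ∈ frontier Ω :=
  ae_restrict_mem isClosed_frontier.measurableSet

theorem isFiniteMeasure_surfaceMeasure (hopen : IsOpen Ω) (hbdd : Bornology.IsBounded Ω)
    (hlip : HasLipschitzBoundary Ω) : IsFiniteMeasure (surfaceMeasure Ω) := by
  obtain ⟨a⟩ := exists_lipAtlas hopen hbdd hlip
  refine ⟨?_⟩
  have h0 : surfaceMeasure Ω univ = surfaceMeasure Ω (frontier Ω) := by
    simp [surfaceMeasure]
  rw [h0]
  refine (measure_mono (a.frontier_subset hopen)).trans_lt ((measure_iUnion_le _).trans_lt ?_)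
  rw [tsum_fintype, ENNReal.sum_lt_top]
  exact fun i _ => (a.chart i).surfaceMeasure_ball_lt_top hopen

/-- By Rademacher's theorem in each of the finitely many charts. -/
theorem ae_isExteriorNormal (hopen : IsOpen Ω) (hbdd : Bornology.IsBounded Ω)
    (hlip : HasLipschitzBoundary Ω) :
    ∀ᵐ x ∂(surfaceMeasure Ω), ∃ ν, IsExteriorNormal Ω x ν := by
  obtain ⟨a⟩ := exists_lipAtlas hopen hbdd hlip
  have h : ∀ᵐ x ∂(surfaceMeasure Ω), ∀ i, x ∈ Metric.ball (a.x₀ i) (a.r i) →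
      ∃ ν, IsExteriorNormal Ω x ν := ae_all_iff.mpr fun i =>
    (a.chart i).ae_of_graph hopen fun w hw hb => ⟨_, (a.chart i).isExteriorNormal hw hb⟩
  filter_upwards [h, ae_mem_frontier Ω] with x hx hxf
  obtain ⟨i, hi⟩ := mem_iUnion.mp (a.frontier_subset hopen hxf)
  exact hx i hi

theorem integrable_bulk_of_continuous {n : ℕ} {Ω : Set (Vec n)} {F : Type*} [NormedAddCommGroup F]
    (hbdd : Bornology.IsBounded Ω) {f : Vec n → F} (hf : Continuous f) :
    Integrable f (volume.restrict Ω) :=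
  (hf.continuousOn.integrableOn_compact hbdd.isCompact_closure).mono_set subset_closure

theorem isCompact_frontier_of_isBounded {n : ℕ} {Ω : Set (Vec n)} (hbdd : Bornology.IsBounded Ω) :
    IsCompact (frontier Ω) :=
  hbdd.isCompact_closure.of_isClosed_subset isClosed_frontier frontier_subset_closure

theorem integrable_bdry_of_continuous {n : ℕ} {Ω : Set (Vec n)} {F : Type*} [NormedAddCommGroup F]
    [IsFiniteMeasure (surfaceMeasure Ω)]
    (hbdd : Bornology.IsBounded Ω) {f : Vec n → F} (hf : Continuous f) :
    Integrable f (surfaceMeasure Ω) := by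
  obtain ⟨C, hC⟩ := (isCompact_frontier_of_isBounded hbdd).exists_bound_of_continuousOn
    hf.continuousOn
  exact Integrable.of_bound hf.aestronglyMeasurable C
    ((ae_mem_frontier Ω).mono fun x hx => hC x hx)

theorem measurable_exteriorNormal_apply {n : ℕ} (Ω : Set (Vec n)) (j : Fin n) :
    Measurable fun x => exteriorNormal Ω x j :=
  (EuclideanSpace.proj (𝕜 := ℝ) j).continuous.measurable.comp (measurable_exteriorNormal Ω)

theorem abs_exteriorNormal_apply_le {n : ℕ} (Ω : Set (Vec n)) (x : Vec n) (j : Fin n) :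
    |exteriorNormal Ω x j| ≤ 1 :=
  (PiLp.norm_apply_le (exteriorNormal Ω x) j).trans (norm_exteriorNormal_le Ω x)

theorem integrable_mul_exteriorNormal {n : ℕ} {Ω : Set (Vec n)} {X : Type*} [MeasurableSpace X]
    {μ : Measure X} {f : X → ℝ} {q : X → Vec n} (hq : Measurable q) (hf : Integrable f μ)
    (j : Fin n) : Integrable (fun x => f x * exteriorNormal Ω (q x) j) μ :=
  hf.mul_bdd (c := 1) ((measurable_exteriorNormal_apply Ω j).comp hq).aestronglyMeasurable
    (ae_of_all _ fun x => abs_exteriorNormal_apply_le Ω (q x) j)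

theorem continuous_pderiv {n : ℕ} {F : Type*} [NormedAddCommGroup F] [NormedSpace ℝ F]
    {f : Vec n → F} (hf : ContDiff ℝ 1 f) (j : Fin n) : Continuous (pderiv j f) :=
  (hf.continuous_fderiv (by norm_num)).clm_apply continuous_const

theorem setIntegral_pderiv_eq_zero {n : ℕ} {Ω : Set (Vec n)} {φ : Vec n → ℝ}
    (hφ : ContDiff ℝ 1 φ) (hc : HasCompactSupport φ) (hs : tsupport φ ⊆ Ω) (j : Fin n) :
    ∫ x in Ω, pderiv j φ x = 0 := by
  have hd : HasCompactSupport fun x => fderiv ℝ φ x (EuclideanSpace.single j 1) :=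
    hc.fderiv_apply (𝕜 := ℝ) _
  rw [setIntegral_eq_integral_of_forall_compl_eq_zero]
  · have hi : Integrable fun x => fderiv ℝ φ x (EuclideanSpace.single j 1) :=
      (continuous_pderiv hφ j).integrable_of_hasCompactSupport hd
    have h := integral_mul_fderiv_eq_neg_fderiv_mul_of_integrable (μ := (volume : Measure (Vec n)))
      (f := fun _ => (1 : ℝ)) (g := φ) (v := EuclideanSpace.single j 1) (by simp)
      (by simpa using hi)
      (by simpa using hφ.continuous.integrable_of_hasCompactSupport hc)
      (by simp) (fun x _ => hφ.differentiable (by norm_num) x)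
    simpa [pderiv] using h
  · intro x hx
    have : x ∉ tsupport (fderiv ℝ φ) := fun h' => hx (hs (tsupport_fderiv_subset ℝ h'))
    rw [pderiv, image_eq_zero_of_notMem_tsupport this]; rfl

/-- The Gauss-Green formula on a bounded Lipschitz domain. -/
theorem gauss_green (hopen : IsOpen Ω) (hbdd : Bornology.IsBounded Ω)
    (hlip : HasLipschitzBoundary Ω) {φ : Vec (k + 1) → ℝ} (hφ : ContDiff ℝ 1 φ)
    (j : Fin (k + 1)) :
    ∫ x in Ω, pderiv j φ x = ∫ x, φ x * exteriorNormal Ω x j ∂(surfaceMeasure Ω) := by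
  have := isFiniteMeasure_surfaceMeasure hopen hbdd hlip
  obtain ⟨a⟩ := exists_lipAtlas hopen hbdd hlip
  set ψ : Option a.ix → Vec (k + 1) → ℝ := fun i x => a.η i x * φ x
  have hψ : ∀ i, ContDiff ℝ 1 (ψ i) := fun i => ((a.smooth i).of_le (by simp)).mul hφ
  have hψc : ∀ i, HasCompactSupport (ψ i) := fun i => (a.hasCompactSupport hbdd i).mul_right
  have hts : ∀ i, tsupport (ψ i) ⊆ tsupport (a.η i) := fun i => tsupport_mul_subset_left
  have hsum : ∀ x ∈ closure Ω, ∑ i, ψ i x = φ x := fun x hx => by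
    rw [← Finset.sum_mul, a.sum_eq x hx, one_mul]
  have e1 : ∫ x in Ω, pderiv j φ x = ∑ i, ∫ x in Ω, pderiv j (ψ i) x := by
    rw [← integral_finsetSum _ fun i _ =>
      integrable_bulk_of_continuous hbdd (continuous_pderiv (hψ i) j)]
    refine setIntegral_congr_fun hopen.measurableSet fun x hx => ?_
    -- The identity holds on all of the open set `Ω`, hence near `x`, so it may be differentiated.
    have hev : φ =ᶠ[𝓝 x] fun y => ∑ i, ψ i y := by
      filter_upwards [hopen.mem_nhds hx] with y hy using (hsum y (subset_closure hy)).symm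
    simp only [pderiv]
    rw [hev.fderiv_eq, fderiv_fun_sum fun i _ => (hψ i).differentiable (by norm_num) x]
    simp
  have e2 : ∫ x, φ x * exteriorNormal Ω x j ∂(surfaceMeasure Ω)
      = ∑ i, ∫ x, ψ i x * exteriorNormal Ω x j ∂(surfaceMeasure Ω) := by
    rw [← integral_finsetSum _ fun i _ => integrable_mul_exteriorNormal (q := fun x => x)
      measurable_id (integrable_bdry_of_continuous hbdd (hψ i).continuous) j]
    refine integral_congr_ae ((ae_mem_frontier Ω).mono fun x hx => ?_)
    simp only
    rw [← Finset.sum_mul, hsum x (frontier_subset_closure hx)]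
  rw [e1, e2]
  refine Finset.sum_congr rfl fun i _ => ?_
  cases i with
  | none =>
    rw [setIntegral_pderiv_eq_zero (hψ none) (hψc none) ((hts none).trans a.supp_none)]
    symm
    refine integral_eq_zero_of_ae ((ae_mem_frontier Ω).mono fun x hx => ?_)
    have : ψ none x = 0 := image_eq_zero_of_notMem_tsupport fun h => by
      rw [hopen.frontier_eq] at hx; exact hx.2 (a.supp_none (hts none h))
    simp [this]
  | some i =>
    exact (a.chart i).gauss_green hopen (hψ _) (hψc _) ((hts _).trans (a.supp_some i)) j

/-- There is a smooth vector field which is uniformly transversal to `∂Ω`. -/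
theorem exists_transversal (hopen : IsOpen Ω) (hbdd : Bornology.IsBounded Ω)
    (hlip : HasLipschitzBoundary Ω) :
    ∃ (X : Fin (k + 1) → Vec (k + 1) → ℝ) (c : ℝ), 0 < c ∧ (∀ j, ContDiff ℝ ∞ (X j)) ∧
      ∀ᵐ x ∂(surfaceMeasure Ω), c ≤ ∑ j, X j x * exteriorNormal Ω x j := by
  obtain ⟨a⟩ := exists_lipAtlas hopen hbdd hlip
  set s : a.ix → ℝ := fun i => √(1 + (a.K i : ℝ) ^ 2)
  have hs : ∀ i, 0 < s i := fun i => Real.sqrt_pos.mpr (by positivity)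
  -- A positive lower bound for all the cosines `(s i)⁻¹`; the summand `1` keeps it meaningful even
  -- without charts.
  set c : ℝ := (1 + ∑ i, s i)⁻¹
  have hS : 0 ≤ ∑ i, s i := Finset.sum_nonneg fun i _ => (hs i).le
  have hcs : ∀ i, c ≤ (s i)⁻¹ := fun i => by
    refine inv_anti₀ (hs i) ?_
    have := Finset.single_le_sum (f := s) (fun i _ => (hs i).le) (Finset.mem_univ i)
    linarith
  -- In each chart `-e` points outward at a uniform angle to the tangent planes. The partition of
  -- unity averages these directions, and the lower bound survives averaging because it is linear in
  -- the field.
  refine ⟨fun j x => ∑ i, a.η (some i) x * (-(a.e i) j), c, by positivity, fun j => ?_, ?_⟩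
  · exact ContDiff.sum fun i _ => (a.smooth (some i)).mul contDiff_const
  have h : ∀ᵐ x ∂(surfaceMeasure Ω), ∀ i, x ∈ Metric.ball (a.x₀ i) (a.r i) →
      (s i)⁻¹ ≤ inner ℝ (-(a.e i)) (exteriorNormal Ω x) := ae_all_iff.mpr fun i =>
    (a.chart i).ae_of_graph hopen fun w hw hb => (a.chart i).inner_exteriorNormal_le hw hb
  filter_upwards [h, ae_mem_frontier Ω] with x hx hxf
  have e1 : ∑ j, (∑ i, a.η (some i) x * (-(a.e i) j)) * exteriorNormal Ω x j
      = ∑ i, a.η (some i) x * inner ℝ (-(a.e i)) (exteriorNormal Ω x) := by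
    simp_rw [Finset.sum_mul]
    rw [Finset.sum_comm]
    refine Finset.sum_congr rfl fun i _ => ?_
    rw [PiLp.inner_apply, Finset.mul_sum]
    refine Finset.sum_congr rfl fun j _ => ?_
    simp [mul_comm, mul_left_comm]
  rw [e1]
  calc c = ∑ i, a.η (some i) x * c := by
        rw [← Finset.sum_mul, a.sum_frontier hopen hxf, one_mul]
    _ ≤ _ := Finset.sum_le_sum fun i _ => ?_
  by_cases hb : x ∈ Metric.ball (a.x₀ i) (a.r i)
  · exact mul_le_mul_of_nonneg_left ((hcs i).trans (hx i hb)) (a.nonneg _ _)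
  · have : a.η (some i) x = 0 := image_eq_zero_of_notMem_tsupport fun h => hb (a.supp_some i h)
    simp [this]

end OccMeas

end

noncomputable section

namespace OccMeas

/-! ### Gauss-Green formula for functions of a Sobolev function -/

/-- The total derivative in direction `j` of `x ↦ Φ(x, y(x))` when `∂y/∂x_j = z`. -/
def totalD {n m : ℕ} (Φ : Vec n × Vec m → ℝ) (j : Fin n) (x : Vec n) (y z : Vec m) : ℝ :=
  fderiv ℝ Φ (x, y) (EuclideanSpace.single j 1, z)

section

variable {n m : ℕ}

theorem hasFDerivAt_left {Φ : Vec n × Vec m → ℝ} (hΦ : ContDiff ℝ 1 Φ) (x : Vec n) (y : Vec m) :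
    HasFDerivAt (fun x' => Φ (x', y))
      ((fderiv ℝ Φ (x, y)).comp (ContinuousLinearMap.inl ℝ (Vec n) (Vec m))) x :=
  (hΦ.differentiable (by norm_num) (x, y)).hasFDerivAt.comp x (hasFDerivAt_prodMk_left x y)

theorem hasFDerivAt_right {Φ : Vec n × Vec m → ℝ} (hΦ : ContDiff ℝ 1 Φ) (x : Vec n) (y : Vec m) :
    HasFDerivAt (fun y' => Φ (x, y'))
      ((fderiv ℝ Φ (x, y)).comp (ContinuousLinearMap.inr ℝ (Vec n) (Vec m))) y :=
  (hΦ.differentiable (by norm_num) (x, y)).hasFDerivAt.comp y (hasFDerivAt_prodMk_right x y)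

theorem totalD_eq {Φ : Vec n × Vec m → ℝ} (hΦ : ContDiff ℝ 1 Φ) (j : Fin n) (x : Vec n)
    (y z : Vec m) :
    totalD Φ j x y z = pderiv j (fun x' => Φ (x', y)) x + fderiv ℝ (fun y' => Φ (x, y')) y z := by
  rw [pderiv, (hasFDerivAt_left hΦ x y).fderiv, (hasFDerivAt_right hΦ x y).fderiv]
  simp only [ContinuousLinearMap.comp_apply, ContinuousLinearMap.inl_apply,
    ContinuousLinearMap.inr_apply, totalD]
  rw [← map_add]; simp

theorem pderiv_comp {Φ : Vec n × Vec m → ℝ} (hΦ : ContDiff ℝ 1 Φ) {u : Vec n → Vec m}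
    (hu : ContDiff ℝ 1 u) (j : Fin n) (x : Vec n) :
    pderiv j (fun x => Φ (x, u x)) x = totalD Φ j x (u x) (pderiv j u x) := by
  have h1 : HasFDerivAt (fun x => (x, u x))
      ((ContinuousLinearMap.id ℝ (Vec n)).prod (fderiv ℝ u x)) x :=
    (hasFDerivAt_id x).prodMk (hu.differentiable (by norm_num) x).hasFDerivAt
  have := (hΦ.differentiable (by norm_num) (x, u x)).hasFDerivAt.comp x h1
  rw [pderiv, HasFDerivAt.fderiv (f := fun x => Φ (x, u x)) this]
  rfl

theorem aestronglyMeasurable_totalD {Φ : Vec n × Vec m → ℝ} (hΦ : ContDiff ℝ 1 Φ) (j : Fin n)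
    {X : Type*} [MeasurableSpace X] {μ : Measure X} {q : X → Vec n} {y z : X → Vec m}
    (hq : AEStronglyMeasurable q μ)
    (hy : AEStronglyMeasurable y μ) (hz : AEStronglyMeasurable z μ) :
    AEStronglyMeasurable (fun x => totalD Φ j (q x) (y x) (z x)) μ := by
  have hc : Continuous fun w : (Vec n × Vec m) × Vec m =>
      fderiv ℝ Φ w.1 (EuclideanSpace.single j 1, w.2) := by
    have := hΦ.continuous_fderiv (by norm_num)
    fun_prop
  exact hc.comp_aestronglyMeasurable ((hq.prodMk hy).prodMk hz)

theorem abs_totalD_le (Φ : Vec n × Vec m → ℝ) (j : Fin n) (x : Vec n) (y z : Vec m) :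
    |totalD Φ j x y z| ≤ ‖fderiv ℝ Φ (x, y)‖ * (1 + ‖z‖) := by
  refine ((fderiv ℝ Φ (x, y)).le_opNorm _).trans (mul_le_mul_of_nonneg_left ?_ (norm_nonneg _))
  have : ‖(EuclideanSpace.single j (1 : ℝ) : Vec n)‖ = 1 := by simp
  rw [Prod.norm_def, this]
  exact max_le (by linarith [norm_nonneg z]) (by linarith [norm_nonneg z])

end

section

variable {k m : ℕ} {Ω : Set (Vec (k + 1))}

theorem exists_subseq_ae {u : ℕ → Vec (k + 1) → Vec m} {y t : Vec (k + 1) → Vec m}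
    (hu : ∀ i, ContDiff ℝ ∞ (u i)) (hy : AEStronglyMeasurable y (volume.restrict Ω))
    (ht : AEStronglyMeasurable t (surfaceMeasure Ω))
    (h1 : Tendsto (fun i => eLpNorm (fun x => u i x - y x) 1 (volume.restrict Ω)) atTop (𝓝 0))
    (h2 : Tendsto (fun i => eLpNorm (fun x => u i x - t x) 1 (surfaceMeasure Ω)) atTop (𝓝 0)) :
    ∃ ns : ℕ → ℕ, StrictMono ns ∧
      (∀ᵐ x ∂(volume.restrict Ω), Tendsto (fun i => u (ns i) x) atTop (𝓝 (y x))) ∧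
      ∀ᵐ x ∂(surfaceMeasure Ω), Tendsto (fun i => u (ns i) x) atTop (𝓝 (t x)) := by
  obtain ⟨a, ha, ha'⟩ := (tendstoInMeasure_of_tendsto_eLpNorm one_ne_zero
    (fun i => (hu i).continuous.aestronglyMeasurable) hy h1).exists_seq_tendsto_ae
  obtain ⟨b, hb, hb'⟩ := (tendstoInMeasure_of_tendsto_eLpNorm (f := fun i => u (a i)) one_ne_zero
    (fun i => (hu (a i)).continuous.aestronglyMeasurable) ht
    (h2.comp ha.tendsto_atTop)).exists_seq_tendsto_ae
  exact ⟨a ∘ b, ha.comp hb, ha'.mono fun x hx => hx.comp hb.tendsto_atTop, hb'⟩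

theorem exists_bound_of_zero_outside {Φ : Vec (k + 1) × Vec m → ℝ} (hΦ : ContDiff ℝ 1 Φ) {R : ℝ}
    (hR : ∀ x y, R ≤ ‖y‖ → Φ (x, y) = 0) (hbdd : Bornology.IsBounded Ω) :
    ∃ C, 0 ≤ C ∧ ∀ x ∈ closure Ω, ∀ y, |Φ (x, y)| ≤ C ∧ ‖fderiv ℝ Φ (x, y)‖ ≤ C := by
  have hK : IsCompact (closure Ω ×ˢ Metric.closedBall (0 : Vec m) R) :=
    hbdd.isCompact_closure.prod (isCompact_closedBall _ _)
  obtain ⟨C₁, h1⟩ := hK.exists_bound_of_continuousOn hΦ.continuous.continuousOn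
  obtain ⟨C₂, h2⟩ := hK.exists_bound_of_continuousOn
    (hΦ.continuous_fderiv (by norm_num)).continuousOn
  refine ⟨max 0 (max C₁ C₂), le_max_left _ _, fun x hx y => ?_⟩
  by_cases hy : ‖y‖ ≤ R
  · have hm : (x, y) ∈ closure Ω ×ˢ Metric.closedBall (0 : Vec m) R := ⟨hx, by simpa using hy⟩
    exact ⟨(h1 _ hm).trans (by simp), (h2 _ hm).trans (by simp)⟩
  · rw [not_le] at hy
    have hz : Φ =ᶠ[𝓝 (x, y)] fun _ => 0 := by
      have : IsOpen {q : Vec (k + 1) × Vec m | R < ‖q.2‖} := isOpen_lt (by fun_prop) (by fun_prop)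
      filter_upwards [this.mem_nhds hy] with q hq using hR q.1 q.2 (le_of_lt hq)
    rw [hz.fderiv_eq, hz.eq_of_nhds]
    simp

/-- Gauss-Green holds for `Φ (x, u x)` with smooth `u`. Since `Φ` vanishes for large `y`, it and its
derivative are bounded over the closure of `Ω`, so the formula survives `W^{1,1}` approximation with
convergence of traces. -/
theorem integral_totalD_of_zero_outside (hopen : IsOpen Ω) (hbdd : Bornology.IsBounded Ω)
    (hlip : HasLipschitzBoundary Ω) {y : Vec (k + 1) → Vec m} {G : Vec (k + 1) → Mat m (k + 1)}
    {t : Vec (k + 1) → Vec m} (hy : AEStronglyMeasurable y (volume.restrict Ω))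
    (hG : Integrable G (volume.restrict Ω)) (htr : IsTrace Ω y G t)
    {Φ : Vec (k + 1) × Vec m → ℝ} (hΦ : ContDiff ℝ 1 Φ) {R : ℝ}
    (hR : ∀ x y, R ≤ ‖y‖ → Φ (x, y) = 0) (j : Fin (k + 1)) :
    ∫ x in Ω, totalD Φ j x (y x) (G x j)
      = ∫ x, Φ (x, t x) * exteriorNormal Ω x j ∂(surfaceMeasure Ω) := by
  have := isFiniteMeasure_surfaceMeasure hopen hbdd hlip
  have hfin : IsFiniteMeasure (volume.restrict Ω) := ⟨by simpa using hbdd.measure_lt_top⟩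
  obtain ⟨ht, u, hu, hu1, hu2, hu3⟩ := htr
  obtain ⟨ns, hns, hbulk, hbdry⟩ := exists_subseq_ae hu hy ht hu1 hu3
  obtain ⟨C, hC0, hC⟩ := exists_bound_of_zero_outside hΦ hR hbdd
  have hGj : Integrable (fun x => G x j) (volume.restrict Ω) := hG.eval j
  set v := fun i => u (ns i)
  have hv : ∀ i, ContDiff ℝ 1 (v i) := fun i => (hu (ns i)).of_le (by simp)
  have hgg : ∀ i, ∫ x in Ω, totalD Φ j x (v i x) (pderiv j (v i) x)
      = ∫ x, Φ (x, v i x) * exteriorNormal Ω x j ∂(surfaceMeasure Ω) := by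
    intro i
    rw [← gauss_green hopen hbdd hlip (φ := fun x => Φ (x, v i x))
      (hΦ.comp (contDiff_id.prodMk (hv i))) j]
    exact integral_congr_ae (ae_of_all _ fun x => (pderiv_comp hΦ (hv i) j x).symm)
  have hlimb : Tendsto (fun i => ∫ x, Φ (x, v i x) * exteriorNormal Ω x j ∂(surfaceMeasure Ω)) atTop
      (𝓝 (∫ x, Φ (x, t x) * exteriorNormal Ω x j ∂(surfaceMeasure Ω))) := by
    refine tendsto_integral_of_dominated_convergence (fun _ => C) (fun i => ?_)
      (integrable_const C) (fun i => ?_) ?_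
    · exact (hΦ.continuous.comp (continuous_id.prodMk (hv i).continuous)).aestronglyMeasurable.mul
        (measurable_exteriorNormal_apply Ω j).aestronglyMeasurable
    · filter_upwards [ae_mem_frontier Ω] with x hx
      rw [norm_mul]
      have h1 := (hC x (frontier_subset_closure hx) (v i x)).1
      have h2 := abs_exteriorNormal_apply_le Ω x j
      calc _ ≤ C * 1 := mul_le_mul h1 h2 (abs_nonneg _) hC0
        _ = C := mul_one C
    · filter_upwards [hbdry] with x hx
      exact ((hΦ.continuous.tendsto _).comp (tendsto_const_nhds.prodMk_nhds hx)).mul_const _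
  have hmem : ∀ᵐ x ∂(volume.restrict Ω), x ∈ Ω := ae_restrict_mem hopen.measurableSet
  have hcd := hΦ.continuous_fderiv (by norm_num)
  have hbound : ∀ i, ∀ᵐ x ∂(volume.restrict Ω),
      ‖totalD Φ j x (v i x) (G x j)‖ ≤ C * (1 + ‖G x j‖) := fun i => by
    filter_upwards [hmem] with x hx
    exact (abs_totalD_le _ _ _ _ _).trans (mul_le_mul_of_nonneg_right
      (hC x (subset_closure hx) _).2 (by positivity))
  have hbint : Integrable (fun x => C * (1 + ‖G x j‖)) (volume.restrict Ω) :=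
    ((integrable_const 1).add hGj.norm).const_mul C
  have hmeas : ∀ i, AEStronglyMeasurable (fun x => totalD Φ j x (v i x) (G x j))
      (volume.restrict Ω) := fun i => aestronglyMeasurable_totalD hΦ j
        aestronglyMeasurable_id (hv i).continuous.aestronglyMeasurable hGj.1
  have hlim1 : Tendsto (fun i => ∫ x in Ω, totalD Φ j x (v i x) (G x j)) atTop
      (𝓝 (∫ x in Ω, totalD Φ j x (y x) (G x j))) := by
    refine tendsto_integral_of_dominated_convergence _ hmeas hbint hbound ?_
    filter_upwards [hbulk] with x hx
    exact ((ContinuousLinearMap.apply ℝ ℝ _).continuous.tendsto _).comp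
      ((hcd.tendsto _).comp (tendsto_const_nhds.prodMk_nhds hx))
  -- The derivatives of the approximants converge only in `L¹`, with no common dominating function.
  -- `totalD` is affine in `z` with bounded slope, so replacing them by `G` costs at most `C` times
  -- the `L¹` distance.
  have hlim2 : Tendsto (fun i => ∫ x in Ω, (totalD Φ j x (v i x) (pderiv j (v i) x)
      - totalD Φ j x (v i x) (G x j))) atTop (𝓝 0) := by
    have hz : Tendsto (fun i => ENNReal.ofReal C *
        eLpNorm (fun x => pderiv j (v i) x - G x j) 1 (volume.restrict Ω)) atTop (𝓝 0) := by
      have := ENNReal.Tendsto.const_mul ((hu2 j).comp hns.tendsto_atTop)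
        (Or.inr (ENNReal.ofReal_ne_top (r := C)))
      simpa using this
    rw [tendsto_zero_iff_enorm_tendsto_zero]
    refine tendsto_of_tendsto_of_tendsto_of_le_of_le tendsto_const_nhds hz (fun _ => zero_le)
      fun i => ?_
    refine (enorm_integral_le_lintegral_enorm _).trans ?_
    rw [eLpNorm_one_eq_lintegral_enorm, ← lintegral_const_mul' _ _ ENNReal.ofReal_ne_top]
    refine lintegral_mono_ae ?_
    filter_upwards [hmem] with x hx
    have e : totalD Φ j x (v i x) (pderiv j (v i) x) - totalD Φ j x (v i x) (G x j)
        = fderiv ℝ Φ (x, v i x) (0, pderiv j (v i) x - G x j) := by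
      simp only [totalD]
      rw [← map_sub]; simp
    rw [e, ← ofReal_norm, ← ofReal_norm, ← ENNReal.ofReal_mul hC0]
    refine ENNReal.ofReal_le_ofReal (((fderiv ℝ Φ (x, v i x)).le_opNorm _).trans ?_)
    rw [Prod.norm_def]
    simp only [norm_zero, norm_nonneg, sup_of_le_right]
    exact mul_le_mul_of_nonneg_right (hC x (subset_closure hx) _).2 (norm_nonneg _)
  have hsum := hlim2.add hlim1
  rw [zero_add] at hsum
  refine tendsto_nhds_unique hsum (hlimb.congr fun i => ?_)
  have i1 : Integrable (fun x => totalD Φ j x (v i x) (G x j)) (volume.restrict Ω) :=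
    hbint.mono' (hmeas i) (hbound i)
  have i2 : Integrable (fun x => totalD Φ j x (v i x) (pderiv j (v i) x)) (volume.restrict Ω) := by
    refine integrable_bulk_of_continuous hbdd ?_
    have := (hv i).continuous
    have := continuous_pderiv (hv i) j
    unfold totalD
    fun_prop
  rw [integral_sub i2 i1, sub_add_cancel, hgg]

/-- Smooth cutoff functions on `ℝᵐ`. -/
theorem exists_cutoffs (m : ℕ) : ∃ (χ : ℕ → Vec m → ℝ) (C : ℝ), 0 ≤ C ∧
    (∀ N, ContDiff ℝ ∞ (χ N)) ∧ (∀ N y, 0 ≤ χ N y ∧ χ N y ≤ 1) ∧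
    (∀ (N : ℕ) y, 2 * ((N : ℝ) + 1) ≤ ‖y‖ → χ N y = 0) ∧ (∀ (N : ℕ) y, ‖y‖ ≤ (N : ℝ) + 1 → χ N y = 1) ∧
    ∀ N y, ‖fderiv ℝ (χ N) y‖ * max 1 ‖y‖ ≤ C := by
  let b : ContDiffBump (0 : Vec m) := ⟨1, 2, one_pos, one_lt_two⟩
  have hbs : ContDiff ℝ ∞ b := b.contDiff
  obtain ⟨C, hC⟩ := (b.hasCompactSupport.fderiv ℝ).exists_bound_of_continuous
    (hbs.continuous_fderiv (by simp))
  have hC0 : 0 ≤ C := (norm_nonneg _).trans (hC 0)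
  let χ : ℕ → Vec m → ℝ := fun N y => b (((N : ℝ) + 1)⁻¹ • y)
  have hsm : ∀ N, ContDiff ℝ ∞ (χ N) := fun N => hbs.comp (contDiff_const_smul _)
  have hz : ∀ (N : ℕ) y, 2 * ((N : ℝ) + 1) ≤ ‖y‖ → χ N y = 0 := fun N y h => by
    refine b.zero_of_le_dist ?_
    have hN : (0 : ℝ) < N + 1 := by positivity
    rw [dist_zero_right, norm_smul, norm_inv, Real.norm_of_nonneg hN.le, inv_mul_eq_div,
      le_div_iff₀ hN]
    exact h
  refine ⟨χ, 2 * C, by positivity, hsm, fun N y => ⟨b.nonneg, b.le_one⟩, hz, fun N y h => ?_,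
    fun N y => ?_⟩
  · refine b.one_of_mem_closedBall ?_
    have hN : (0 : ℝ) < N + 1 := by positivity
    rw [Metric.mem_closedBall, dist_zero_right, norm_smul, norm_inv, Real.norm_of_nonneg hN.le,
      inv_mul_eq_div, div_le_iff₀ hN]
    simpa [b] using h
  · have hN : (0 : ℝ) < N + 1 := by positivity
    by_cases hy : ‖y‖ ≤ 2 * ((N : ℝ) + 1)
    · have hd : fderiv ℝ (χ N) y = ((N : ℝ) + 1)⁻¹ • fderiv ℝ b (((N : ℝ) + 1)⁻¹ • y) :=
        fderiv_comp_smul (f := (b : Vec m → ℝ)) (c := ((N : ℝ) + 1)⁻¹)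
      -- The gradient has size `C / (N + 1)` and lives where `‖y‖ ≤ 2 (N + 1)`, so its product with
      -- `max 1 ‖y‖` is bounded uniformly in `N`.
      have hmax : max 1 ‖y‖ ≤ 2 * ((N : ℝ) + 1) := max_le (by linarith) hy
      rw [hd, norm_smul, norm_inv, Real.norm_of_nonneg hN.le]
      calc _ ≤ ((N : ℝ) + 1)⁻¹ * C * (2 * ((N : ℝ) + 1)) := by
            gcongr
            exact hC _
        _ = 2 * C := by field_simp
    · rw [not_le] at hy
      have hev : χ N =ᶠ[𝓝 y] fun _ => 0 := by
        have : IsOpen {q : Vec m | 2 * ((N : ℝ) + 1) < ‖q‖} := isOpen_lt (by fun_prop) (by fun_prop)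
        filter_upwards [this.mem_nhds hy] with q hq using hz N q (le_of_lt hq)
      rw [hev.fderiv_eq]
      simpa using hC0

end

end OccMeas

end

/-! ### Gauss-Green with unbounded integrands and integrability of traces -/

noncomputable section

namespace OccMeas

section

variable {k m : ℕ} {Ω : Set (Vec (k + 1))}

theorem totalD_cutoff_mul {χ : Vec m → ℝ} (hχ : ContDiff ℝ 1 χ) {n : ℕ} {Φ : Vec n × Vec m → ℝ}
    (hΦ : ContDiff ℝ 1 Φ) (j : Fin n) (x : Vec n) (y z : Vec m) :
    totalD (fun q => χ q.2 * Φ q) j x y z = χ y * totalD Φ j x y z + Φ (x, y) * fderiv ℝ χ y z := by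
  have h1 : HasFDerivAt (fun q : Vec n × Vec m => χ q.2)
      ((fderiv ℝ χ y).comp (ContinuousLinearMap.snd ℝ (Vec n) (Vec m))) (x, y) :=
    HasFDerivAt.comp (x, y) (hχ.differentiable (by norm_num) y).hasFDerivAt hasFDerivAt_snd
  have h2 := (hΦ.differentiable (by norm_num) (x, y)).hasFDerivAt
  have := h1.mul h2
  rw [totalD, HasFDerivAt.fderiv (f := fun q : Vec n × Vec m => χ q.2 * Φ q) this]
  simp [totalD]

/-- The product rule leaves the term `Φ · ∇χ · z`. As `∇χ` decays like `C / max 1 ‖y‖`, it is enough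
that `|Φ| ‖z‖` be dominated with the extra factor `max 1 ‖y‖`, which is the form of the hypothesis.
-/
theorem abs_totalD_cutoff_le {χ : Vec m → ℝ} (hχ : ContDiff ℝ 1 χ) {n : ℕ}
    {Φ : Vec n × Vec m → ℝ} (hΦ : ContDiff ℝ 1 Φ) (j : Fin n) (x : Vec n) (y z : Vec m)
    {C a : ℝ} (h01 : 0 ≤ χ y ∧ χ y ≤ 1) (hC : ‖fderiv ℝ χ y‖ * max 1 ‖y‖ ≤ C)
    (ha : |totalD Φ j x y z| ≤ a ∧ |Φ (x, y)| * ‖z‖ ≤ a * max 1 ‖y‖) :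
    |totalD (fun q => χ q.2 * Φ q) j x y z| ≤ (1 + C) * a := by
  rw [totalD_cutoff_mul hχ hΦ]
  have ha0 : 0 ≤ a := (abs_nonneg _).trans ha.1
  have hM : 0 < max 1 ‖y‖ := lt_max_of_lt_left one_pos
  have e1 : |χ y * totalD Φ j x y z| ≤ a := by
    rw [abs_mul, abs_of_nonneg h01.1]
    exact (mul_le_mul h01.2 ha.1 (abs_nonneg _) zero_le_one).trans_eq (one_mul a)
  have e2 : |Φ (x, y) * fderiv ℝ χ y z| ≤ C * a := by
    rw [abs_mul]
    have h1 : |fderiv ℝ χ y z| ≤ ‖fderiv ℝ χ y‖ * ‖z‖ := (fderiv ℝ χ y).le_opNorm z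
    have h2 : |Φ (x, y)| * |fderiv ℝ χ y z| ≤ ‖fderiv ℝ χ y‖ * (a * max 1 ‖y‖) := by
      calc _ ≤ |Φ (x, y)| * (‖fderiv ℝ χ y‖ * ‖z‖) := by gcongr
        _ = ‖fderiv ℝ χ y‖ * (|Φ (x, y)| * ‖z‖) := by ring
        _ ≤ _ := mul_le_mul_of_nonneg_left ha.2 (norm_nonneg _)
    calc _ ≤ _ := h2
      _ = (‖fderiv ℝ χ y‖ * max 1 ‖y‖) * a := by ring
      _ ≤ C * a := by gcongr
  calc _ ≤ _ := abs_add_le _ _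
    _ ≤ a + C * a := add_le_add e1 e2
    _ = _ := by ring

theorem contDiff_cutoff_mul {χ : Vec m → ℝ} (hχ : ContDiff ℝ 1 χ) {n : ℕ} {Φ : Vec n × Vec m → ℝ}
    (hΦ : ContDiff ℝ 1 Φ) : ContDiff ℝ 1 fun q : Vec n × Vec m => χ q.2 * Φ q :=
  (hχ.comp contDiff_snd).mul hΦ

/-- The Gauss-Green formula for `x ↦ Φ(x, y(x))` when the integrands are dominated. -/
theorem integral_totalD (hopen : IsOpen Ω) (hbdd : Bornology.IsBounded Ω)
    (hlip : HasLipschitzBoundary Ω) {y : Vec (k + 1) → Vec m} {G : Vec (k + 1) → Mat m (k + 1)}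
    {t : Vec (k + 1) → Vec m} (hy : AEStronglyMeasurable y (volume.restrict Ω))
    (hG : Integrable G (volume.restrict Ω)) (htr : IsTrace Ω y G t)
    {Φ : Vec (k + 1) × Vec m → ℝ} (hΦ : ContDiff ℝ 1 Φ) (j : Fin (k + 1))
    {a : Vec (k + 1) → ℝ} (hai : Integrable a (volume.restrict Ω))
    (ha : ∀ᵐ x ∂(volume.restrict Ω), |totalD Φ j x (y x) (G x j)| ≤ a x ∧
      |Φ (x, y x)| * ‖G x j‖ ≤ a x * max 1 ‖y x‖)
    (hb : Integrable (fun x => Φ (x, t x)) (surfaceMeasure Ω)) :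
    ∫ x in Ω, totalD Φ j x (y x) (G x j)
      = ∫ x, Φ (x, t x) * exteriorNormal Ω x j ∂(surfaceMeasure Ω) := by
  obtain ⟨χ, C, hC0, hsm, h01, hz, h1, hder⟩ := exists_cutoffs m
  have hs1 : ∀ N, ContDiff ℝ 1 (χ N) := fun N => (hsm N).of_le (by simp)
  have hgg := fun N => integral_totalD_of_zero_outside hopen hbdd hlip hy hG htr
    (contDiff_cutoff_mul (hs1 N) hΦ) (R := 2 * ((N : ℝ) + 1))
    (fun x y h => by simp [hz N y h]) j
  have hev : ∀ y : Vec m, ∀ᶠ N : ℕ in atTop, ‖y‖ < (N : ℝ) + 1 := fun y => by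
    obtain ⟨M, hM⟩ := exists_nat_gt ‖y‖
    filter_upwards [eventually_ge_atTop M] with N hN
    have : (M : ℝ) ≤ N := by exact_mod_cast hN
    linarith
  have hl : Tendsto (fun N => ∫ x in Ω, totalD (fun q => χ N q.2 * Φ q) j x (y x) (G x j)) atTop
      (𝓝 (∫ x in Ω, totalD Φ j x (y x) (G x j))) := by
    refine tendsto_integral_of_dominated_convergence (fun x => (1 + C) * a x) (fun N => ?_)
      (hai.const_mul _) (fun N => ?_) (ae_of_all _ fun x => ?_)
    · exact aestronglyMeasurable_totalD (contDiff_cutoff_mul (hs1 N) hΦ) j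
        aestronglyMeasurable_id hy (hG.eval j).1
    · filter_upwards [ha] with x hx
      exact abs_totalD_cutoff_le (hs1 N) hΦ j x _ _ (h01 N _) (hder N _) hx
    · refine tendsto_const_nhds.congr' ?_
      filter_upwards [hev (y x)] with N hN
      rw [totalD_cutoff_mul (hs1 N) hΦ, h1 N _ hN.le]
      -- The inequality for `‖y x‖` is strict, so the cutoff is `1` in a neighbourhood and its
      -- derivative drops out too.
      have he : χ N =ᶠ[𝓝 (y x)] fun _ => 1 := by
        have : IsOpen {q : Vec m | ‖q‖ < (N : ℝ) + 1} := isOpen_lt (by fun_prop) (by fun_prop)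
        filter_upwards [this.mem_nhds hN] with q hq using h1 N q (le_of_lt hq)
      rw [he.fderiv_eq]
      simp
  have hr : Tendsto (fun N => ∫ x, χ N (t x) * Φ (x, t x) * exteriorNormal Ω x j
      ∂(surfaceMeasure Ω)) atTop
      (𝓝 (∫ x, Φ (x, t x) * exteriorNormal Ω x j ∂(surfaceMeasure Ω))) := by
    refine tendsto_integral_of_dominated_convergence (fun x => |Φ (x, t x)|) (fun N => ?_)
      hb.abs (fun N => ae_of_all _ fun x => ?_) (ae_of_all _ fun x => ?_)
    · exact (((hsm N).continuous.comp_aestronglyMeasurable htr.1).mul hb.1).mul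
        (measurable_exteriorNormal_apply Ω j).aestronglyMeasurable
    · rw [norm_mul, norm_mul, Real.norm_of_nonneg (h01 N _).1]
      calc _ ≤ 1 * |Φ (x, t x)| * 1 := by
            gcongr
            · exact (h01 N _).2
            · rfl
            · exact abs_exteriorNormal_apply_le Ω x j
        _ = _ := by ring
    · refine tendsto_const_nhds.congr' ?_
      filter_upwards [hev (t x)] with N hN
      rw [h1 N _ hN.le, one_mul]
  exact tendsto_nhds_unique hl (hr.congr fun N => (hgg N).symm)

/-- A bulk bound of `W(y)` and of its gradient in terms of `a` bounds the trace integral. -/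
theorem lintegral_trace_lt_top (hopen : IsOpen Ω) (hbdd : Bornology.IsBounded Ω)
    (hlip : HasLipschitzBoundary Ω) {y : Vec (k + 1) → Vec m} {G : Vec (k + 1) → Mat m (k + 1)}
    {t : Vec (k + 1) → Vec m} (hy : AEStronglyMeasurable y (volume.restrict Ω))
    (hG : Integrable G (volume.restrict Ω)) (htr : IsTrace Ω y G t)
    {W : Vec m → ℝ} (hW : ContDiff ℝ 1 W) (hW0 : ∀ y, 0 ≤ W y)
    {a : Vec (k + 1) → ℝ} (hai : Integrable a (volume.restrict Ω))
    (ha : ∀ᵐ x ∂(volume.restrict Ω), W (y x) ≤ a x ∧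
      ∀ j, ‖fderiv ℝ W (y x)‖ * ‖G x j‖ ≤ a x ∧ W (y x) * ‖G x j‖ ≤ a x * max 1 ‖y x‖) :
    ∃ C : ℝ, ∫⁻ x, ENNReal.ofReal (W (t x)) ∂(surfaceMeasure Ω)
      ≤ ENNReal.ofReal (C * ∫ x in Ω, a x) := by
  obtain ⟨χ, C, hC0, hsm, h01, hz, h1, hder⟩ := exists_cutoffs m
  have hs1 : ∀ N, ContDiff ℝ 1 (χ N) := fun N => (hsm N).of_le (by simp)
  obtain ⟨X, c, hc, hX, hXc⟩ := exists_transversal hopen hbdd hlip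
  have := isFiniteMeasure_surfaceMeasure hopen hbdd hlip
  have hX1 : ∀ j, ContDiff ℝ 1 (X j) := fun j => (hX j).of_le (by simp)
  -- Summed over `j`, the boundary terms of these functions give `W (t x)` times the normal
  -- component of the transversal field, which is at least `c W (t x)`.
  set Φ : Fin (k + 1) → Vec (k + 1) × Vec m → ℝ := fun j q => X j q.1 * W q.2
  have hΦ : ∀ j, ContDiff ℝ 1 (Φ j) := fun j =>
    ((hX1 j).comp contDiff_fst).mul (hW.comp contDiff_snd)
  have htot : ∀ j x y z, totalD (Φ j) j x y z = pderiv j (X j) x * W y + X j x * fderiv ℝ W y z := by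
    intro j x y z
    rw [totalD_eq (hΦ j)]
    congr 1
    · have := ((hX1 j).differentiable (by norm_num) x).hasFDerivAt.mul_const (W y)
      rw [pderiv, this.fderiv]
      simp [pderiv, mul_comm]
    · have := ((hW.differentiable (by norm_num) y).hasFDerivAt).const_mul (X j x)
      rw [this.fderiv]
      simp
  -- bounds for the field
  have hB : ∃ B : ℝ, 0 ≤ B ∧ ∀ x ∈ closure Ω, ∀ j, |X j x| ≤ B ∧ |pderiv j (X j) x| ≤ B := by
    have hb : ∀ j, ∃ B : ℝ, ∀ x ∈ closure Ω, |X j x| ≤ B ∧ |pderiv j (X j) x| ≤ B := fun j => by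
      obtain ⟨B₁, h₁⟩ := hbdd.isCompact_closure.exists_bound_of_continuousOn
        (hX1 j).continuous.continuousOn
      obtain ⟨B₂, h₂⟩ := hbdd.isCompact_closure.exists_bound_of_continuousOn
        (continuous_pderiv (hX1 j) j).continuousOn
      exact ⟨max B₁ B₂, fun x hx => ⟨(h₁ x hx).trans (le_max_left _ _),
        (h₂ x hx).trans (le_max_right _ _)⟩⟩
    choose B hB using hb
    refine ⟨∑ j, |B j|, Finset.sum_nonneg fun j _ => abs_nonneg _, fun x hx j => ?_⟩
    have hle : B j ≤ ∑ j, |B j| := (le_abs_self _).trans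
      (Finset.single_le_sum (f := fun j => |B j|) (fun j _ => abs_nonneg _) (Finset.mem_univ j))
    exact ⟨(hB j x hx).1.trans hle, (hB j x hx).2.trans hle⟩
  obtain ⟨B, hB0, hB⟩ := hB
  have hmem : ∀ᵐ x ∂(volume.restrict Ω), x ∈ Ω := ae_restrict_mem hopen.measurableSet
  have hgg := fun N j => integral_totalD_of_zero_outside hopen hbdd hlip hy hG htr
    (contDiff_cutoff_mul (hs1 N) (hΦ j)) (R := 2 * ((N : ℝ) + 1))
    (fun x y h => by simp [hz N y h]) j
  -- One summand for each of the `k + 1` directions, `1 + C` from the cutoff, and `2 B` from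
  -- differentiating the field and `W`.
  set D : ℝ := ((k : ℝ) + 1) * ((1 + C) * (2 * B))
  have hI0 : 0 ≤ ∫ x in Ω, a x := integral_nonneg_of_ae (ha.mono fun x hx => (hW0 _).trans hx.1)
  have hbulk : ∀ N, ∑ j, ∫ x in Ω, totalD (fun q => χ N q.2 * Φ j q) j x (y x) (G x j)
      ≤ D * ∫ x in Ω, a x := by
    intro N
    have : ∀ j, ∫ x in Ω, totalD (fun q => χ N q.2 * Φ j q) j x (y x) (G x j)
        ≤ ((1 + C) * (2 * B)) * ∫ x in Ω, a x := by
      intro j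
      rw [← integral_const_mul]
      have hle : ∀ᵐ x ∂(volume.restrict Ω),
          |totalD (fun q => χ N q.2 * Φ j q) j x (y x) (G x j)| ≤ ((1 + C) * (2 * B)) * a x := by
        filter_upwards [ha, hmem] with x hx hxΩ
        have hbx := hB x (subset_closure hxΩ) j
        have ha0 : 0 ≤ a x := (hW0 _).trans hx.1
        rw [mul_assoc (1 + C)]
        refine abs_totalD_cutoff_le (hs1 N) (hΦ j) j x _ _ (h01 N _) (hder N _) ⟨?_, ?_⟩
        · rw [htot]
          have e1 : |pderiv j (X j) x * W (y x)| ≤ B * a x := by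
            rw [abs_mul, abs_of_nonneg (hW0 _)]
            exact mul_le_mul hbx.2 hx.1 (hW0 _) hB0
          have e2 : |X j x * fderiv ℝ W (y x) (G x j)| ≤ B * a x := by
            rw [abs_mul]
            exact mul_le_mul hbx.1 (((fderiv ℝ W (y x)).le_opNorm _).trans (hx.2 j).1)
              (abs_nonneg _) hB0
          calc _ ≤ _ := abs_add_le _ _
            _ ≤ 2 * B * a x := by linarith
        · simp only [Φ]
          rw [abs_mul, abs_of_nonneg (hW0 _), mul_assoc]
          have hM : 0 ≤ max 1 ‖y x‖ := zero_le_one.trans (le_max_left _ _)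
          calc _ ≤ B * (a x * max 1 ‖y x‖) :=
                mul_le_mul hbx.1 (hx.2 j).2 (mul_nonneg (hW0 _) (norm_nonneg _)) hB0
            _ ≤ 2 * B * a x * max 1 ‖y x‖ := by
                nlinarith [mul_nonneg hB0 (mul_nonneg ha0 hM)]
      refine integral_mono_ae ?_ (hai.const_mul _) (hle.mono fun x hx => (le_abs_self _).trans hx)
      exact (hai.const_mul _).mono' (aestronglyMeasurable_totalD
        (contDiff_cutoff_mul (hs1 N) (hΦ j)) j aestronglyMeasurable_id hy (hG.eval j).1) hle
    calc _ ≤ ∑ _j : Fin (k + 1), ((1 + C) * (2 * B)) * ∫ x in Ω, a x :=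
          Finset.sum_le_sum fun j _ => this j
      _ = D * ∫ x in Ω, a x := by simp [D]; ring
  have hχW : ∀ N, Integrable (fun x => χ N (t x) * W (t x)) (surfaceMeasure Ω) := by
    intro N
    have hcs : HasCompactSupport fun y => χ N y * W y := by
      refine HasCompactSupport.intro (isCompact_closedBall (0 : Vec m) (2 * ((N : ℝ) + 1)))
        fun y hy => ?_
      rw [Metric.mem_closedBall, dist_zero_right, not_le] at hy
      rw [hz N y hy.le, zero_mul]
    have hcont : Continuous fun y => χ N y * W y := (hsm N).continuous.mul hW.continuous
    obtain ⟨M, hM⟩ := hcont.bounded_above_of_compact_support hcs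
    exact Integrable.of_bound (hcont.comp_aestronglyMeasurable htr.1) M (ae_of_all _ fun x => hM _)
  have hbd : ∀ N, c * ∫ x, χ N (t x) * W (t x) ∂(surfaceMeasure Ω) ≤ D * ∫ x in Ω, a x := by
    intro N
    refine le_trans ?_ (hbulk N)
    simp_rw [hgg N]
    have hXb : ∀ j, Integrable (fun x => χ N (t x) * Φ j (x, t x) * exteriorNormal Ω x j)
        (surfaceMeasure Ω) := by
      intro j
      refine integrable_mul_exteriorNormal (q := fun x => x) measurable_id ?_ j
      have := (hχW N).bdd_mul (c := B) (hX1 j).continuous.aestronglyMeasurable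
        ((ae_mem_frontier Ω).mono fun x hx => (hB x (frontier_subset_closure hx) j).1)
      refine this.congr (ae_of_all _ fun x => ?_)
      simp only [Φ]; ring
    rw [← integral_finsetSum _ fun j _ => hXb j, ← integral_const_mul]
    refine integral_mono_ae ((hχW N).const_mul c) (integrable_finsetSum _ fun j _ => hXb j) ?_
    filter_upwards [hXc] with x hx
    have e : ∑ j, χ N (t x) * Φ j (x, t x) * exteriorNormal Ω x j
        = (∑ j, X j x * exteriorNormal Ω x j) * (χ N (t x) * W (t x)) := by
      rw [Finset.sum_mul]
      refine Finset.sum_congr rfl fun j _ => ?_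
      simp only [Φ]; ring
    rw [e]
    exact mul_le_mul_of_nonneg_right hx (mul_nonneg (h01 N _).1 (hW0 _))
  refine ⟨D / c, ?_⟩
  have hlim : ∀ x, Tendsto (fun N => ENNReal.ofReal (χ N (t x) * W (t x))) atTop
      (𝓝 (ENNReal.ofReal (W (t x)))) := fun x => by
    refine tendsto_const_nhds.congr' ?_
    obtain ⟨M, hM⟩ := exists_nat_gt ‖t x‖
    filter_upwards [eventually_ge_atTop M] with N hN
    have : (M : ℝ) ≤ N := by exact_mod_cast hN
    rw [h1 N _ (by linarith), one_mul]
  -- Integrability of `W (t x)` is not known in advance, so the cutoffs are removed by Fatou's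
  -- lemma.
  calc ∫⁻ x, ENNReal.ofReal (W (t x)) ∂(surfaceMeasure Ω)
      = ∫⁻ x, liminf (fun N => ENNReal.ofReal (χ N (t x) * W (t x))) atTop ∂(surfaceMeasure Ω) :=
        lintegral_congr fun x => (hlim x).liminf_eq.symm
    _ ≤ liminf (fun N => ∫⁻ x, ENNReal.ofReal (χ N (t x) * W (t x)) ∂(surfaceMeasure Ω)) atTop :=
        lintegral_liminf_le' fun N => (hχW N).1.aemeasurable.ennreal_ofReal
    _ ≤ _ := by
        refine liminf_le_of_le (by isBoundedDefault) fun b hb => ?_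
        obtain ⟨N, hN⟩ := hb.exists
        refine hN.trans ?_
        rw [← ofReal_integral_eq_lintegral_ofReal (hχW N)
          (ae_of_all _ fun x => mul_nonneg (h01 N _).1 (hW0 _))]
        refine ENNReal.ofReal_le_ofReal ?_
        rw [div_mul_eq_mul_div, le_div_iff₀ hc, mul_comm]
        exact hbd N

end

end OccMeas

end

noncomputable section

namespace OccMeas

/-! ### Push-forwards and sets that need not be measurable -/

/-- `S` need not be measurable. By inner regularity `A` is exhausted, up to a null set, by compact
sets; their images are compact, hence Borel, lie in `S`, and together carry the push-forward. -/
theorem ae_map_of_continuous {X Z : Type*} [TopologicalSpace X] [PolishSpace X]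
    [MeasurableSpace X] [BorelSpace X] [TopologicalSpace Z] [T2Space Z] [MeasurableSpace Z]
    [BorelSpace Z] {μ : Measure X} [IsFiniteMeasure μ] {f : X → Z} (hf : Continuous f)
    {A : Set X} (hA : MeasurableSet A) (hAc : μ Aᶜ = 0) {S : Set Z} (hS : ∀ x ∈ A, f x ∈ S) :
    ∀ᵐ z ∂(μ.map f), z ∈ S := by
  have hK : ∀ n : ℕ, ∃ K ⊆ A, IsCompact K ∧ μ (A \ K) < ((n : ℝ≥0∞) + 1)⁻¹ := fun n =>
    hA.exists_isCompact_sdiff_lt (measure_ne_top μ A) (by simp)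
  choose K hKA hKc hKμ using hK
  set T := ⋃ n, f '' K n
  have hT : MeasurableSet T := MeasurableSet.iUnion fun n => ((hKc n).image hf).isClosed.measurableSet
  have hTS : T ⊆ S := iUnion_subset fun n => by
    rintro _ ⟨x, hx, rfl⟩; exact hS x (hKA n hx)
  suffices h : μ.map f Tᶜ = 0 from mem_of_superset (mem_ae_iff.mpr h) hTS
  rw [Measure.map_apply hf.measurable hT.compl]
  have hle : ∀ n : ℕ, μ (f ⁻¹' Tᶜ) ≤ ((n : ℝ≥0∞) + 1)⁻¹ := fun n => by
    have : f ⁻¹' Tᶜ ⊆ Aᶜ ∪ (A \ K n) := by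
      intro x hx
      by_cases hxA : x ∈ A
      · exact Or.inr ⟨hxA, fun hxK => hx (mem_iUnion.mpr ⟨n, x, hxK, rfl⟩)⟩
      · exact Or.inl hxA
    refine (measure_mono this).trans ((measure_union_le _ _).trans ?_)
    rw [hAc, zero_add]; exact (hKμ n).le
  refine le_antisymm (ge_of_tendsto' (x := atTop) (f := fun n : ℕ => ((n : ℝ≥0∞) + 1)⁻¹) ?_ hle) zero_le
  have := ENNReal.tendsto_inv_nat_nhds_zero.comp (tendsto_add_atTop_nat 1)
  refine this.congr fun n => ?_
  simp

/-- If `f` maps almost every point into the (arbitrary) set `S`, then the push-forward is carried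
by `S`. -/
theorem ae_map_of_ae {X Z : Type*} [tX : TopologicalSpace X] [hX : PolishSpace X] [MeasurableSpace X]
    [BorelSpace X] [TopologicalSpace Z] [T2Space Z] [SecondCountableTopology Z]
    [MeasurableSpace Z] [BorelSpace Z] {μ : Measure X} [IsFiniteMeasure μ] {f : X → Z}
    (hf : AEMeasurable f μ) {S : Set Z} (h : ∀ᵐ x ∂μ, f x ∈ S) : ∀ᵐ z ∂(μ.map f), z ∈ S := by
  obtain ⟨f₀, hf₀, hff₀⟩ := hf
  rw [Measure.map_congr hff₀]
  have h0 : ∀ᵐ x ∂μ, f₀ x ∈ S := by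
    filter_upwards [h, hff₀] with x h1 h2 using h2 ▸ h1
  set A := (toMeasurable μ {x | f₀ x ∈ S}ᶜ)ᶜ
  have hA : MeasurableSet A := (measurableSet_toMeasurable _ _).compl
  have hAc : μ Aᶜ = 0 := by
    rw [compl_compl, measure_toMeasurable]; exact h0
  have hS : ∀ x ∈ A, f₀ x ∈ S := fun x hx => by
    by_contra hn
    exact hx (subset_toMeasurable μ {x | f₀ x ∈ S}ᶜ hn)
  -- A finer Polish topology makes the measurable map continuous without changing the Borel sets.
  obtain ⟨t', ht', hcont, hpol⟩ := hf₀.exists_continuous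
  have hb : @BorelSpace X t' _ := by
    refine @BorelSpace.mk X t' _ ?_
    rw [borel_eq_borel_of_le hpol hX ht']
    exact BorelSpace.measurable_eq
  exact @ae_map_of_continuous X Z t' hpol _ hb _ _ _ _ μ _ f₀ hcont A hA hAc S hS

/-- `S` itself may be non-measurable, but it contains a measurable set of full measure on which `f`
is measurable. -/
theorem aemeasurable_of_domRestrict {α : Type*} [MeasurableSpace α] {μ : Measure α} {f : α → ℝ}
    {S : Set α} (hf : Measurable (S.domRestrict f)) (h : ∀ᵐ a ∂μ, a ∈ S) : AEMeasurable f μ := by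
  set T := (toMeasurable μ Sᶜ)ᶜ
  have hT : MeasurableSet T := (measurableSet_toMeasurable _ _).compl
  have hTS : T ⊆ S := fun x hx => by
    by_contra hn
    exact hx (subset_toMeasurable μ Sᶜ hn)
  have hTμ : μ.restrict T = μ := by
    refine Measure.restrict_eq_self_of_ae_mem ?_
    rw [ae_iff]
    change μ Tᶜ = 0
    rw [compl_compl, measure_toMeasurable]; exact h
  rw [← hTμ]
  exact aemeasurable_restrict_of_measurable_subtype hT
    (hf.comp (measurable_inclusion hTS))

theorem extIntegral_map {α β : Type*} [MeasurableSpace α] [MeasurableSpace β] {μ : Measure α}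
    {g : α → β} (hg : AEMeasurable g μ) {f : β → ℝ} (hf : AEMeasurable f (μ.map g)) :
    extIntegral (μ.map g) f = extIntegral μ fun a => f (g a) := by
  have h2 : AEMeasurable (fun b => ENNReal.ofReal (-f b)) (μ.map g) := hf.neg.ennreal_ofReal
  rw [extIntegral, extIntegral, lintegral_map' hf.ennreal_ofReal hg, lintegral_map' h2 hg]

/-! ### Growth conditions -/

theorem rpow_sub_one_mul_le {a b q : ℝ} (ha : 0 ≤ a) (hb : 0 ≤ b) (hq : 1 ≤ q) :
    a ^ (q - 1) * b ≤ a ^ q + b ^ q := by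
  have hM : 0 ≤ max a b := ha.trans (le_max_left _ _)
  have e : max a b ^ (q - 1) * max a b = max a b ^ q := by
    conv_lhs => rw [← Real.rpow_one (max a b), ← Real.rpow_mul hM, one_mul,
      ← Real.rpow_add_of_nonneg hM (by linarith) zero_le_one, sub_add_cancel]
  calc a ^ (q - 1) * b ≤ max a b ^ (q - 1) * max a b := by
        gcongr
        · exact le_max_left _ _
        · exact le_max_right _ _
    _ = max a b ^ q := e
    _ ≤ a ^ q + b ^ q := by
        rcases max_choice a b with h | h <;> rw [h]
        · linarith [Real.rpow_nonneg hb q]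
        · linarith [Real.rpow_nonneg ha q]

theorem le_one_add_rpow {b q : ℝ} (hb : 0 ≤ b) (hq : 1 ≤ q) : b ≤ 1 + b ^ q := by
  have h0 := Real.rpow_nonneg hb q
  rcases le_total b 1 with h | h
  · linarith
  · have := Real.rpow_le_rpow_of_exponent_le h hq
    rw [Real.rpow_one] at this
    linarith

theorem one_add_rpow_sub_one_mul_le {a b q : ℝ} (ha : 0 ≤ a) (hb : 0 ≤ b) (hq : 1 ≤ q) :
    (1 + a ^ (q - 1)) * b ≤ 2 * (1 + a ^ q + b ^ q) := by
  have h1 := rpow_sub_one_mul_le ha hb hq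
  have h2 := le_one_add_rpow hb hq
  have h3 := Real.rpow_nonneg ha q
  have h4 := Real.rpow_nonneg hb q
  nlinarith

theorem max_one_rpow_le {a q : ℝ} (ha : 0 ≤ a) : max 1 a ^ q ≤ 1 + a ^ q := by
  rcases max_choice 1 a with h | h <;> rw [h]
  · rw [Real.one_rpow]; linarith [Real.rpow_nonneg ha q]
  · linarith

/-- The left side has degree `q + 1`. The factor `max 1 a` takes up the excess degree, and this is
precisely what the cutoff estimate permits. -/
theorem one_add_rpow_mul_le {a b q : ℝ} (ha : 0 ≤ a) (hb : 0 ≤ b) (hq : 1 ≤ q) :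
    (1 + a ^ q) * b ≤ 2 * (1 + a ^ q + b ^ q) * max 1 a := by
  set M := max 1 a
  have hM1 : 1 ≤ M := le_max_left _ _
  have hM : 0 ≤ M := zero_le_one.trans hM1
  have e : M ^ q = M ^ (q - 1) * M := by
    rw [← Real.rpow_add_one (by positivity), sub_add_cancel]
  have h1 : a ^ q ≤ M ^ q := Real.rpow_le_rpow ha (le_max_right _ _) (by linarith)
  have h2 : 1 ≤ M ^ q := Real.one_le_rpow hM1 (by linarith)
  have h3 := rpow_sub_one_mul_le hM hb hq
  have h4 : M ^ q ≤ 1 + a ^ q := max_one_rpow_le ha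
  calc (1 + a ^ q) * b ≤ (2 * (M ^ (q - 1) * M)) * b := by
        rw [← e]; gcongr; linarith
    _ = 2 * (M ^ (q - 1) * b) * M := by ring
    _ ≤ 2 * (1 + a ^ q + b ^ q) * M := by gcongr; linarith

/-- A smooth substitute for `‖y‖ ^ q`. -/
def smoothPow {m : ℕ} (q : ℝ) (y : Vec m) : ℝ := (1 + ‖y‖ ^ 2) ^ (q / 2)

section
variable {m : ℕ}

theorem contDiff_smoothPow (q : ℝ) : ContDiff ℝ 1 (smoothPow q : Vec m → ℝ) :=
  (contDiff_const.add (contDiff_norm_sq ℝ)).rpow_const_of_ne fun y => by positivity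

theorem smoothPow_nonneg (q : ℝ) (y : Vec m) : 0 ≤ smoothPow q y := by
  unfold smoothPow; positivity

theorem rpow_norm_le_smoothPow {q : ℝ} (hq : 1 ≤ q) (y : Vec m) : ‖y‖ ^ q ≤ smoothPow q y := by
  have : ‖y‖ ^ q = (‖y‖ ^ 2) ^ (q / 2) := by
    rw [← Real.rpow_natCast, ← Real.rpow_mul (norm_nonneg y)]
    congr 1; push_cast; ring
  rw [this, smoothPow]
  gcongr
  linarith [sq_nonneg ‖y‖]

theorem one_add_sq_rpow_le {s : ℝ} (hs : 0 ≤ s) (y : Vec m) :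
    (1 + ‖y‖ ^ 2) ^ (s / 2) ≤ 2 ^ s * (1 + ‖y‖ ^ s) := by
  have hM1 : 1 ≤ max 1 ‖y‖ := le_max_left _ _
  have hM2 : ‖y‖ ≤ max 1 ‖y‖ := le_max_right _ _
  have hM0 : 0 ≤ max 1 ‖y‖ := by positivity
  calc (1 + ‖y‖ ^ 2) ^ (s / 2) ≤ ((2 * max 1 ‖y‖) ^ 2) ^ (s / 2) := by
        gcongr
        nlinarith [norm_nonneg y]
    _ = (2 * max 1 ‖y‖) ^ s := by
        rw [← Real.rpow_natCast, ← Real.rpow_mul (by positivity)]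
        congr 1; push_cast; ring
    _ = 2 ^ s * max 1 ‖y‖ ^ s := Real.mul_rpow (by norm_num) hM0
    _ ≤ _ := by gcongr; exact max_one_rpow_le (norm_nonneg y)

/-- The factor `‖y‖` from differentiating `‖y‖ ^ 2` counts as half a power of `1 + ‖y‖ ^ 2`, which
brings the exponent `q / 2 - 1` up to `(q - 1) / 2`. -/
theorem norm_fderiv_smoothPow_le {q : ℝ} (hq : 1 ≤ q) (y : Vec m) :
    ‖fderiv ℝ (smoothPow q) y‖ ≤ q * (2 ^ (q - 1) * (1 + ‖y‖ ^ (q - 1))) := by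
  have hpos : 0 < 1 + ‖y‖ ^ 2 := by positivity
  have h := (((hasStrictFDerivAt_norm_sq y).hasFDerivAt).const_add 1).rpow_const (p := q / 2)
    (Or.inl hpos.ne')
  have e : fderiv ℝ (smoothPow q) y = _ := h.fderiv
  rw [e, norm_smul, Real.norm_of_nonneg (by positivity)]
  have h2 : ‖(2 • innerSL ℝ y : Vec m →L[ℝ] ℝ)‖ ≤ 2 * ‖y‖ := by
    refine (norm_nsmul_le).trans ?_
    simp
  have h3 : ‖y‖ ≤ (1 + ‖y‖ ^ 2) ^ (1 / 2 : ℝ) := by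
    rw [← Real.sqrt_eq_rpow]
    exact Real.le_sqrt_of_sq_le (by linarith)
  calc _ ≤ (q / 2 * (1 + ‖y‖ ^ 2) ^ (q / 2 - 1)) * (2 * (1 + ‖y‖ ^ 2) ^ (1 / 2 : ℝ)) := by
        gcongr
        exact h2.trans (by gcongr)
    _ = q * ((1 + ‖y‖ ^ 2) ^ (q / 2 - 1) * (1 + ‖y‖ ^ 2) ^ (1 / 2 : ℝ)) := by ring
    _ = q * (1 + ‖y‖ ^ 2) ^ ((q - 1) / 2) := by
        rw [← Real.rpow_add hpos]; congr 2; ring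
    _ ≤ _ := by gcongr; exact one_add_sq_rpow_le (by linarith) y

end

end OccMeas

end

noncomputable section

namespace OccMeas

/-! ### Traces of `W^{1,p}` functions -/

section
variable {k m : ℕ} {Ω : Set (Vec (k + 1))} {y : Vec (k + 1) → Vec m}
  {G : Vec (k + 1) → Mat m (k + 1)} {t : Vec (k + 1) → Vec m} {p : ℝ≥0∞}

theorem isFiniteMeasure_restrict_of_isBounded {n : ℕ} {Ω : Set (Vec n)}
    (hbdd : Bornology.IsBounded Ω) : IsFiniteMeasure (volume.restrict Ω) :=
  ⟨by simpa using hbdd.measure_lt_top⟩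

theorem IsSobolev.integrable_deriv {n : ℕ} {Ω : Set (Vec n)} {y : Vec n → Vec m}
    {G : Vec n → Mat m n} (h : IsSobolev Ω p y G) (hbdd : Bornology.IsBounded Ω) (hp : 1 ≤ p) :
    Integrable G (volume.restrict Ω) := by
  have := isFiniteMeasure_restrict_of_isBounded hbdd
  exact h.memLp_deriv.integrable hp

/-- The function that dominates integrands of growth `p`. -/
def growthBound {n : ℕ} (p : ℝ≥0∞) (y : Vec n → Vec m) (G : Vec n → Mat m n) (x : Vec n) : ℝ :=
  1 + ‖y x‖ ^ p.toReal + ‖G x‖ ^ p.toReal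

theorem IsSobolev.integrable_growthBound {n : ℕ} {Ω : Set (Vec n)} {y : Vec n → Vec m}
    {G : Vec n → Mat m n} (h : IsSobolev Ω p y G) (hbdd : Bornology.IsBounded Ω) (hp : 1 ≤ p)
    (hp' : p ≠ ⊤) : Integrable (growthBound p y G) (volume.restrict Ω) := by
  have := isFiniteMeasure_restrict_of_isBounded hbdd
  have hp0 : p ≠ 0 := (zero_lt_one.trans_le hp).ne'
  exact ((integrable_const 1).add (h.memLp.integrable_norm_rpow hp0 hp')).add
    (h.memLp_deriv.integrable_norm_rpow hp0 hp')

theorem one_le_toReal (hp : 1 ≤ p) (hp' : p ≠ ⊤) : 1 ≤ p.toReal := by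
  have := ENNReal.toReal_mono hp' hp
  simpa using this

theorem growth_bounds {n : ℕ} {y : Vec n → Vec m} {G : Vec n → Mat m n} (hp : 1 ≤ p)
    (hp' : p ≠ ⊤) (x : Vec n) (j : Fin n) :
    (1 + ‖y x‖ ^ (p.toReal - 1)) * ‖G x j‖ ≤ 2 * growthBound p y G x ∧
    (1 + ‖y x‖ ^ p.toReal) * ‖G x j‖ ≤ 2 * growthBound p y G x * max 1 ‖y x‖ ∧
    1 + ‖y x‖ ^ p.toReal ≤ growthBound p y G x := by
  have hq := one_le_toReal hp hp'
  have hG : ‖G x j‖ ≤ ‖G x‖ := norm_le_pi_norm (G x) j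
  have h0 := norm_nonneg (y x)
  have h1 := norm_nonneg (G x)
  refine ⟨?_, ?_, ?_⟩
  · exact (mul_le_mul_of_nonneg_left hG (by positivity)).trans
      (one_add_rpow_sub_one_mul_le h0 h1 hq)
  · exact (mul_le_mul_of_nonneg_left hG (by positivity)).trans (one_add_rpow_mul_le h0 h1 hq)
  · unfold growthBound; linarith [Real.rpow_nonneg h1 p.toReal]

/-- The trace of a `W^{1,p}` function is `p`-integrable. -/
theorem IsSobolev.lintegral_trace_rpow_lt_top (hopen : IsOpen Ω) (hbdd : Bornology.IsBounded Ω)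
    (hlip : HasLipschitzBoundary Ω) (hp : 1 ≤ p) (hp' : p ≠ ⊤) (h : IsSobolev Ω p y G)
    (htr : IsTrace Ω y G t) :
    ∫⁻ x, ‖t x‖ₑ ^ p.toReal ∂(surfaceMeasure Ω) < ⊤ := by
  have hq := one_le_toReal hp hp'
  set q := p.toReal with hqd
  -- Large enough for the three bounds below: the value needs `2 ^ q`, the gradient term `2 q 2 ^ (q
  -- - 1)`, and the product with `G` needs `2 · 2 ^ q`.
  set c : ℝ := 2 * q * 2 ^ q
  have h2 : (1 : ℝ) ≤ 2 ^ q := Real.one_le_rpow one_le_two (by linarith)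
  have h21 : (2 : ℝ) ^ (q - 1) ≤ 2 ^ q := Real.rpow_le_rpow_of_exponent_le one_le_two (by linarith)
  obtain ⟨C, hC⟩ := lintegral_trace_lt_top hopen hbdd hlip h.memLp.1
    (h.integrable_deriv hbdd hp) htr (contDiff_smoothPow q) (smoothPow_nonneg q)
    ((h.integrable_growthBound hbdd hp hp').const_mul c) (ae_of_all _ fun x => by
      have hb := fun j => growth_bounds (y := y) (G := G) hp hp' x j
      have hW := one_add_sq_rpow_le (zero_le_one.trans hq) (y x)
      change smoothPow q (y x) ≤ _ at hW
      have hg : 1 + ‖y x‖ ^ q ≤ growthBound p y G x := by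
        unfold growthBound; linarith [Real.rpow_nonneg (norm_nonneg (G x)) q]
      have hg0 : 0 ≤ growthBound p y G x := by
        linarith [Real.rpow_nonneg (norm_nonneg (y x)) q]
      have hM : 0 ≤ max 1 ‖y x‖ := zero_le_one.trans (le_max_left _ _)
      have hc : 2 ^ q ≤ c := by simp only [c]; nlinarith
      refine ⟨hW.trans ?_, fun j => ⟨?_, ?_⟩⟩
      · exact mul_le_mul hc hg (by positivity) (by positivity)
      · calc _ ≤ q * (2 ^ (q - 1) * (1 + ‖y x‖ ^ (q - 1))) * ‖G x j‖ := by
              gcongr; exact norm_fderiv_smoothPow_le hq (y x)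
          _ = (q * 2 ^ (q - 1)) * ((1 + ‖y x‖ ^ (q - 1)) * ‖G x j‖) := by ring
          _ ≤ (q * 2 ^ q) * (2 * growthBound p y G x) :=
              mul_le_mul (by gcongr) (hb j).1 (by positivity) (by positivity)
          _ = _ := by simp only [c]; ring
      · calc _ ≤ (2 ^ q * (1 + ‖y x‖ ^ q)) * ‖G x j‖ := by gcongr
          _ = 2 ^ q * ((1 + ‖y x‖ ^ q) * ‖G x j‖) := by ring
          _ ≤ 2 ^ q * (2 * growthBound p y G x * max 1 ‖y x‖) :=
              mul_le_mul_of_nonneg_left (hb j).2.1 (by positivity)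
          _ = (2 * 2 ^ q) * (growthBound p y G x * max 1 ‖y x‖) := by ring
          _ ≤ c * (growthBound p y G x * max 1 ‖y x‖) :=
              mul_le_mul_of_nonneg_right (by simp only [c]; nlinarith) (by positivity)
          _ = _ := by ring)
  refine (lintegral_mono fun x => ?_).trans_lt (hC.trans_lt ENNReal.ofReal_lt_top)
  rw [← ofReal_norm, ENNReal.ofReal_rpow_of_nonneg (norm_nonneg _) (by linarith)]
  exact ENNReal.ofReal_le_ofReal (rpow_norm_le_smoothPow hq (t x))

theorem exists_ae_norm_le_of_memLp_top {X F : Type*} [MeasurableSpace X] [NormedAddCommGroup F]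
    {μ : Measure X} {f : X → F} (hf : MemLp f ⊤ μ) : ∃ M : ℝ, ∀ᵐ x ∂μ, ‖f x‖ ≤ M := by
  have h := hf.2
  rw [eLpNorm_exponent_top] at h
  refine ⟨(eLpNormEssSup f μ).toReal, ?_⟩
  filter_upwards [ae_le_eLpNormEssSup (f := f) (μ := μ)] with x hx
  have := ENNReal.toReal_mono h.ne hx
  simpa using this

/-- The trace of a bounded Sobolev function is bounded. -/
theorem IsTrace.exists_ae_norm_le (hopen : IsOpen Ω) (hbdd : Bornology.IsBounded Ω)
    (hlip : HasLipschitzBoundary Ω) (hy : AEStronglyMeasurable y (volume.restrict Ω))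
    (hG : Integrable G (volume.restrict Ω)) (htr : IsTrace Ω y G t) {M : ℝ}
    (hM : ∀ᵐ x ∂(volume.restrict Ω), ‖y x‖ ≤ M) :
    ∃ M', ∀ᵐ x ∂(surfaceMeasure Ω), ‖t x‖ ≤ M' := by
  set R := |M| + 1
  -- This smooth function vanishes exactly on the closed ball of radius `R`. Since `‖y x‖ < R`
  -- almost everywhere, `W` and its gradient vanish along `y`, so the bulk bound holds with `a = 0`
  -- and the trace estimate forces `W (t x) = 0`.
  set W : Vec m → ℝ := fun y => expNegInvGlue (‖y‖ ^ 2 - R ^ 2)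
  have hW : ContDiff ℝ 1 W :=
    (expNegInvGlue.contDiff (n := 1)).comp ((contDiff_norm_sq ℝ).sub contDiff_const)
  have hzero : ∀ y : Vec m, ‖y‖ < R → W y = 0 := fun y hy =>
    expNegInvGlue.zero_of_nonpos (by nlinarith [norm_nonneg y])
  obtain ⟨C, hC⟩ := lintegral_trace_lt_top hopen hbdd hlip hy hG htr hW
    (fun y => expNegInvGlue.nonneg _) (a := fun _ => 0) (integrable_zero _ _ _) (by
      filter_upwards [hM] with x hx
      have hlt : ‖y x‖ < R := by simp only [R]; linarith [le_abs_self M]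
      have he : W =ᶠ[𝓝 (y x)] fun _ => 0 := by
        have : IsOpen {q : Vec m | ‖q‖ < R} := isOpen_lt (by fun_prop) (by fun_prop)
        filter_upwards [this.mem_nhds hlt] with q hq using hzero q hq
      rw [he.fderiv_eq, hzero _ hlt]
      simp)
  simp only [integral_zero, mul_zero, ENNReal.ofReal_zero, nonpos_iff_eq_zero] at hC
  rw [lintegral_eq_zero_iff' (hW.continuous.comp_aestronglyMeasurable
    htr.1).aemeasurable.ennreal_ofReal] at hC
  refine ⟨R, ?_⟩
  filter_upwards [hC] with x hx
  have h1 : W (t x) ≤ 0 := ENNReal.ofReal_eq_zero.mp hx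
  have h2 : W (t x) = 0 := le_antisymm h1 (expNegInvGlue.nonneg _)
  rw [expNegInvGlue.zero_iff_nonpos] at h2
  refine abs_le_of_sq_le_sq' (by linarith) ?_ |>.2
  positivity

end

/-! ### Occupation measures of feasible functions -/

namespace VarData

variable {k m : ℕ} {I : Type*} {Ω : Set (Vec (k + 1))} {P : VarData (k + 1) m I} {p : ℝ≥0∞}
  {y : Vec (k + 1) → Vec m} {G : Vec (k + 1) → Mat m (k + 1)} {t : Vec (k + 1) → Vec m}

/-- Gauss-Green formula for test functions along feasible functions. -/
theorem Feasible.integral_totalD (hopen : IsOpen Ω) (hbdd : Bornology.IsBounded Ω)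
    (hlip : HasLipschitzBoundary Ω) (hp : 1 ≤ p) (h : P.Feasible Ω p y G t)
    {φ : Vec (k + 1) × Vec m → ℝ} (hφ : P.IsTest Ω p φ) (j : Fin (k + 1)) :
    ∫ x in Ω, totalD φ j x (y x) (G x j)
      = ∫ x, φ (x, t x) * exteriorNormal Ω x j ∂(surfaceMeasure Ω) := by
  have := isFiniteMeasure_restrict_of_isBounded hbdd
  have := isFiniteMeasure_surfaceMeasure hopen hbdd hlip
  have hy := h.sobolev.memLp.1
  have hG := h.sobolev.integrable_deriv hbdd hp
  have hφ1 : ContDiff ℝ 1 φ := hφ.1.of_le (by simp)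
  have hmem : ∀ᵐ x ∂(volume.restrict Ω), x ∈ Ω := ae_restrict_mem hopen.measurableSet
  have hφt : AEStronglyMeasurable (fun x => φ (x, t x)) (surfaceMeasure Ω) :=
    hφ1.continuous.comp_aestronglyMeasurable (aestronglyMeasurable_id.prodMk h.trace.1)
  by_cases hp' : p = ⊤
  · subst hp'
    obtain ⟨M₁, hM₁⟩ := exists_ae_norm_le_of_memLp_top h.sobolev.memLp
    obtain ⟨M₂, hM₂⟩ := exists_ae_norm_le_of_memLp_top h.sobolev.memLp_deriv
    obtain ⟨M₃, hM₃⟩ := h.trace.exists_ae_norm_le hopen hbdd hlip hy hG hM₁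
    have hK : ∀ M, IsCompact (closure Ω ×ˢ Metric.closedBall (0 : Vec m) M) := fun M =>
      hbdd.isCompact_closure.prod (isCompact_closedBall _ _)
    obtain ⟨B, hB⟩ := (hK M₁).exists_bound_of_continuousOn hφ1.continuous.continuousOn
    obtain ⟨B', hB'⟩ := (hK M₁).exists_bound_of_continuousOn
      (hφ1.continuous_fderiv (by norm_num)).continuousOn
    obtain ⟨B'', hB''⟩ := (hK M₃).exists_bound_of_continuousOn hφ1.continuous.continuousOn
    refine OccMeas.integral_totalD hopen hbdd hlip hy hG h.trace hφ1 j
      (a := fun _ => |B| * |M₂| + |B'| * (1 + |M₂|)) (integrable_const _) ?_ ?_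
    · filter_upwards [hM₁, hM₂, hmem] with x h1 h2 hx
      have hm : (x, y x) ∈ closure Ω ×ˢ Metric.closedBall (0 : Vec m) M₁ :=
        ⟨subset_closure hx, by simpa using h1⟩
      have hGx : ‖G x j‖ ≤ |M₂| := (norm_le_pi_norm (G x) j).trans (h2.trans (le_abs_self _))
      have hb := (hB _ hm).trans (le_abs_self _)
      have hb' := (hB' _ hm).trans (le_abs_self _)
      have e1 : ‖fderiv ℝ φ (x, y x)‖ * (1 + ‖G x j‖) ≤ |B'| * (1 + |M₂|) := by gcongr
      have e2 : |φ (x, y x)| * ‖G x j‖ ≤ |B| * |M₂| := by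
        refine mul_le_mul hb hGx (norm_nonneg _) (abs_nonneg _)
      have e3 : 0 ≤ |B| * |M₂| := by positivity
      have e4 : 0 ≤ |B'| * (1 + |M₂|) := by positivity
      refine ⟨(abs_totalD_le _ _ _ _ _).trans (e1.trans (by linarith)), ?_⟩
      have hM : 1 ≤ max 1 ‖y x‖ := le_max_left _ _
      nlinarith
    · refine Integrable.of_bound hφt B'' ?_
      filter_upwards [hM₃, ae_mem_frontier Ω] with x h1 hx
      exact hB'' _ ⟨frontier_subset_closure hx, by simpa using h1⟩
  · obtain ⟨c, hc, hgr⟩ := hφ.2 hp'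
    -- The constant `3 c` collects `c` from the derivative in `x` and `2 c` from the derivative in
    -- `y` applied to `G`.
    refine OccMeas.integral_totalD hopen hbdd hlip hy hG h.trace hφ1 j
      (a := fun x => 3 * c * growthBound p y G x)
      ((h.sobolev.integrable_growthBound hbdd hp hp').const_mul _) ?_ ?_
    · filter_upwards [h.mem_bulk, hmem] with x hx hxΩ
      obtain ⟨g1, g2, g3⟩ := hgr x hxΩ (y x) hx.1
      obtain ⟨b1, b2, b3⟩ := growth_bounds (y := y) (G := G) hp hp' x j
      have hg0 : 0 ≤ growthBound p y G x := by
        linarith [Real.rpow_nonneg (norm_nonneg (y x)) p.toReal]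
      have hM : 1 ≤ max 1 ‖y x‖ := le_max_left _ _
      constructor
      · rw [totalD_eq hφ1, pderiv]
        refine (abs_add_le _ _).trans ?_
        have e1 : |fderiv ℝ (fun x' => φ (x', y x)) x (EuclideanSpace.single j 1)|
            ≤ c * growthBound p y G x := by
          refine ((fderiv ℝ (fun x' => φ (x', y x)) x).le_opNorm _).trans ?_
          rw [PiLp.norm_single, norm_one, mul_one]
          exact g1.trans (by gcongr)
        have e2 : |fderiv ℝ (fun y' => φ (x, y')) (y x) (G x j)|
            ≤ 2 * c * growthBound p y G x := by
          refine ((fderiv ℝ (fun y' => φ (x, y')) (y x)).le_opNorm _).trans ?_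
          calc _ ≤ c * (1 + ‖y x‖ ^ (p.toReal - 1)) * ‖G x j‖ := by gcongr
            _ = c * ((1 + ‖y x‖ ^ (p.toReal - 1)) * ‖G x j‖) := by ring
            _ ≤ c * (2 * growthBound p y G x) := by gcongr
            _ = _ := by ring
        linarith
      · calc _ ≤ c * (1 + ‖y x‖ ^ p.toReal) * ‖G x j‖ := by gcongr
          _ = c * ((1 + ‖y x‖ ^ p.toReal) * ‖G x j‖) := by ring
          _ ≤ c * (2 * growthBound p y G x * max 1 ‖y x‖) := by gcongr
          _ ≤ _ := by
            have : 0 ≤ c * growthBound p y G x * max 1 ‖y x‖ := by positivity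
            linarith
    · have ht := h.sobolev.lintegral_trace_rpow_lt_top hopen hbdd hlip hp hp' h.trace
      have hti : Integrable (fun x => ‖t x‖ ^ p.toReal) (surfaceMeasure Ω) := by
        refine ⟨(h.trace.1.norm.aemeasurable.pow_const _).aestronglyMeasurable, ?_⟩
        refine (lintegral_mono fun x => ?_).trans_lt ht
        rw [Real.enorm_of_nonneg (by positivity), ← ofReal_norm,
          ENNReal.ofReal_rpow_of_nonneg (norm_nonneg _) ENNReal.toReal_nonneg]
      have hint : Integrable (fun x => c * (1 + ‖t x‖ ^ p.toReal)) (surfaceMeasure Ω) := by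
        refine Integrable.const_mul ?_ c
        exact (integrable_const (1 : ℝ)).add hti
      refine hint.mono' hφt ?_
      filter_upwards [h.mem_bdry, ae_mem_frontier Ω] with x hx hxf
      set b : ℝ := c * (1 + ‖t x‖ ^ p.toReal) with hb
      -- The growth condition is imposed over `Ω` only. For fixed `y` it is closed in `x`, hence
      -- extends to the boundary.
      have hcl : IsClosed {x' : Vec (k + 1) | |φ (x', t x)| ≤ b} := by
        have := hφ1.continuous
        exact isClosed_le (by fun_prop) continuous_const
      have hsub : Ω ⊆ {x' : Vec (k + 1) | |φ (x', t x)| ≤ b} :=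
        fun x' hx' => (hgr x' hx' _ hx).2.2
      exact closure_minimal hsub hcl (frontier_subset_closure hxf)

/-- The affine test functions belong to the test class. -/
theorem isTest_affine (P : VarData (k + 1) m I) (hbdd : Bornology.IsBounded Ω) (hp : 1 ≤ p)
    {φ₁ : Vec (k + 1) → ℝ} {φ₂ : Vec (k + 1) → Vec m} (h₁ : ContDiff ℝ ∞ φ₁)
    (h₂ : ContDiff ℝ ∞ φ₂) :
    P.IsTest Ω p fun q => φ₁ q.1 + inner ℝ q.2 (φ₂ q.1) := by
  refine ⟨(h₁.comp contDiff_fst).add (contDiff_snd.inner ℝ (h₂.comp contDiff_fst)),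
    fun hp' => ?_⟩
  have hK := hbdd.isCompact_closure
  have hd₁ : ContDiff ℝ 1 φ₁ := h₁.of_le (by simp)
  have hd₂ : ContDiff ℝ 1 φ₂ := h₂.of_le (by simp)
  obtain ⟨a₁, ha₁⟩ := hK.exists_bound_of_continuousOn h₁.continuous.continuousOn
  obtain ⟨a₂, ha₂⟩ := hK.exists_bound_of_continuousOn h₂.continuous.continuousOn
  obtain ⟨a₃, ha₃⟩ := hK.exists_bound_of_continuousOn
    (hd₁.continuous_fderiv (by norm_num)).continuousOn
  obtain ⟨a₄, ha₄⟩ := hK.exists_bound_of_continuousOn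
    (hd₂.continuous_fderiv (by norm_num)).continuousOn
  set A := 1 + |a₁| + |a₂| + |a₃| + |a₄|
  have hq := one_le_toReal hp hp'
  have hlin : ∀ b : ℝ, 0 ≤ b → 1 + b ≤ 2 * (1 + b ^ p.toReal) := fun b hb => by
    linarith [le_one_add_rpow hb hq, Real.rpow_nonneg hb p.toReal]
  have hA : ∀ {u v b : ℝ}, 0 ≤ b → u ≤ A → v ≤ A → u + b * v ≤ 2 * A * (1 + b ^ p.toReal) := by
    intro u v b hb hu hv
    have hA0 : 0 ≤ A := by positivity
    calc u + b * v ≤ A * (1 + b) := by nlinarith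
      _ ≤ A * (2 * (1 + b ^ p.toReal)) := by gcongr; exact hlin b hb
      _ = _ := by ring
  have hA1 : |a₁| ≤ A := by simp only [A]; linarith [abs_nonneg a₂, abs_nonneg a₃, abs_nonneg a₄]
  have hA2 : |a₂| ≤ A := by simp only [A]; linarith [abs_nonneg a₁, abs_nonneg a₃, abs_nonneg a₄]
  have hA3 : |a₃| ≤ A := by simp only [A]; linarith [abs_nonneg a₁, abs_nonneg a₂, abs_nonneg a₄]
  have hA4 : |a₄| ≤ A := by simp only [A]; linarith [abs_nonneg a₁, abs_nonneg a₂, abs_nonneg a₃]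
  refine ⟨2 * A, by positivity, fun x hx y _ => ⟨?_, ?_, ?_⟩⟩
  · have hx' := subset_closure hx
    have e : HasFDerivAt (fun x' => φ₁ x' + inner ℝ y (φ₂ x'))
        (fderiv ℝ φ₁ x + (innerSL ℝ y).comp (fderiv ℝ φ₂ x)) x :=
      (hd₁.differentiable (by norm_num) x).hasFDerivAt.add
        ((innerSL ℝ y).hasFDerivAt.comp x (hd₂.differentiable (by norm_num) x).hasFDerivAt)
    rw [e.fderiv]
    refine (norm_add_le _ _).trans (le_trans ?_ (hA (norm_nonneg y)
      ((ha₃ x hx').trans ((le_abs_self _).trans hA3))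
      ((ha₄ x hx').trans ((le_abs_self _).trans hA4))))
    gcongr
    refine (ContinuousLinearMap.opNorm_comp_le _ _).trans ?_
    rw [innerSL_apply_norm]
  · have e : HasFDerivAt (fun y' => φ₁ x + inner ℝ y' (φ₂ x)) (innerSL ℝ (φ₂ x)) y := by
      have := ((innerSL ℝ (φ₂ x)).hasFDerivAt (x := y)).const_add (φ₁ x)
      refine this.congr_of_eventuallyEq (Eventually.of_forall fun y' => ?_)
      simp [real_inner_comm]
    rw [e.fderiv, innerSL_apply_norm]
    have h0 := Real.rpow_nonneg (norm_nonneg y) (p.toReal - 1)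
    have hA0 : 0 ≤ A := by positivity
    have := (ha₂ x (subset_closure hx)).trans ((le_abs_self _).trans hA2)
    nlinarith
  · have hx' := subset_closure hx
    refine (abs_add_le _ _).trans (le_trans ?_ (hA (norm_nonneg y)
      ((ha₁ x hx').trans ((le_abs_self _).trans hA1))
      ((ha₂ x hx').trans ((le_abs_self _).trans hA2))))
    gcongr
    · rfl
    · exact abs_real_inner_le_norm _ _

end VarData

end OccMeas

end

/-! ### Occupation measures of feasible functions and the upper bound -/

noncomputable section

namespace OccMeas

namespace VarData

variable {k m : ℕ} {I : Type*} {Ω : Set (Vec (k + 1))} {P : VarData (k + 1) m I} {p : ℝ≥0∞}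
  {y : Vec (k + 1) → Vec m} {G : Vec (k + 1) → Mat m (k + 1)} {t : Vec (k + 1) → Vec m}

/-- The occupation measure of `y` with weak derivative `G`. -/
def bulkMeasure {n : ℕ} (Ω : Set (Vec n)) (y : Vec n → Vec m) (G : Vec n → Mat m n) :
    Measure (Vec n × Vec m × Mat m n) :=
  (volume.restrict Ω).map fun x => (x, y x, G x)

/-- The boundary measure of a function with trace `t`. -/
def bdryMeasure {n : ℕ} (Ω : Set (Vec n)) (t : Vec n → Vec m) : Measure (Vec n × Vec m) :=
  (surfaceMeasure Ω).map fun x => (x, t x)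

theorem Feasible.aemeasurable_bulk (h : P.Feasible Ω p y G t) :
    AEMeasurable (fun x => (x, y x, G x)) (volume.restrict Ω) :=
  aemeasurable_id.prodMk (h.sobolev.memLp.1.aemeasurable.prodMk
    h.sobolev.memLp_deriv.1.aemeasurable)

theorem Feasible.aemeasurable_bdry (h : P.Feasible Ω p y G t) :
    AEMeasurable (fun x => (x, t x)) (surfaceMeasure Ω) :=
  aemeasurable_id.prodMk h.trace.1.aemeasurable

theorem Feasible.ae_bulkMeasure (h : P.Feasible Ω p y G t) (hbdd : Bornology.IsBounded Ω)
    {S : Set (Vec (k + 1) × Vec m × Mat m (k + 1))}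
    (hS : ∀ᵐ x ∂(volume.restrict Ω), (x, y x, G x) ∈ S) : ∀ᵐ w ∂(bulkMeasure Ω y G), w ∈ S := by
  have := isFiniteMeasure_restrict_of_isBounded hbdd
  exact ae_map_of_ae h.aemeasurable_bulk hS

theorem Feasible.ae_bdryMeasure (h : P.Feasible Ω p y G t) (hopen : IsOpen Ω)
    (hbdd : Bornology.IsBounded Ω) (hlip : HasLipschitzBoundary Ω) {S : Set (Vec (k + 1) × Vec m)}
    (hS : ∀ᵐ x ∂(surfaceMeasure Ω), (x, t x) ∈ S) : ∀ᵐ w ∂(bdryMeasure Ω t), w ∈ S := by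
  have := isFiniteMeasure_surfaceMeasure hopen hbdd hlip
  exact ae_map_of_ae h.aemeasurable_bdry hS

theorem Feasible.relaxedConstraints_carried (h : P.Feasible Ω p y G t) (hopen : IsOpen Ω)
    (hbdd : Bornology.IsBounded Ω) (hlip : HasLipschitzBoundary Ω) :
    (∀ᵐ w ∂(bulkMeasure Ω y G), w ∈ P.bulk Ω ∧ P.Admissible w.1 w.2.1 w.2.2) ∧
    ∀ᵐ w ∂(bdryMeasure Ω t), w ∈ P.bdry Ω ∧ P.AdmissibleBdry w.1 w.2 := by
  constructor
  · refine h.ae_bulkMeasure hbdd (S := {w | w ∈ P.bulk Ω ∧ P.Admissible w.1 w.2.1 w.2.2}) ?_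
    filter_upwards [h.mem_bulk, h.bulk, ae_restrict_mem hopen.measurableSet] with x h1 h2 h3
    exact ⟨⟨h3, h1.1, h1.2⟩, h2⟩
  · refine h.ae_bdryMeasure hopen hbdd hlip
      (S := {w | w ∈ P.bdry Ω ∧ P.AdmissibleBdry w.1 w.2}) ?_
    filter_upwards [h.mem_bdry, h.bdry, ae_mem_frontier Ω] with x h1 h2 h3
    exact ⟨⟨h3, h1⟩, h2⟩

/-- A relaxed measure might charge `∂Ω` in its first variable; the pointwise constraints exclude
this, so restricting to `Ω` loses nothing. -/
theorem restrict_fst_mem {n : ℕ} {P : VarData n m I} {Ω : Set (Vec n)}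
    {μ : Measure (Vec n × Vec m × Mat m n)}
    (h : ∀ᵐ w ∂μ, w ∈ P.bulk Ω ∧ P.Admissible w.1 w.2.1 w.2.2) :
    μ.restrict {w | w.1 ∈ Ω} = μ :=
  Measure.restrict_eq_self_of_ae_mem (h.mono fun _ hw => hw.1.1)

theorem Feasible.restrict_bulkMeasure (h : P.Feasible Ω p y G t) (hopen : IsOpen Ω)
    (hbdd : Bornology.IsBounded Ω) (hlip : HasLipschitzBoundary Ω) :
    (bulkMeasure Ω y G).restrict {w | w.1 ∈ Ω} = bulkMeasure Ω y G :=
  restrict_fst_mem (h.relaxedConstraints_carried hopen hbdd hlip).1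

theorem isCompact_support_of_ae_mem {X : Type*} [TopologicalSpace X] [T2Space X]
    [MeasurableSpace X]
    {μ : Measure X} {K : Set X} (hK : IsCompact K) (h : ∀ᵐ x ∂μ, x ∈ K) :
    IsCompact μ.support :=
  hK.of_isClosed_subset Measure.isClosed_support
    (Measure.support_subset_of_isClosed hK.isClosed h)

theorem continuous_totalD {n : ℕ} {φ : Vec n × Vec m → ℝ} (hφ : ContDiff ℝ 1 φ) (j : Fin n) :
    Continuous fun w : Vec n × Vec m × Mat m n => totalD φ j w.1 w.2.1 (w.2.2 j) := by
  have := hφ.continuous_fderiv (by norm_num)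
  unfold totalD
  fun_prop

/-- The Liouville equation for the occupation measures of a feasible function. -/
theorem Feasible.liouville (hopen : IsOpen Ω) (hbdd : Bornology.IsBounded Ω)
    (hlip : HasLipschitzBoundary Ω) (hp : 1 ≤ p) (h : P.Feasible Ω p y G t)
    {φ : Vec (k + 1) × Vec m → ℝ} (hφ : P.IsTest Ω p φ) (j : Fin (k + 1)) :
    ∫ w in {w | w.1 ∈ Ω}, totalD φ j w.1 w.2.1 (w.2.2 j) ∂(bulkMeasure Ω y G)
      = ∫ w, φ w * exteriorNormal Ω w.1 j ∂(bdryMeasure Ω t) := by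
  have hφ1 : ContDiff ℝ 1 φ := hφ.1.of_le (by simp)
  rw [h.restrict_bulkMeasure hopen hbdd hlip, bulkMeasure,
    integral_map h.aemeasurable_bulk (continuous_totalD hφ1 j).aestronglyMeasurable,
    bdryMeasure, integral_map h.aemeasurable_bdry]
  · exact h.integral_totalD hopen hbdd hlip hp hφ j
  · exact hφ1.continuous.aestronglyMeasurable.mul
      ((measurable_exteriorNormal_apply Ω j).comp measurable_fst).aestronglyMeasurable

theorem totalD_affine {n : ℕ} {φ₁ : Vec n → ℝ} {φ₂ : Vec n → Vec m} (h₁ : ContDiff ℝ 1 φ₁)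
    (h₂ : ContDiff ℝ 1 φ₂) (j : Fin n) (x : Vec n) (y z : Vec m) :
    totalD (fun q => φ₁ q.1 + inner ℝ q.2 (φ₂ q.1)) j x y z
      = pderiv j φ₁ x + inner ℝ y (pderiv j φ₂ x) + inner ℝ (φ₂ x) z := by
  have d₁ := (h₁.differentiable (by norm_num) x).hasFDerivAt
  have d₂ := (h₂.differentiable (by norm_num) x).hasFDerivAt
  have hΦ : ContDiff ℝ 1 fun q : Vec n × Vec m => φ₁ q.1 + inner ℝ q.2 (φ₂ q.1) :=
    (h₁.comp contDiff_fst).add (contDiff_snd.inner ℝ (h₂.comp contDiff_fst))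
  rw [totalD_eq hΦ]
  have e1 : HasFDerivAt (fun x' => φ₁ x' + inner ℝ y (φ₂ x'))
      (fderiv ℝ φ₁ x + (innerSL ℝ y).comp (fderiv ℝ φ₂ x)) x :=
    d₁.add ((innerSL ℝ y).hasFDerivAt.comp x d₂)
  have e2 : HasFDerivAt (fun y' => φ₁ x + inner ℝ y' (φ₂ x)) (innerSL ℝ (φ₂ x)) y := by
    have := ((innerSL ℝ (φ₂ x)).hasFDerivAt (x := y)).const_add (φ₁ x)
    refine this.congr_of_eventuallyEq (Eventually.of_forall fun y' => ?_)
    simp [real_inner_comm]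
  rw [pderiv, e1.fderiv, e2.fderiv]
  simp [pderiv]

theorem Feasible.isOccupation (hopen : IsOpen Ω) (hbdd : Bornology.IsBounded Ω)
    (hlip : HasLipschitzBoundary Ω) (hp : 1 ≤ p) (h : P.Feasible Ω p y G t) :
    P.IsOccupation Ω p (bulkMeasure Ω y G) (bdryMeasure Ω t) := by
  have hfb := isFiniteMeasure_restrict_of_isBounded hbdd
  have hfs := isFiniteMeasure_surfaceMeasure hopen hbdd hlip
  have hmem : ∀ᵐ x ∂(volume.restrict Ω), x ∈ Ω := ae_restrict_mem hopen.measurableSet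
  have hcar := h.relaxedConstraints_carried hopen hbdd hlip
  refine { finite_bulk := ?_, finite_bdry := ?_, conc_bulk := ?_, conc_bdry := ?_, mass := ?_,
           compact_support := ?_, moment := ?_, normal := ?_, liouville := ?_,
           liouville_full := ?_ }
  · unfold bulkMeasure; infer_instance
  · unfold bdryMeasure; infer_instance
  · exact hcar.1.mono fun w hw => ⟨subset_closure hw.1.1, hw.1.2.1, hw.1.2.2⟩
  · exact hcar.2.mono fun w hw => ⟨hw.1.1, hw.1.2⟩
  · rw [bulkMeasure, Measure.map_apply_of_aemeasurable h.aemeasurable_bulk MeasurableSet.univ]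
    simp
  · intro hp'
    subst hp'
    obtain ⟨M₁, hM₁⟩ := exists_ae_norm_le_of_memLp_top h.sobolev.memLp
    obtain ⟨M₂, hM₂⟩ := exists_ae_norm_le_of_memLp_top h.sobolev.memLp_deriv
    obtain ⟨M₃, hM₃⟩ := h.trace.exists_ae_norm_le hopen hbdd hlip h.sobolev.memLp.1
      (h.sobolev.integrable_deriv hbdd hp) hM₁
    constructor
    · refine isCompact_support_of_ae_mem (hbdd.isCompact_closure.prod
        ((isCompact_closedBall (0 : Vec m) M₁).prod
          (isCompact_closedBall (0 : Mat m (k + 1)) M₂))) (h.ae_bulkMeasure hbdd ?_)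
      filter_upwards [hmem, hM₁, hM₂] with x hx h1 h2
      exact ⟨subset_closure hx, by simpa using h1, by simpa using h2⟩
    · refine isCompact_support_of_ae_mem ((isCompact_frontier_of_isBounded hbdd).prod
        (isCompact_closedBall (0 : Vec m) M₃)) (h.ae_bdryMeasure hopen hbdd hlip ?_)
      filter_upwards [ae_mem_frontier Ω, hM₃] with x hx h1
      exact ⟨hx, by simpa using h1⟩
  · intro hp'
    have hp0 : p ≠ 0 := (zero_lt_one.trans_le hp).ne'
    constructor
    · rw [h.restrict_bulkMeasure hopen hbdd hlip, bulkMeasure,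
        lintegral_map' (by fun_prop) h.aemeasurable_bulk]
      have hy := lintegral_rpow_enorm_lt_top_of_eLpNorm_lt_top hp0 hp' h.sobolev.memLp.2
      have hG := lintegral_rpow_enorm_lt_top_of_eLpNorm_lt_top hp0 hp' h.sobolev.memLp_deriv.2
      -- The matrix norm is the largest column norm, so the sum over the `k + 1` columns costs a
      -- factor `k + 1`.
      have hle : ∀ x, ‖y x‖ₑ ^ p.toReal + ∑ j, ‖G x j‖ₑ ^ p.toReal
          ≤ ‖y x‖ₑ ^ p.toReal + ((k : ℝ≥0∞) + 1) * ‖G x‖ₑ ^ p.toReal := by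
        intro x
        gcongr
        calc ∑ j, ‖G x j‖ₑ ^ p.toReal ≤ ∑ _j : Fin (k + 1), ‖G x‖ₑ ^ p.toReal := by
              refine Finset.sum_le_sum fun j _ => ?_
              gcongr
              rw [← ofReal_norm, ← ofReal_norm]
              exact ENNReal.ofReal_le_ofReal (norm_le_pi_norm (G x) j)
          _ = _ := by simp
      refine (lintegral_mono hle).trans_lt ?_
      rw [lintegral_add_left' (h.sobolev.memLp.1.enorm.pow_const _),
        lintegral_const_mul' _ _ (by finiteness)]
      exact ENNReal.add_lt_top.mpr ⟨hy, ENNReal.mul_lt_top (by finiteness) hG⟩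
    · rw [bdryMeasure, lintegral_map' (by fun_prop) h.aemeasurable_bdry]
      exact h.sobolev.lintegral_trace_rpow_lt_top hopen hbdd hlip hp hp' h.trace
  · exact h.ae_bdryMeasure hopen hbdd hlip (S := {w | ∃ ν, IsExteriorNormal Ω w.1 ν})
      (ae_isExteriorNormal hopen hbdd hlip)
  · intro φ₁ φ₂ h₁ h₂ j
    have := h.liouville hopen hbdd hlip hp (P.isTest_affine hbdd hp h₁ h₂) j
    simp_rw [totalD_affine (h₁.of_le (by simp) : ContDiff ℝ 1 φ₁)
      (h₂.of_le (by simp) : ContDiff ℝ 1 φ₂)] at this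
    exact this
  · intro φ hφ j
    have := h.liouville hopen hbdd hlip hp hφ j
    simp_rw [totalD_eq (hφ.1.of_le (by simp) : ContDiff ℝ 1 φ)] at this
    exact this

/-- Integrands of the bulk and of the boundary have the same integrals against the occupation
measures as along the function. -/
theorem Feasible.extIntegral_bulkMeasure (h : P.Feasible Ω p y G t) (hopen : IsOpen Ω)
    (hbdd : Bornology.IsBounded Ω) (hlip : HasLipschitzBoundary Ω)
    {f : Vec (k + 1) → Vec m → Mat m (k + 1) → ℝ}
    (hf : Measurable ((P.bulk Ω).domRestrict fun w => f w.1 w.2.1 w.2.2)) :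
    extIntegral ((bulkMeasure Ω y G).restrict {w | w.1 ∈ Ω}) (fun w => f w.1 w.2.1 w.2.2)
      = extIntegral (volume.restrict Ω) fun x => f x (y x) (G x) := by
  rw [h.restrict_bulkMeasure hopen hbdd hlip]
  exact extIntegral_map h.aemeasurable_bulk (aemeasurable_of_domRestrict hf
    ((h.relaxedConstraints_carried hopen hbdd hlip).1.mono fun w hw => hw.1))

theorem Feasible.extIntegral_bdryMeasure (h : P.Feasible Ω p y G t) (hopen : IsOpen Ω)
    (hbdd : Bornology.IsBounded Ω) (hlip : HasLipschitzBoundary Ω)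
    {f : Vec (k + 1) → Vec m → ℝ}
    (hf : Measurable ((P.bdry Ω).domRestrict fun w => f w.1 w.2)) :
    extIntegral (bdryMeasure Ω t) (fun w => f w.1 w.2)
      = extIntegral (surfaceMeasure Ω) fun x => f x (t x) :=
  extIntegral_map h.aemeasurable_bdry (aemeasurable_of_domRestrict hf
    ((h.relaxedConstraints_carried hopen hbdd hlip).2.mono fun _ hw => hw.1))

/-- Passing to occupation measures preserves the cost and all integral constraints exactly, so every
competitor of the original problem is one of the relaxed problem with the same cost. -/
theorem relaxedValue_le_classicalValue (hopen : IsOpen Ω) (hbdd : Bornology.IsBounded Ω)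
    (hlip : HasLipschitzBoundary Ω) (hp : 1 ≤ p) (hP : P.MeasurableIntegrands Ω) :
    P.relaxedValue Ω p ≤ P.classicalValue Ω p := by
  refine le_iInf fun y => le_iInf fun G => le_iInf fun t => le_iInf fun h => ?_
  refine iInf_le_of_le (bulkMeasure Ω y G) (iInf_le_of_le (bdryMeasure Ω t) (iInf_le_of_le
    ⟨h.isOccupation hopen hbdd hlip hp, ?_⟩ ?_))
  · have hcar := h.relaxedConstraints_carried hopen hbdd hlip
    refine ⟨hcar.1, hcar.2, fun i => ?_, fun i => ?_⟩
    · rw [h.extIntegral_bulkMeasure hopen hbdd hlip (hP.C i)]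
      exact h.integral_bulk i
    · rw [h.extIntegral_bdryMeasure hopen hbdd hlip (hP.Cb i)]
      exact h.integral_bdry i
  · rw [relaxedCost, h.extIntegral_bulkMeasure hopen hbdd hlip hP.L,
      h.extIntegral_bdryMeasure hopen hbdd hlip hP.Lb, cost]

theorem affRelaxedValue_le_relaxedValue {n : ℕ} (P : VarData n m I) (Ω : Set (Vec n)) (p : ℝ≥0∞) :
    P.affRelaxedValue Ω p ≤ P.relaxedValue Ω p :=
  le_iInf fun μ => le_iInf fun μb => le_iInf fun h =>
    iInf_le_of_le μ (iInf_le_of_le μb (iInf_le_of_le ⟨h.1.toIsAffOccupation, h.2⟩ le_rfl))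

end VarData

end OccMeas

end

/-! ### Barycenters and Jensen's inequality on arbitrary convex sets -/

noncomputable section

namespace OccMeas

/-- A point outside a convex set of a finite-dimensional space can be weakly separated from it by a
nonzero functional. -/
theorem exists_separating_functional {E : Type*} [NormedAddCommGroup E] [NormedSpace ℝ E]
    [FiniteDimensional ℝ E] {S : Set E} (hS : Convex ℝ S) (hne : S.Nonempty)
    (h0 : (0 : E) ∉ S) :
    ∃ l : E →L[ℝ] ℝ, l ≠ 0 ∧ ((∀ x ∈ S, 0 ≤ l x) ∨ ∃ c, ∀ x ∈ S, l x = c) := by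
  -- With interior points this is Hahn-Banach. Without them `S` lies in a proper affine subspace, on
  -- which some nonzero functional is constant.
  by_cases hint : (interior S).Nonempty
  · obtain ⟨l, hl, h⟩ := geometric_hahn_banach_of_nonempty_interior_point hS
      (fun h => h0 (interior_subset h)) hint
    refine ⟨-l, by simpa using hl, Or.inl fun x hx => ?_⟩
    have := h x hx
    simp only [map_zero] at this
    simpa using this
  · rw [hS.interior_nonempty_iff_affineSpan_eq_top] at hint
    obtain ⟨x₀, hx₀⟩ := hne
    have hdir : (affineSpan ℝ S).direction ≠ ⊤ := fun h => hint
      ((AffineSubspace.direction_eq_top_iff_of_nonempty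
        ⟨x₀, subset_affineSpan ℝ S hx₀⟩).1 h)
    obtain ⟨l, hl, hle⟩ := Submodule.exists_le_ker_of_lt_top _ (lt_top_iff_ne_top.2 hdir)
    refine ⟨LinearMap.toContinuousLinearMap l, by simpa using hl, Or.inr ⟨l x₀, fun x hx => ?_⟩⟩
    have := hle (AffineSubspace.vsub_mem_direction (subset_affineSpan ℝ S hx)
      (subset_affineSpan ℝ S hx₀))
    rw [LinearMap.mem_ker, vsub_eq_sub, map_sub, sub_eq_zero] at this
    simpa using this

/-- Induction on the dimension. If `0 ∉ S`, the separating functional composed with `f` has mean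
zero and is nonnegative or constant, hence vanishes almost everywhere. So `f` takes values in a
hyperplane, and the slice of `S` there still omits `0`. -/
theorem integral_mem_of_convex_aux {α : Type*} [MeasurableSpace α] {μ : Measure α}
    [IsProbabilityMeasure μ] (d : ℕ) : ∀ {E : Type _} [NormedAddCommGroup E] [NormedSpace ℝ E]
    [FiniteDimensional ℝ E] {S : Set E} {f : α → E}, Module.finrank ℝ E = d → Convex ℝ S →
    Integrable f μ → (∀ᵐ a ∂μ, f a ∈ S) → ∫ a, f a ∂μ = 0 → (0 : E) ∈ S := by
  induction d using Nat.strong_induction_on with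
  | _ d ih =>
    intro E _ _ _ S f hd hS hf hfS hint
    by_contra h0
    obtain ⟨a, ha⟩ := hfS.exists
    obtain ⟨l, hl, h⟩ := exists_separating_functional hS ⟨_, ha⟩ h0
    have hli : ∫ a, l (f a) ∂μ = 0 := by
      rw [l.integral_comp_comm hf, hint, map_zero]
    have hzero : ∀ᵐ a ∂μ, l (f a) = 0 := by
      rcases h with h | ⟨c, hc⟩
      · exact (integral_eq_zero_iff_of_nonneg_ae (hfS.mono fun a ha => h _ ha)
          (l.integrable_comp hf)).1 hli
      · have h1 : ∀ᵐ a ∂μ, l (f a) = c := hfS.mono fun a ha => hc _ ha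
        have h2 : ∫ a, l (f a) ∂μ = c := by rw [integral_congr_ae h1]; simp
        filter_upwards [h1] with a h3
        rw [h3, ← h2, hli]
    set V := LinearMap.ker (l : E →ₗ[ℝ] ℝ) with hV
    -- Any linear retraction onto `V` turns `f` into a `V`-valued map, without change where `f`
    -- already lies in `V`.
    obtain ⟨π, hπ⟩ := V.subtype.exists_leftInverse_of_injective (by simp)
    have hπ' : ∀ v : V, π v = v := fun v => LinearMap.congr_fun hπ v
    have hVd : Module.finrank ℝ V < d := by
      rw [← hd]
      refine Submodule.finrank_lt fun h => hl ?_
      rw [LinearMap.ker_eq_top] at h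
      exact ContinuousLinearMap.coe_injective h
    set πc : E →L[ℝ] V := LinearMap.toContinuousLinearMap π
    have hgi : Integrable (fun a => πc (f a)) μ := πc.integrable_comp hf
    have hmem := ih _ hVd (E := V) (S := V.subtype ⁻¹' S) (f := fun a => πc (f a)) rfl
      (hS.linear_preimage _) hgi ?_ ?_
    · exact h0 (by simpa using hmem)
    · filter_upwards [hfS, hzero] with a h1 h2
      have h3 : πc (f a) = (⟨f a, h2⟩ : V) := hπ' ⟨f a, h2⟩
      simpa [h3] using h1
    · rw [πc.integral_comp_comm hf, hint, map_zero]

/-- The barycenter of a probability measure carried by a (not necessarily closed or measurable)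
convex subset of a finite-dimensional space belongs to this set. -/
theorem integral_mem_of_convex {α E : Type*} [MeasurableSpace α] {μ : Measure α}
    [IsProbabilityMeasure μ] [NormedAddCommGroup E] [NormedSpace ℝ E] [FiniteDimensional ℝ E]
    {S : Set E} {f : α → E} (hS : Convex ℝ S) (hf : Integrable f μ)
    (hfS : ∀ᵐ a ∂μ, f a ∈ S) : ∫ a, f a ∂μ ∈ S := by
  have h := integral_mem_of_convex_aux (μ := μ) _ (S := (fun x => (∫ a, f a ∂μ) + x) ⁻¹' S)
    (f := fun a => f a - ∫ a, f a ∂μ) rfl (hS.translate_preimage_right _)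
    (hf.sub (integrable_const _)) (hfS.mono fun a ha => by simpa using ha)
    (by rw [integral_sub hf (integrable_const _)]; simp)
  simpa using h

/-- Jensen's inequality for convex functions on arbitrary convex sets. -/
theorem map_integral_le_of_convexOn {α E : Type*} [MeasurableSpace α] {μ : Measure α}
    [IsProbabilityMeasure μ] [NormedAddCommGroup E] [NormedSpace ℝ E] [FiniteDimensional ℝ E]
    {S : Set E} {f : α → E} {g : E → ℝ} (hg : ConvexOn ℝ S g) (hf : Integrable f μ)
    (hfS : ∀ᵐ a ∂μ, f a ∈ S) (hgf : Integrable (fun a => g (f a)) μ) :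
    g (∫ a, f a ∂μ) ≤ ∫ a, g (f a) ∂μ := by
  -- The barycenter of `(f, g ∘ f)` lies in the epigraph of `g`, which need not be closed.
  have h := integral_mem_of_convex hg.convex_epigraph (hf.prodMk hgf)
    (hfS.mono fun a ha => ⟨ha, le_rfl⟩)
  rw [integral_pair hf hgf] at h
  exact h.2

/-- Jensen without integrability of the negative part, stated without subtraction so that infinite
values are harmless. The truncations `max g (-k)` are convex and integrable along `f` when the
positive part is; letting `k → ∞` is monotone convergence. -/
theorem ofReal_map_integral_le {α E : Type*} [MeasurableSpace α] {μ : Measure α}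
    [IsProbabilityMeasure μ] [NormedAddCommGroup E] [NormedSpace ℝ E] [FiniteDimensional ℝ E]
    {S : Set E} {f : α → E} {g : E → ℝ} (hg : ConvexOn ℝ S g) (hf : Integrable f μ)
    (hfS : ∀ᵐ a ∂μ, f a ∈ S) (hgm : AEMeasurable (fun a => g (f a)) μ) :
    ENNReal.ofReal (g (∫ a, f a ∂μ)) ≤ ∫⁻ a, ENNReal.ofReal (g (f a)) ∂μ ∧
    (∫⁻ a, ENNReal.ofReal (-g (f a)) ∂μ) + ENNReal.ofReal (g (∫ a, f a ∂μ)) ≤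
      (∫⁻ a, ENNReal.ofReal (g (f a)) ∂μ) + ENNReal.ofReal (-g (∫ a, f a ∂μ)) := by
  set b := ∫ a, f a ∂μ
  by_cases htop : ∫⁻ a, ENNReal.ofReal (g (f a)) ∂μ = ⊤
  · simp [htop]
  have key : ∀ k : ℕ, (∫⁻ a, ENNReal.ofReal (min (-g (f a)) k) ∂μ) + ENNReal.ofReal (g b) ≤
      (∫⁻ a, ENNReal.ofReal (g (f a)) ∂μ) + ENNReal.ofReal (-g b) := by
    intro k
    have hgk : ConvexOn ℝ S fun x => max (g x) (-(k : ℝ)) :=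
      hg.sup (convexOn_const _ hg.1)
    have hp : Integrable (fun a => max (g (f a)) 0) μ := by
      refine ⟨(hgm.max aemeasurable_const).aestronglyMeasurable, ?_⟩
      rw [hasFiniteIntegral_iff_ofReal
        (Eventually.of_forall fun a => (le_max_right _ _ : (0 : ℝ) ≤ max (g (f a)) 0))]
      simpa [ENNReal.ofReal_max] using lt_top_iff_ne_top.2 htop
    have hq : Integrable (fun a => max (min (-g (f a)) k) 0) μ := by
      refine Integrable.of_bound (C := k)
        ((hgm.neg.min aemeasurable_const).max aemeasurable_const).aestronglyMeasurable
        (Eventually.of_forall fun a => ?_)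
      rw [Real.norm_of_nonneg (le_max_right _ _)]
      exact max_le (min_le_right _ _) k.cast_nonneg
    have heq : (fun a => max (g (f a)) (-(k : ℝ))) =
        fun a => max (g (f a)) 0 - max (min (-g (f a)) k) 0 := by
      funext a
      have hk : (0 : ℝ) ≤ k := k.cast_nonneg
      rcases le_total (g (f a)) 0 with h | h
      · rw [max_eq_right h, max_eq_left (le_min (by linarith) hk)]
        rcases le_total (g (f a)) (-k) with h' | h'
        · rw [max_eq_right h', min_eq_right (by linarith)]; ring
        · rw [max_eq_left h', min_eq_left (by linarith)]; ring
      · rw [max_eq_left h, max_eq_left (by linarith),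
          max_eq_right ((min_le_left _ _).trans (by linarith))]; ring
    have hJ := map_integral_le_of_convexOn hgk hf hfS (by rw [heq]; exact hp.sub hq)
    rw [heq, integral_sub hp hq] at hJ
    have e1 : ∫⁻ a, ENNReal.ofReal (g (f a)) ∂μ = ENNReal.ofReal (∫ a, max (g (f a)) 0 ∂μ) := by
      rw [ofReal_integral_eq_lintegral_ofReal hp (Eventually.of_forall fun a => le_max_right _ _)]
      simp [ENNReal.ofReal_max]
    have e2 : ∫⁻ a, ENNReal.ofReal (min (-g (f a)) k) ∂μ
        = ENNReal.ofReal (∫ a, max (min (-g (f a)) k) 0 ∂μ) := by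
      rw [ofReal_integral_eq_lintegral_ofReal hq (Eventually.of_forall fun a => le_max_right _ _)]
      simp [ENNReal.ofReal_max]
    have n1 : 0 ≤ ∫ a, max (g (f a)) 0 ∂μ := integral_nonneg fun a => le_max_right _ _
    have n2 : 0 ≤ ∫ a, max (min (-g (f a)) k) 0 ∂μ := integral_nonneg fun a => le_max_right _ _
    rw [e1, e2]
    have hb := (le_max_left (g b) (-(k : ℝ))).trans hJ
    rcases le_total (g b) 0 with h | h
    · rw [ENNReal.ofReal_of_nonpos h, add_zero, ← ENNReal.ofReal_add n1 (by linarith)]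
      have hk := (le_max_right (g b) (-(k : ℝ))).trans hJ
      exact ENNReal.ofReal_le_ofReal (by linarith)
    · rw [ENNReal.ofReal_of_nonpos (p := -g b) (by linarith), add_zero,
        ← ENNReal.ofReal_add n2 h]
      exact ENNReal.ofReal_le_ofReal (by linarith)
  constructor
  · rcases le_total (g b) 0 with h | h
    · simp [ENNReal.ofReal_of_nonpos h]
    -- At level `0` the negative part is truncated away: this is Jensen for the positive part of
    -- `g`.
    · have := key 0
      rw [ENNReal.ofReal_of_nonpos (p := -g b) (by linarith), add_zero] at this
      exact le_add_self.trans this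
  · have hlim : ∫⁻ a, ENNReal.ofReal (-g (f a)) ∂μ
        = ⨆ k : ℕ, ∫⁻ a, ENNReal.ofReal (min (-g (f a)) k) ∂μ := by
      rw [← lintegral_iSup']
      · refine lintegral_congr fun a => le_antisymm ?_ (iSup_le fun k =>
          ENNReal.ofReal_le_ofReal (min_le_left _ _))
        obtain ⟨k, hk⟩ := exists_nat_ge (-g (f a))
        exact le_iSup_of_le k (by rw [min_eq_left hk])
      · exact fun k => (hgm.neg.min aemeasurable_const).ennreal_ofReal
      · exact Eventually.of_forall fun a i j hij =>
          ENNReal.ofReal_le_ofReal (min_le_min_left _ (by exact_mod_cast hij))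
    rw [hlim, ENNReal.iSup_add]
    exact iSup_le key

/-- The second hypothesis is the inequality of the differences with all terms moved to the side
where they are positive. The first serves the convention for `+∞`: an infinite positive part of `f`
forces one for `g`. -/
theorem extIntegral_le_of_lintegral {α β : Type*} [MeasurableSpace α] [MeasurableSpace β]
    {μ : Measure α} {ν : Measure β} {f : α → ℝ} {g : β → ℝ}
    (h1 : ∫⁻ a, ENNReal.ofReal (f a) ∂μ ≤ ∫⁻ a, ENNReal.ofReal (g a) ∂ν)
    (h2 : (∫⁻ a, ENNReal.ofReal (-g a) ∂ν) + ∫⁻ a, ENNReal.ofReal (f a) ∂μ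
      ≤ (∫⁻ a, ENNReal.ofReal (g a) ∂ν) + ∫⁻ a, ENNReal.ofReal (-f a) ∂μ) :
    extIntegral μ f ≤ extIntegral ν g := by
  unfold extIntegral
  generalize ∫⁻ a, ENNReal.ofReal (f a) ∂μ = c at *
  generalize ∫⁻ a, ENNReal.ofReal (-f a) ∂μ = d at *
  generalize ∫⁻ a, ENNReal.ofReal (g a) ∂ν = a at *
  generalize ∫⁻ a, ENNReal.ofReal (-g a) ∂ν = b at *
  by_cases ha : a = ⊤
  · rw [if_pos ha]; exact le_top
  have hc : c ≠ ⊤ := fun h => ha (top_le_iff.1 (h ▸ h1))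
  rw [if_neg ha, if_neg hc]
  by_cases hd : d = ⊤
  · rw [hd, EReal.coe_ennreal_top, EReal.sub_top]
    exact bot_le
  have hb : b ≠ ⊤ := fun h => by
    rw [h, top_add] at h2
    exact ENNReal.add_ne_top.2 ⟨ha, hd⟩ (top_le_iff.1 h2)
  lift a to NNReal using ha
  lift b to NNReal using hb
  lift c to NNReal using hc
  lift d to NNReal using hd
  have h3 : (b : ℝ) + c ≤ a + d := by exact_mod_cast h2
  have h4 : (c : ℝ) - d ≤ a - b := by linarith
  simp only [EReal.coe_nnreal_eq_coe_real]
  exact_mod_cast h4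

theorem extIntegral_mono_ae {α : Type*} [MeasurableSpace α] {μ : Measure α} {f g : α → ℝ}
    (hf : AEMeasurable f μ) (hg : AEMeasurable g μ) (h : ∀ᵐ a ∂μ, f a ≤ g a) :
    extIntegral μ f ≤ extIntegral μ g := by
  refine extIntegral_le_of_lintegral
    (lintegral_mono_ae (h.mono fun a ha => ENNReal.ofReal_le_ofReal ha)) ?_
  rw [← lintegral_add_right' _ hf.ennreal_ofReal, ← lintegral_add_left' hg.ennreal_ofReal]
  refine lintegral_mono_ae (h.mono fun a ha => ?_)
  rcases le_total (f a) 0 with h1 | h1 <;> rcases le_total (g a) 0 with h2 | h2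
  · rw [ENNReal.ofReal_of_nonpos h1, ENNReal.ofReal_of_nonpos h2, add_zero, zero_add]
    exact ENNReal.ofReal_le_ofReal (by linarith)
  · rw [ENNReal.ofReal_of_nonpos h1, ENNReal.ofReal_of_nonpos (p := -g a) (by linarith)]
    simp
  · rw [show f a = 0 by linarith, show g a = 0 by linarith]; simp
  · rw [ENNReal.ofReal_of_nonpos (p := -f a) (by linarith),
      ENNReal.ofReal_of_nonpos (p := -g a) (by linarith), add_zero, zero_add]
    exact ENNReal.ofReal_le_ofReal ha

open ProbabilityTheory in
/-- Jensen's inequality for a disintegrated measure. -/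
theorem extIntegral_barycenter_le {X E : Type*} [MeasurableSpace X] [NormedAddCommGroup E]
    [NormedSpace ℝ E] [FiniteDimensional ℝ E] [MeasurableSpace E] [BorelSpace E]
    {ρ : Measure X} [SFinite ρ] {κ : Kernel X E} [IsMarkovKernel κ] {f : X → E → ℝ}
    {S : X → Set E} (hconv : ∀ᵐ x ∂ρ, ConvexOn ℝ (S x) (f x))
    (hS : ∀ᵐ w ∂(ρ.compProd κ), w.2 ∈ S w.1)
    (hint : ∀ᵐ x ∂ρ, Integrable (fun q => q) (κ x))
    (hf : AEMeasurable (fun w : X × E => f w.1 w.2) (ρ.compProd κ))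
    (hfb : AEMeasurable (fun x => f x (∫ q, q ∂κ x)) ρ) :
    extIntegral ρ (fun x => f x (∫ q, q ∂κ x)) ≤
      extIntegral (ρ.compProd κ) fun w => f w.1 w.2 := by
  have hfm : ∀ᵐ x ∂ρ, AEMeasurable (f x) (κ x) := by
    filter_upwards [Measure.ae_ae_of_ae_compProd hf.ae_eq_mk] with x hx
    exact ⟨fun q => hf.mk _ (x, q), hf.measurable_mk.comp measurable_prodMk_left, hx⟩
  -- Integrands are only almost everywhere measurable, so Fubini is applied to a measurable
  -- modification, which agrees `κ x`-almost everywhere for almost every `x`.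
  have hlin : ∀ {h : X × E → ℝ}, AEMeasurable h (ρ.compProd κ) →
      ∫⁻ w, ENNReal.ofReal (h w) ∂(ρ.compProd κ)
        = ∫⁻ x, ∫⁻ q, ENNReal.ofReal (h (x, q)) ∂κ x ∂ρ := by
    intro h hh
    have h1 : ∫⁻ w, ENNReal.ofReal (h w) ∂(ρ.compProd κ)
        = ∫⁻ w, ENNReal.ofReal (hh.mk _ w) ∂(ρ.compProd κ) :=
      lintegral_congr_ae (hh.ae_eq_mk.mono fun w hw => by simp only [hw])
    rw [h1, Measure.lintegral_compProd hh.measurable_mk.ennreal_ofReal]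
    refine lintegral_congr_ae ?_
    filter_upwards [Measure.ae_ae_of_ae_compProd hh.ae_eq_mk] with x hx
    exact lintegral_congr_ae (hx.mono fun q hq => by simp only [hq])
  have hmeas : AEMeasurable (fun x => ∫⁻ q, ENNReal.ofReal (f x q) ∂κ x) ρ := by
    refine ⟨fun x => ∫⁻ q, ENNReal.ofReal (hf.mk _ (x, q)) ∂κ x,
      hf.measurable_mk.ennreal_ofReal.lintegral_kernel_prod_right', ?_⟩
    filter_upwards [Measure.ae_ae_of_ae_compProd hf.ae_eq_mk] with x hx
    exact lintegral_congr_ae (hx.mono fun q hq => by simp only [hq])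
  have key : ∀ᵐ x ∂ρ, ENNReal.ofReal (f x (∫ q, q ∂κ x)) ≤ ∫⁻ q, ENNReal.ofReal (f x q) ∂κ x ∧
      (∫⁻ q, ENNReal.ofReal (-f x q) ∂κ x) + ENNReal.ofReal (f x (∫ q, q ∂κ x)) ≤
      (∫⁻ q, ENNReal.ofReal (f x q) ∂κ x) + ENNReal.ofReal (-f x (∫ q, q ∂κ x)) := by
    filter_upwards [hconv, Measure.ae_ae_of_ae_compProd hS, hint, hfm] with x h1 h2 h3 h4
    exact ofReal_map_integral_le h1 h3 h2 h4
  refine extIntegral_le_of_lintegral ?_ ?_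
  · rw [hlin hf]
    exact lintegral_mono_ae (key.mono fun x hx => hx.1)
  · rw [hlin hf, hlin (h := fun w => -f w.1 w.2) hf.neg,
      ← lintegral_add_right' _ hfb.ennreal_ofReal, ← lintegral_add_left' hmeas]
    exact lintegral_mono_ae (key.mono fun x hx => hx.2)

theorem addTop_le_addTop {a b c d : EReal} (h1 : a ≤ c) (h2 : b ≤ d) :
    addTop a b ≤ addTop c d := by
  unfold addTop
  by_cases h : c = ⊤ ∨ d = ⊤
  · rw [if_pos h]; exact le_top
  · rw [if_neg h, if_neg]
    · exact add_le_add h1 h2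
    · push Not at h ⊢
      exact ⟨(h1.trans_lt (lt_top_iff_ne_top.2 h.1)).ne, (h2.trans_lt (lt_top_iff_ne_top.2 h.2)).ne⟩

end OccMeas

end

/-! ### The first marginals of relaxed occupation measures -/

noncomputable section

namespace OccMeas

variable {n : ℕ}

/-- Finite measures with the same integrals of test functions, weighted with functions which do not
vanish simultaneously, agree. -/
theorem restrict_eq_of_integral_testFunction_eq {ι : Type*} [Countable ι] {ν₁ ν₂ : Measure (Vec n)}
    [IsFiniteMeasure ν₁] [IsFiniteMeasure ν₂] {U : Set (Vec n)} (hU : IsOpen U)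
    {h : ι → Vec n → ℝ} (hm : ∀ i, Measurable (h i)) (hb : ∀ i x, |h i x| ≤ 1)
    (hne₁ : ∀ᵐ x ∂ν₁, ∃ i, h i x ≠ 0) (hne₂ : ∀ᵐ x ∂ν₂, ∃ i, h i x ≠ 0)
    (heq : ∀ i (φ : Vec n → ℝ), ContDiff ℝ ∞ φ → HasCompactSupport φ → tsupport φ ⊆ U →
      ∫ x, φ x * h i x ∂ν₁ = ∫ x, φ x * h i x ∂ν₂) :
    ν₁.restrict U = ν₂.restrict U := by
  -- Both measures have densities with respect to their sum. The fundamental lemma of the calculus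
  -- of variations kills the difference of the densities times each weight, and at almost every
  -- point some weight is nonzero.
  set τ := ν₁ + ν₂ with hτ
  have hfin : IsFiniteMeasure τ := by rw [hτ]; infer_instance
  have hd₁ : ν₁.HaveLebesgueDecomposition τ :=
    Measure.haveLebesgueDecomposition_of_sigmaFinite ν₁ τ
  have hd₂ : ν₂.HaveLebesgueDecomposition τ :=
    Measure.haveLebesgueDecomposition_of_sigmaFinite ν₂ τ
  have hac₁ : ν₁ ≪ τ := Measure.absolutelyContinuous_of_le (Measure.le_add_right le_rfl)
  have hac₂ : ν₂ ≪ τ := Measure.absolutelyContinuous_of_le (Measure.le_add_left le_rfl)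
  have hi₁ : Integrable (fun x => (ν₁.rnDeriv τ x).toReal) τ := Measure.integrable_toReal_rnDeriv
  have hi₂ : Integrable (fun x => (ν₂.rnDeriv τ x).toReal) τ := Measure.integrable_toReal_rnDeriv
  have hf : ∀ i, Integrable (fun x => ((ν₁.rnDeriv τ x).toReal - (ν₂.rnDeriv τ x).toReal) * h i x)
      τ := fun i => (hi₁.sub hi₂).mul_bdd (c := 1) (hm i).aestronglyMeasurable
    (ae_of_all _ fun x => hb i x)
  have hzero : ∀ i, ∀ᵐ x ∂τ, x ∈ U →
      ((ν₁.rnDeriv τ x).toReal - (ν₂.rnDeriv τ x).toReal) * h i x = 0 := by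
    intro i
    refine hU.ae_eq_zero_of_integral_contDiff_smul_eq_zero
      ((hf i).locallyIntegrable.locallyIntegrableOn U) fun φ hφ hφc hφU => ?_
    obtain ⟨C, hC⟩ := hφc.exists_bound_of_continuous hφ.continuous
    have hbd : ∀ x, ‖φ x * h i x‖ ≤ C := fun x => by
      rw [norm_mul]
      exact (mul_le_of_le_one_right (norm_nonneg _) (hb i x)).trans (hC x)
    have hms : AEStronglyMeasurable (fun x => φ x * h i x) τ :=
      (hφ.continuous.measurable.mul (hm i)).aestronglyMeasurable
    have e₁ := integral_rnDeriv_smul (f := fun x => φ x * h i x) hac₁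
    have e₂ := integral_rnDeriv_smul (f := fun x => φ x * h i x) hac₂
    simp only [smul_eq_mul] at e₁ e₂ ⊢
    have : ∀ x, φ x * (((ν₁.rnDeriv τ x).toReal - (ν₂.rnDeriv τ x).toReal) * h i x) =
        (ν₁.rnDeriv τ x).toReal * (φ x * h i x) - (ν₂.rnDeriv τ x).toReal * (φ x * h i x) :=
      fun x => by ring
    simp only [this]
    rw [integral_sub (hi₁.mul_bdd hms (ae_of_all _ hbd)) (hi₂.mul_bdd hms (ae_of_all _ hbd)), e₁,
      e₂, heq i φ hφ hφc hφU, sub_self]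
  have hr : ∀ᵐ x ∂τ, x ∈ U → ν₁.rnDeriv τ x = ν₂.rnDeriv τ x := by
    have hne : ∀ᵐ x ∂τ, ∃ i, h i x ≠ 0 := ae_add_measure_iff.2 ⟨hne₁, hne₂⟩
    filter_upwards [ae_all_iff.2 hzero, hne, Measure.rnDeriv_lt_top ν₁ τ,
      Measure.rnDeriv_lt_top ν₂ τ] with x h1 ⟨i, hi⟩ h2 h3 hx
    have := (mul_eq_zero.1 (h1 i hx)).resolve_right hi
    exact (ENNReal.toReal_eq_toReal_iff' h2.ne h3.ne).1 (sub_eq_zero.1 this)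
  rw [← Measure.withDensity_rnDeriv_eq ν₁ τ hac₁, ← Measure.withDensity_rnDeriv_eq ν₂ τ hac₂,
    restrict_withDensity hU.measurableSet, restrict_withDensity hU.measurableSet]
  exact withDensity_congr_ae ((ae_restrict_iff' hU.measurableSet).2 hr)

theorem fderiv_eq_zero_of_pderiv {F : Type*} [NormedAddCommGroup F] [NormedSpace ℝ F]
    {L : Vec n →L[ℝ] F} (h : ∀ j, L (EuclideanSpace.single j 1) = 0) : L = 0 := by
  have := (EuclideanSpace.basisFun (Fin n) ℝ).toBasis.ext (f₁ := (L : Vec n →ₗ[ℝ] F)) (f₂ := 0)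
    (fun j => by simpa using h j)
  exact ContinuousLinearMap.coe_injective this

theorem hasCompactSupport_fderiv_bound {φ : Vec n → ℝ} (hφ : ContDiff ℝ ∞ φ)
    (hφc : HasCompactSupport φ) : ∃ C, ∀ x, ‖fderiv ℝ φ x‖ ≤ C :=
  (hφc.fderiv (𝕜 := ℝ)).exists_bound_of_continuous (hφ.continuous_fderiv (by simp))

/-- If all partial derivatives of the measure `ν` vanish in `Ω`, the integral of a test function is
not changed by translations within `Ω`. -/
theorem integral_translate_eq {ν : Measure (Vec n)} [IsFiniteMeasure ν] {Ω : Set (Vec n)}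
    (hν : ∀ φ : Vec n → ℝ, ContDiff ℝ ∞ φ → HasCompactSupport φ → tsupport φ ⊆ Ω →
      ∀ j, ∫ x, pderiv j φ x ∂ν = 0)
    {φ : Vec n → ℝ} (hφ : ContDiff ℝ ∞ φ) (hφc : HasCompactSupport φ) {c : Vec n} {r : ℝ}
    (hr : ∀ v ∈ Metric.ball c r, ∀ x ∈ tsupport φ, x + v ∈ Ω) {v w : Vec n}
    (hv : v ∈ Metric.ball c r) (hw : w ∈ Metric.ball c r) :
    ∫ x, φ (x - v) ∂ν = ∫ x, φ (x - w) ∂ν := by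
  obtain ⟨C, hC⟩ := hφc.exists_bound_of_continuous hφ.continuous
  obtain ⟨C', hC'⟩ := hasCompactSupport_fderiv_bound hφ hφc
  -- Differentiating in the translation moves the derivative onto `φ`. The result integrates to zero
  -- as long as the translate is supported in `Ω`.
  have hD : ∀ v, HasFDerivAt (fun v => ∫ x, φ (x - v) ∂ν) (∫ x, -fderiv ℝ φ (x - v) ∂ν) v := by
    intro v
    refine hasFDerivAt_integral_of_dominated_of_fderiv_le (s := univ) (bound := fun _ => C')
      (F := fun v x => φ (x - v)) (F' := fun v x => -fderiv ℝ φ (x - v)) univ_mem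
      (Eventually.of_forall fun v =>
        (hφ.continuous.comp (continuous_id.sub continuous_const)).aestronglyMeasurable) ?_ ?_
      (ae_of_all _ fun x v _ => by rw [norm_neg]; exact hC' _) (integrable_const _)
      (ae_of_all _ fun x v _ => ?_)
    · exact Integrable.of_bound
        (hφ.continuous.comp (continuous_id.sub continuous_const)).aestronglyMeasurable C
        (ae_of_all _ fun x => hC _)
    · exact ((hφ.continuous_fderiv (by simp)).comp
        (continuous_id.sub continuous_const)).neg.aestronglyMeasurable
    · have h1 : HasFDerivAt (fun v : Vec n => x - v) (-ContinuousLinearMap.id ℝ (Vec n)) v := by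
        simpa using (hasFDerivAt_id v).const_sub x
      have := ((hφ.differentiable (by simp)) (x - v)).hasFDerivAt.comp v h1
      refine this.congr_fderiv ?_
      rw [ContinuousLinearMap.comp_neg, ContinuousLinearMap.comp_id]
  have hz : ∀ v ∈ Metric.ball c r, fderiv ℝ (fun v => ∫ x, φ (x - v) ∂ν) v = 0 := by
    intro v hv
    rw [(hD v).fderiv]
    refine fderiv_eq_zero_of_pderiv fun j => ?_
    have hint : Integrable (fun x => -fderiv ℝ φ (x - v)) ν :=
      Integrable.of_bound ((hφ.continuous_fderiv (by simp)).comp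
        (continuous_id.sub continuous_const)).neg.aestronglyMeasurable C'
        (ae_of_all _ fun x => by rw [norm_neg]; exact hC' _)
    rw [ContinuousLinearMap.integral_apply hint]
    have h2 := hν (fun x => φ (x - v)) (hφ.comp (contDiff_id.sub contDiff_const))
      (hφc.comp_homeomorph (Homeomorph.subRight v)) ?_ j
    · simp only [neg_apply, integral_neg, neg_eq_zero]
      rw [← h2]
      refine integral_congr_ae (ae_of_all _ fun x => ?_)
      simp only [pderiv]
      simp only [sub_eq_add_neg, fderiv_comp_add_right]
    · intro x hx
      have : x - v ∈ tsupport φ := by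
        have := tsupport_comp_eq_preimage φ (Homeomorph.subRight v)
        change x ∈ tsupport (φ ∘ (Homeomorph.subRight v)) at hx
        rw [this] at hx
        exact hx
      simpa using hr v hv _ this
  exact Metric.isOpen_ball.is_const_of_fderiv_eq_zero (𝕜 := ℝ) (convex_ball c r).isPreconnected
    (fun v _ => (hD v).differentiableAt.differentiableWithinAt) (fun v hv => hz v hv) hv hw

/-- A finite measure with vanishing derivatives is locally a multiple of Lebesgue measure. -/
theorem exists_restrict_ball_eq_smul {ν : Measure (Vec n)} [IsFiniteMeasure ν] {Ω : Set (Vec n)}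
    (hν : ∀ φ : Vec n → ℝ, ContDiff ℝ ∞ φ → HasCompactSupport φ → tsupport φ ⊆ Ω →
      ∀ j, ∫ x, pderiv j φ x ∂ν = 0) {x₀ : Vec n} {r : ℝ} (hr : 0 < r)
    (hball : Metric.ball x₀ (2 * r) ⊆ Ω) :
    ∃ c : ℝ≥0∞, c ≠ ⊤ ∧
      ν.restrict (Metric.ball x₀ r) = c • volume.restrict (Metric.ball x₀ r) := by
  set B : ContDiffBump (0 : Vec n) := ⟨r / 4, r / 2, by positivity, by linarith⟩ with hB
  set ψ : Vec n → ℝ := B.normed volume with hψ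
  have hψs : ContDiff ℝ ∞ ψ := B.contDiff_normed
  have hψc : HasCompactSupport ψ := B.hasCompactSupport_normed
  have hψt : tsupport ψ = Metric.closedBall 0 (r / 2) := B.tsupport_normed_eq
  -- The mollified measure is constant on the ball of radius `r`, and its value is the density
  -- sought. The radius `r / 2` of `ψ` keeps all translates inside the ball of radius `2 r`.
  set c : ℝ := ∫ x, ψ (x - x₀) ∂ν with hc
  have hc0 : 0 ≤ c := integral_nonneg fun x => B.nonneg_normed _
  have hcu : ∀ u ∈ Metric.ball x₀ r, ∫ x, ψ (x - u) ∂ν = c := by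
    intro u hu
    refine integral_translate_eq hν hψs hψc (c := x₀) (r := r) ?_ hu (Metric.mem_ball_self hr)
    intro v hv x hx
    rw [hψt, mem_closedBall_zero_iff] at hx
    refine hball ?_
    rw [Metric.mem_ball, dist_eq_norm] at hv ⊢
    calc ‖x + v - x₀‖ = ‖x + (v - x₀)‖ := by congr 1; abel
      _ ≤ ‖x‖ + ‖v - x₀‖ := norm_add_le _ _
      _ < 2 * r := by linarith
  refine ⟨ENNReal.ofReal c, ENNReal.ofReal_ne_top, ?_⟩
  have hfin : IsFiniteMeasure (ENNReal.ofReal c • volume.restrict (Metric.ball x₀ r)) :=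
    haveI : IsFiniteMeasure (volume.restrict (Metric.ball x₀ r)) :=
      ⟨by simpa using measure_ball_lt_top⟩
    Measure.smul_finite _ ENNReal.ofReal_ne_top
  have key : ∀ φ : Vec n → ℝ, ContDiff ℝ ∞ φ → HasCompactSupport φ →
      tsupport φ ⊆ Metric.ball x₀ r → ∫ x, φ x ∂ν = c * ∫ x, φ x := by
    intro φ hφ hφc hφt
    obtain ⟨C, hC⟩ := hφc.exists_bound_of_continuous hφ.continuous
    have h1 : ∀ v ∈ tsupport ψ, ∫ x, φ (x - v) ∂ν = ∫ x, φ x ∂ν := by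
      intro v hv
      have := integral_translate_eq hν hφ hφc (c := 0) (r := r) ?_ (v := v) (w := 0) ?_
        (Metric.mem_ball_self hr)
      · simpa using this
      · intro v hv x hx
        refine hball ?_
        have := hφt hx
        rw [Metric.mem_ball, dist_eq_norm] at this ⊢
        rw [mem_ball_zero_iff] at hv
        calc ‖x + v - x₀‖ = ‖(x - x₀) + v‖ := by congr 1; abel
          _ ≤ ‖x - x₀‖ + ‖v‖ := norm_add_le _ _
          _ < 2 * r := by linarith
      · rw [hψt, mem_closedBall_zero_iff] at hv
        rw [mem_ball_zero_iff]; linarith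
    -- Averaging over translates by `ψ` does not change the integral of `φ`. Exchanging the
    -- integrals then lets `ψ` act on `ν`, where it gives the constant `c`.
    have h2 : ∫ v, ∫ x, ψ v * φ (x - v) ∂ν = ∫ x, φ x ∂ν := by
      have : ∀ v, ∫ x, ψ v * φ (x - v) ∂ν = ψ v * ∫ x, φ x ∂ν := by
        intro v
        rw [integral_const_mul]
        by_cases hv : v ∈ tsupport ψ
        · rw [h1 v hv]
        · rw [image_eq_zero_of_notMem_tsupport hv, zero_mul, zero_mul]
      simp only [this]
      rw [integral_mul_const, B.integral_normed, one_mul]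
    have hψi : Integrable ψ := B.integrable_normed
    have hφi : Integrable φ := hφ.continuous.integrable_of_hasCompactSupport hφc
    have h3 : ∫ v, ∫ x, ψ v * φ (x - v) ∂ν = ∫ x, (∫ v, ψ v * φ (x - v)) ∂ν := by
      refine integral_integral_swap ?_
      refine Integrable.mul_bdd (c := C) (hψi.comp_fst ν) (Continuous.aestronglyMeasurable
        (hφ.continuous.comp (continuous_snd.sub continuous_fst))) (ae_of_all _ fun q => hC _)
    have h4 : ∀ x, ∫ v, ψ v * φ (x - v) = ∫ u, ψ (x - u) * φ u := by
      intro x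
      rw [← integral_sub_left_eq_self (fun v => ψ v * φ (x - v)) volume x]
      simp
    have h5 : ∫ x, (∫ u, ψ (x - u) * φ u) ∂ν = ∫ u, ∫ x, ψ (x - u) * φ u ∂ν := by
      obtain ⟨C', hC'⟩ := hψc.exists_bound_of_continuous hψs.continuous
      refine integral_integral_swap ?_
      refine Integrable.bdd_mul (c := C') (hφi.comp_snd ν) (Continuous.aestronglyMeasurable
        (hψs.continuous.comp (continuous_fst.sub continuous_snd))) (ae_of_all _ fun q => hC' _)
    rw [← h2, h3]
    simp only [h4]
    rw [h5, ← integral_const_mul]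
    refine integral_congr_ae (ae_of_all _ fun u => ?_)
    simp only
    rw [integral_mul_const]
    by_cases hu : u ∈ tsupport φ
    · rw [hcu u (hφt hu)]
    · rw [image_eq_zero_of_notMem_tsupport hu, mul_zero, mul_zero]
  have := restrict_eq_of_integral_testFunction_eq (ι := Unit) (ν₁ := ν)
    (ν₂ := ENNReal.ofReal c • volume.restrict (Metric.ball x₀ r)) (U := Metric.ball x₀ r)
    Metric.isOpen_ball (h := fun _ _ => 1) (fun _ => measurable_const) (fun _ _ => by simp)
    (by simp) (by simp) (fun _ φ hφ hφc hφt => by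
      simp only [mul_one]
      rw [key φ hφ hφc hφt, integral_smul_measure, ENNReal.toReal_ofReal hc0,
        setIntegral_eq_integral_of_forall_compl_eq_zero, smul_eq_mul]
      exact fun x hx => image_eq_zero_of_notMem_tsupport fun h => hx (hφt h))
  rw [this, Measure.restrict_smul, Measure.restrict_restrict Metric.isOpen_ball.measurableSet,
    inter_self]

/-- A finite measure on a connected open set with vanishing derivatives is a multiple of Lebesgue
measure. -/
theorem exists_restrict_eq_smul {ν : Measure (Vec n)} [IsFiniteMeasure ν] {Ω : Set (Vec n)}
    (hopen : IsOpen Ω) (hconn : IsConnected Ω)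
    (hν : ∀ φ : Vec n → ℝ, ContDiff ℝ ∞ φ → HasCompactSupport φ → tsupport φ ⊆ Ω →
      ∀ j, ∫ x, pderiv j φ x ∂ν = 0) :
    ∃ c : ℝ≥0∞, ν.restrict Ω = c • volume.restrict Ω := by
  have hloc : ∀ x ∈ Ω, ∃ r > 0, Metric.ball x r ⊆ Ω ∧ ∃ c : ℝ≥0∞, c ≠ ⊤ ∧
      ν.restrict (Metric.ball x r) = c • volume.restrict (Metric.ball x r) := by
    intro x hx
    obtain ⟨ε, hε, hb⟩ := Metric.isOpen_iff.1 hopen x hx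
    refine ⟨ε / 2, by positivity, (Metric.ball_subset_ball (by linarith)).trans hb,
      exists_restrict_ball_eq_smul hν (by positivity) ?_⟩
    rwa [mul_div_cancel₀ _ two_ne_zero]
  choose! r hr hball c hctop hc using hloc
  -- Balls around nearby points overlap in a set of positive finite volume, which forces equal
  -- constants; connectedness makes this global.
  have hconst : ∀ x ∈ Ω, ∀ y ∈ Ω, c x = c y := by
    intro x hx y hy
    refine hconn.isPreconnected.induction₂' (fun x y => c x = c y) ?_
      (fun _ _ _ _ _ _ h1 h2 => h1.trans h2) hx hy
    intro x hx
    have : Metric.ball x (r x) ∈ 𝓝[Ω] x :=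
      mem_nhdsWithin_of_mem_nhds (Metric.ball_mem_nhds x (hr x hx))
    filter_upwards [this, self_mem_nhdsWithin] with y hy hyΩ
    suffices c x = c y from ⟨this, this.symm⟩
    set V := Metric.ball x (r x) ∩ Metric.ball y (r y) with hV
    have hVo : IsOpen V := Metric.isOpen_ball.inter Metric.isOpen_ball
    have hVpos : volume V ≠ 0 := (hVo.measure_pos volume
      ⟨y, hy, Metric.mem_ball_self (hr y hyΩ)⟩).ne'
    have hVtop : volume V ≠ ⊤ := ((measure_mono inter_subset_left).trans_lt
      measure_ball_lt_top).ne
    have e1 := congrArg (fun m => m V) (hc x hx)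
    have e2 := congrArg (fun m => m V) (hc y hyΩ)
    simp only [Measure.smul_apply, smul_eq_mul, Measure.restrict_apply hVo.measurableSet] at e1 e2
    rw [inter_eq_left.2 inter_subset_left] at e1
    rw [inter_eq_left.2 inter_subset_right] at e2
    exact (ENNReal.mul_left_inj hVpos hVtop).1 (e1.symm.trans e2)
  obtain ⟨z, hz⟩ := hconn.nonempty
  refine ⟨c z, ?_⟩
  obtain ⟨s, hs, hsc, hcov⟩ := TopologicalSpace.countable_cover_nhdsWithin
    (f := fun x => Metric.ball x (r x)) (s := Ω)
    fun x hx => mem_nhdsWithin_of_mem_nhds (Metric.ball_mem_nhds x (hr x hx))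
  have hU : Ω = ⋃ x ∈ s, Metric.ball x (r x) :=
    hcov.antisymm (iUnion₂_subset fun x hx => hball x (hs hx))
  rw [← Measure.restrict_smul]
  rw [hU, Measure.restrict_biUnion_congr hsc]
  intro x hx
  rw [hc x (hs hx), Measure.restrict_smul, hconst x (hs hx) z hz]

namespace VarData

variable {k m : ℕ} {I : Type*} {Ω : Set (Vec (k + 1))} {P : VarData (k + 1) m I} {p : ℝ≥0∞}
  {μ : Measure (Vec (k + 1) × Vec m × Mat m (k + 1))} {μb : Measure (Vec (k + 1) × Vec m)}

/-- The Liouville equation with `φ₂ = 0` involves only the first marginals and is their Gauss-Green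
formula. -/
theorem IsAffOccupation.integral_pderiv (h : P.IsAffOccupation Ω p μ μb)
    (hr : P.RelaxedConstraints Ω μ μb) {φ : Vec (k + 1) → ℝ} (hφ : ContDiff ℝ ∞ φ)
    (j : Fin (k + 1)) :
    ∫ x, pderiv j φ x ∂μ.fst = ∫ x, φ x * exteriorNormal Ω x j ∂μb.fst := by
  have := h.liouville φ 0 hφ contDiff_const j
  rw [restrict_fst_mem hr.bulk] at this
  have h0 : ∀ x, pderiv j (0 : Vec (k + 1) → Vec m) x = 0 := fun x => by simp [pderiv]
  simp only [h0, inner_zero_right, add_zero, Pi.zero_apply, inner_zero_left] at this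
  rw [Measure.fst, Measure.fst, integral_map measurable_fst.aemeasurable
    (continuous_pderiv (hφ.of_le (by simp)) j).aestronglyMeasurable,
    integral_map measurable_fst.aemeasurable, this]
  exact (hφ.continuous.measurable.mul (measurable_exteriorNormal_apply Ω j)).aestronglyMeasurable

/-- Test functions supported in `Ω` vanish on the boundary, where `μb` lives, so the marginal has
zero derivatives in `Ω` and is a multiple of Lebesgue measure. The mass condition makes the factor
`1`. -/
theorem IsAffOccupation.fst_bulk (h : P.IsAffOccupation Ω p μ μb)
    (hr : P.RelaxedConstraints Ω μ μb) (hopen : IsOpen Ω) (hconn : IsConnected Ω)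
    (hbdd : Bornology.IsBounded Ω) : μ.fst = volume.restrict Ω := by
  have := h.finite_bulk
  have hfr : ∀ᵐ x ∂μb.fst, x ∈ frontier Ω :=
    (ae_map_iff measurable_fst.aemeasurable isClosed_frontier.measurableSet).2
      (h.conc_bdry.mono fun w hw => hw.1)
  obtain ⟨c, hc⟩ := exists_restrict_eq_smul (ν := μ.fst) hopen hconn fun φ hφ _ hφt j => by
    rw [h.integral_pderiv hr hφ j]
    refine integral_eq_zero_of_ae (hfr.mono fun x hx => ?_)
    have : φ x = 0 := image_eq_zero_of_notMem_tsupport fun hx' => by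
      rw [hopen.frontier_eq] at hx; exact hx.2 (hφt hx')
    simp [this]
  have hΩ : ∀ᵐ x ∂μ.fst, x ∈ Ω :=
    (ae_map_iff measurable_fst.aemeasurable hopen.measurableSet).2
      (hr.bulk.mono fun w hw => hw.1.1)
  rw [Measure.restrict_eq_self_of_ae_mem hΩ] at hc
  have hm := congrArg (fun m => m univ) hc
  simp only [Measure.fst_univ, h.mass, Measure.smul_apply, smul_eq_mul, Measure.restrict_apply_univ]
    at hm
  have h1 : c = 1 := by
    have hpos : volume Ω ≠ 0 := (hopen.measure_pos volume hconn.nonempty).ne'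
    exact (ENNReal.mul_left_inj hpos hbdd.measure_lt_top.ne).1 (by rw [one_mul, ← hm])
  rw [hc, h1, one_smul]

/-- With the bulk marginal known, Gauss-Green shows that this measure and surface measure agree
after weighting with each component of the normal. A unit vector has a nonzero component, and the
normal exists almost everywhere for both measures. -/
theorem IsAffOccupation.fst_bdry (h : P.IsAffOccupation Ω p μ μb)
    (hr : P.RelaxedConstraints Ω μ μb) (hopen : IsOpen Ω) (hconn : IsConnected Ω)
    (hbdd : Bornology.IsBounded Ω) (hlip : HasLipschitzBoundary Ω) :
    μb.fst = surfaceMeasure Ω := by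
  have := h.finite_bdry
  have := isFiniteMeasure_surfaceMeasure hopen hbdd hlip
  have hne : ∀ {x : Vec (k + 1)}, (∃ ν, IsExteriorNormal Ω x ν) →
      ∃ j, exteriorNormal Ω x j ≠ 0 := by
    rintro x ⟨ν, hν⟩
    by_contra! hj
    have h0 : exteriorNormal Ω x = 0 := by ext j; simpa using hj j
    have h1 := hν.1
    rw [← hν.exteriorNormal_eq, h0] at h1
    simp at h1
  have hS : MeasurableSet {x : Vec (k + 1) | ∃ j, exteriorNormal Ω x j ≠ 0} := by
    have : {x : Vec (k + 1) | ∃ j, exteriorNormal Ω x j ≠ 0}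
        = ⋃ j, {x | exteriorNormal Ω x j ≠ 0} := by ext; simp
    rw [this]
    exact MeasurableSet.iUnion fun j =>
      (measurable_exteriorNormal_apply Ω j) (measurableSet_singleton 0).compl
  have := restrict_eq_of_integral_testFunction_eq (ν₁ := μb.fst) (ν₂ := surfaceMeasure Ω)
    isOpen_univ (h := fun j x => exteriorNormal Ω x j) (measurable_exteriorNormal_apply Ω)
    (fun j x => abs_exteriorNormal_apply_le Ω x j)
    ((ae_map_iff measurable_fst.aemeasurable hS).2 (h.normal.mono fun w hw => hne hw))
    ((ae_isExteriorNormal hopen hbdd hlip).mono fun x hx => hne hx)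
    (fun j φ hφ _ _ => by
      rw [← h.integral_pderiv hr hφ j, h.fst_bulk hr hopen hconn hbdd,
        gauss_green hopen hbdd hlip (hφ.of_le (by simp)) j])
  simpa using this

end VarData

end OccMeas

end

/-! ### Disintegration, conditional means and their Gauss-Green formula -/

noncomputable section

namespace OccMeas

open ProbabilityTheory

section Barycenter

theorem ae_integrable_of_memLp_snd {X E : Type*} [MeasurableSpace X] [NormedAddCommGroup E]
    [MeasurableSpace E] {ρ : Measure X} [IsFiniteMeasure ρ] {κ : Kernel X E} [IsMarkovKernel κ]
    {p : ℝ≥0∞} (hp : 1 ≤ p)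
    (h : MemLp (fun w : X × E => w.2) p (ρ.compProd κ)) :
    ∀ᵐ x ∂ρ, Integrable (fun q => q) (κ x) :=
  ((Measure.integrable_compProd_iff h.1).1 (h.integrable hp)).1

variable {X E : Type*} [MeasurableSpace X] [NormedAddCommGroup E] [NormedSpace ℝ E]
  [FiniteDimensional ℝ E] [MeasurableSpace E] {ρ : Measure X} [IsFiniteMeasure ρ]
  {κ : Kernel X E}

theorem measurable_barycenter [BorelSpace E] : Measurable fun x => ∫ q, q ∂κ x :=
  (StronglyMeasurable.integral_kernel stronglyMeasurable_id).measurable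

variable [IsMarkovKernel κ]

/-- For a probability measure the norm of the mean is at most the `L¹` norm, hence at most the `Lᵖ`
norm of the conditional measure; its `p`-th power integrates to the given moment. -/
theorem memLp_barycenter [BorelSpace E] {p : ℝ≥0∞} (hp : 1 ≤ p)
    (h : MemLp (fun w : X × E => w.2) p (ρ.compProd κ)) : MemLp (fun x => ∫ q, q ∂κ x) p ρ := by
  refine ⟨measurable_barycenter.aestronglyMeasurable, ?_⟩
  rcases eq_or_ne p ⊤ with rfl | hp'
  · have hC := Measure.ae_ae_of_ae_compProd (ae_le_eLpNormEssSup (f := fun w : X × E => w.2)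
      (μ := ρ.compProd κ))
    have hfin : eLpNormEssSup (fun w : X × E => w.2) (ρ.compProd κ) < ⊤ := by
      simpa using h.2
    refine lt_of_le_of_lt ?_ hfin
    rw [eLpNorm_exponent_top]
    refine essSup_le_of_ae_le _ (hC.mono fun x hx => ?_)
    refine (enorm_integral_le_lintegral_enorm _).trans ((lintegral_mono_ae hx).trans ?_)
    simp
  · have hp0 : p ≠ 0 := fun h0 => by simp [h0] at hp
    have hpp : 0 < p.toReal := ENNReal.toReal_pos hp0 hp'
    have h2 := h.2
    rw [eLpNorm_lt_top_iff_lintegral_rpow_enorm_lt_top hp0 hp'] at h2 ⊢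
    rw [Measure.lintegral_compProd (measurable_snd.enorm.pow_const _)] at h2
    refine lt_of_le_of_lt (lintegral_mono fun x => ?_) h2
    have h3 := eLpNorm_le_eLpNorm_of_exponent_le (μ := κ x) (f := fun q : E => q) hp
      aestronglyMeasurable_id
    rw [eLpNorm_one_eq_lintegral_enorm, eLpNorm_eq_lintegral_rpow_enorm_toReal hp0 hp'] at h3
    have h4 := ENNReal.rpow_le_rpow ((enorm_integral_le_lintegral_enorm _).trans h3) hpp.le
    rwa [← ENNReal.rpow_mul, one_div, inv_mul_cancel₀ hpp.ne', ENNReal.rpow_one] at h4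

theorem ae_barycenter_mem {S : X → Set E} (hS : ∀ᵐ x ∂ρ, Convex ℝ (S x))
    (hint : ∀ᵐ x ∂ρ, Integrable (fun q => q) (κ x))
    (hmem : ∀ᵐ w ∂(ρ.compProd κ), w.2 ∈ S w.1) : ∀ᵐ x ∂ρ, ∫ q, q ∂κ x ∈ S x := by
  filter_upwards [hS, hint, Measure.ae_ae_of_ae_compProd hmem] with x h1 h2 h3
  exact integral_mem_of_convex h1 h2 h3

theorem extIntegral_barycenter_le_of_carried [BorelSpace E] [TopologicalSpace X] [PolishSpace X] [BorelSpace X]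
    {U : Set X} {T : Set E} (hT : Convex ℝ T) {f : X → E → ℝ}
    (hf : Measurable ((U ×ˢ T).domRestrict fun w => f w.1 w.2))
    (hconv : ∀ x ∈ U, ConvexOn ℝ T (f x)) (hint : ∀ᵐ x ∂ρ, Integrable (fun q => q) (κ x))
    (hU : ∀ᵐ x ∂ρ, x ∈ U) (hmem : ∀ᵐ w ∂(ρ.compProd κ), w ∈ U ×ˢ T) :
    extIntegral ρ (fun x => f x (∫ q, q ∂κ x)) ≤
      extIntegral (ρ.compProd κ) fun w => f w.1 w.2 := by
  have hb := ae_barycenter_mem (S := fun _ => T) (ae_of_all ρ fun _ => hT) hint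
    (hmem.mono fun w hw => hw.2)
  have hm : AEMeasurable (fun x => (x, ∫ q, q ∂κ x)) ρ :=
    (measurable_id.prodMk measurable_barycenter).aemeasurable
  refine extIntegral_barycenter_le (S := fun _ => T) (hU.mono hconv)
    (hmem.mono fun w hw => hw.2) hint (aemeasurable_of_domRestrict hf hmem) ?_
  -- `f` is measurable only on `U ×ˢ T`, possibly a non-measurable set. The integrand along the
  -- means is measurable because the graph of the mean carries its own push-forward inside that set.
  have h1 : ∀ᵐ w ∂(ρ.map fun x => (x, ∫ q, q ∂κ x)), w ∈ U ×ˢ T := by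
    refine ae_map_of_ae hm ?_
    filter_upwards [hb, hU] with x h1 h2 using ⟨h2, h1⟩
  exact (aemeasurable_of_domRestrict hf h1).comp_aemeasurable hm

end Barycenter

/-- `y`, `G` and `t` satisfy the Gauss-Green formula. -/
def IsGreenTriple {n m : ℕ} (Ω : Set (Vec n)) (y : Vec n → Vec m) (G : Vec n → Mat m n)
    (t : Vec n → Vec m) : Prop :=
  ∀ φ : Vec n → ℝ, ContDiff ℝ ∞ φ → ∀ j : Fin n,
    ∫ x in Ω, (pderiv j φ x • y x + φ x • G x j)
      = ∫ x, (φ x * exteriorNormal Ω x j) • t x ∂(surfaceMeasure Ω)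

theorem integrable_smul_of_continuous {n : ℕ} {Ω : Set (Vec n)} {F : Type*} [NormedAddCommGroup F]
    [NormedSpace ℝ F] (hopen : IsOpen Ω) (hbdd : Bornology.IsBounded Ω) {f : Vec n → ℝ}
    (hf : Continuous f) {g : Vec n → F} (hg : Integrable g (volume.restrict Ω)) :
    Integrable (fun x => f x • g x) (volume.restrict Ω) := by
  obtain ⟨C, hC⟩ := hbdd.isCompact_closure.exists_bound_of_continuousOn hf.continuousOn
  refine hg.bdd_smul C hf.aestronglyMeasurable ?_
  filter_upwards [ae_restrict_mem hopen.measurableSet] with x hx using hC x (subset_closure hx)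

theorem IsGreenTriple.isWeakDeriv {n m : ℕ} {Ω : Set (Vec n)} {y : Vec n → Vec m}
    {G : Vec n → Mat m n} {t : Vec n → Vec m} (h : IsGreenTriple Ω y G t) (hopen : IsOpen Ω)
    (hbdd : Bornology.IsBounded Ω) (hy : Integrable y (volume.restrict Ω))
    (hG : ∀ j, Integrable (fun x => G x j) (volume.restrict Ω)) : IsWeakDeriv Ω y G := by
  intro ψ hψ _ hψt j
  have h0 : ∫ x, (ψ x * exteriorNormal Ω x j) • t x ∂(surfaceMeasure Ω) = 0 := by
    refine integral_eq_zero_of_ae ((ae_mem_frontier Ω).mono fun x hx => ?_)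
    have : ψ x = 0 := image_eq_zero_of_notMem_tsupport fun hx' => by
      rw [hopen.frontier_eq] at hx; exact hx.2 (hψt hx')
    simp [this]
  have h1 := h ψ hψ j
  rw [h0, integral_add (integrable_smul_of_continuous hopen hbdd
    (continuous_pderiv (hψ.of_le (by simp)) j) hy)
    (integrable_smul_of_continuous hopen hbdd hψ.continuous (hG j))] at h1
  exact eq_neg_of_add_eq_zero_left h1

namespace VarData

variable {k m : ℕ} {I : Type*} {Ω : Set (Vec (k + 1))} {P Q : VarData (k + 1) m I} {p : ℝ≥0∞}
  {μ : Measure (Vec (k + 1) × Vec m × Mat m (k + 1))} {μb : Measure (Vec (k + 1) × Vec m)}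

theorem exists_ae_norm_snd_le {X F : Type*} [NormedAddCommGroup X] [NormedAddCommGroup F]
    [MeasurableSpace (X × F)] [SecondCountableTopology (X × F)] {ν : Measure (X × F)}
    (h : IsCompact ν.support) : ∃ C : ℝ, ∀ᵐ w ∂ν, ‖w.2‖ ≤ C := by
  obtain ⟨C, hC⟩ := h.isBounded.exists_norm_le
  refine ⟨C, ?_⟩
  filter_upwards [(Measure.support_mem_ae : ν.support ∈ ae ν)] with w hw
  exact (norm_snd_le w).trans (hC w hw)

/-- The norm of `(y, z)` is the maximum of `‖y‖` and the column norms of `z`, so it is one of the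
summands of the moment condition. For `p = ∞` the compact support gives a bound. -/
theorem IsAffOccupation.memLp_bulk (h : P.IsAffOccupation Ω p μ μb)
    (hr : P.RelaxedConstraints Ω μ μb) (hp : 1 ≤ p) :
    MemLp (fun w : Vec (k + 1) × Vec m × Mat m (k + 1) => w.2) p μ := by
  have hms : AEStronglyMeasurable (fun w : Vec (k + 1) × Vec m × Mat m (k + 1) => w.2) μ :=
    measurable_snd.aestronglyMeasurable
  rcases eq_or_ne p ⊤ with rfl | hp'
  · obtain ⟨C, hC⟩ := exists_ae_norm_snd_le (h.compact_support rfl).1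
    exact memLp_top_of_bound hms C hC
  · refine ⟨hms, ?_⟩
    rw [eLpNorm_lt_top_iff_lintegral_rpow_enorm_lt_top (fun h0 => by simp [h0] at hp) hp']
    refine lt_of_le_of_lt (lintegral_mono fun w => ?_)
      (restrict_fst_mem hr.bulk ▸ (h.moment hp').1)
    have hpos : 0 ≤ p.toReal := ENNReal.toReal_nonneg
    obtain ⟨x, y, z⟩ := w
    simp only
    rcases le_total ‖y‖ ‖z‖ with hyz | hyz
    · have e1 : ‖((y, z) : Vec m × Mat m (k + 1))‖ₑ = ‖z‖ₑ := by
        rw [← ofReal_norm, ← ofReal_norm, Prod.norm_def, max_eq_right hyz]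
      obtain ⟨j, hj⟩ : ∃ j, ‖z‖ = ‖z j‖ := by
        obtain ⟨j, -, hj⟩ := Finset.exists_mem_eq_sup' (s := Finset.univ)
          Finset.univ_nonempty (fun j => ‖z j‖₊)
        refine ⟨j, ?_⟩
        rw [Pi.norm_def, ← coe_nnnorm, NNReal.coe_inj, ← hj, Finset.sup'_eq_sup]
      have e2 : ‖z‖ₑ = ‖z j‖ₑ := by
        rw [← ofReal_norm, ← ofReal_norm, hj]
      rw [e1, e2]
      exact (Finset.single_le_sum (f := fun j => ‖z j‖ₑ ^ p.toReal) (fun _ _ => zero_le)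
        (Finset.mem_univ j)).trans le_add_self
    · have e1 : ‖((y, z) : Vec m × Mat m (k + 1))‖ₑ = ‖y‖ₑ := by
        rw [← ofReal_norm, ← ofReal_norm, Prod.norm_def, max_eq_left hyz]
      rw [e1]
      exact le_self_add

theorem IsAffOccupation.memLp_bdry (h : P.IsAffOccupation Ω p μ μb) (hp : 1 ≤ p) :
    MemLp (fun w : Vec (k + 1) × Vec m => w.2) p μb := by
  have hms : AEStronglyMeasurable (fun w : Vec (k + 1) × Vec m => w.2) μb :=
    measurable_snd.aestronglyMeasurable
  rcases eq_or_ne p ⊤ with rfl | hp'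
  · obtain ⟨C, hC⟩ := exists_ae_norm_snd_le (h.compact_support rfl).2
    exact memLp_top_of_bound hms C hC
  · refine ⟨hms, ?_⟩
    rw [eLpNorm_lt_top_iff_lintegral_rpow_enorm_lt_top (fun h0 => by simp [h0] at hp) hp']
    exact (h.moment hp').2

/-- The conditional mean of `(y, Dy)`. -/
def bulkMean (μ : Measure (Vec (k + 1) × Vec m × Mat m (k + 1))) [IsFiniteMeasure μ]
    (x : Vec (k + 1)) : Vec m × Mat m (k + 1) :=
  ∫ q, q ∂(μ.condKernel x)

/-- The conditional mean of the boundary values. -/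
def bdryMean (μb : Measure (Vec (k + 1) × Vec m)) [IsFiniteMeasure μb] (x : Vec (k + 1)) : Vec m :=
  ∫ q, q ∂(μb.condKernel x)

/-- The affine Liouville equation depends on `y` and `z` only linearly, so integrating out the
conditional measures replaces them by their means. -/
theorem IsAffOccupation.isGreenTriple [IsFiniteMeasure μ] [IsFiniteMeasure μb]
    (h : P.IsAffOccupation Ω p μ μb)
    (hr : P.RelaxedConstraints Ω μ μb) (hopen : IsOpen Ω) (hconn : IsConnected Ω)
    (hbdd : Bornology.IsBounded Ω) (hlip : HasLipschitzBoundary Ω) (hp : 1 ≤ p) :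
    IsGreenTriple Ω (fun x => (bulkMean μ x).1) (fun x => (bulkMean μ x).2) (bdryMean μb) := by
  have hfin := isFiniteMeasure_restrict_of_isBounded hbdd
  have hfin' := isFiniteMeasure_surfaceMeasure hopen hbdd hlip
  have e1 : (volume.restrict Ω).compProd μ.condKernel = μ := by
    conv_rhs => rw [← μ.disintegrate μ.condKernel, h.fst_bulk hr hopen hconn hbdd]
  have e2 : (surfaceMeasure Ω).compProd μb.condKernel = μb := by
    conv_rhs => rw [← μb.disintegrate μb.condKernel, h.fst_bdry hr hopen hconn hbdd hlip]
  have hL := h.memLp_bulk hr hp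
  have hLb := h.memLp_bdry hp
  have hint : ∀ᵐ x ∂(volume.restrict Ω), Integrable (fun q => q) (μ.condKernel x) :=
    ae_integrable_of_memLp_snd hp (by rwa [e1])
  have hcl : ∀ᵐ w ∂μ, w.1 ∈ closure Ω := h.conc_bulk.mono fun w hw => hw.1
  have hfr : ∀ᵐ w ∂μb, w.1 ∈ frontier Ω := h.conc_bdry.mono fun w hw => hw.1
  intro φ hφ j
  have hφd : Continuous (pderiv j φ) := continuous_pderiv (hφ.of_le (by simp)) j
  obtain ⟨C, hC⟩ := hbdd.isCompact_closure.exists_bound_of_continuousOn hφ.continuous.continuousOn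
  obtain ⟨C', hC'⟩ := hbdd.isCompact_closure.exists_bound_of_continuousOn hφd.continuousOn
  have hnb : ∀ᵐ w ∂μb, ‖φ w.1 * exteriorNormal Ω w.1 j‖ ≤ C := by
    filter_upwards [hfr] with w hx
    rw [norm_mul]
    exact (mul_le_of_le_one_right (norm_nonneg _) (abs_exteriorNormal_apply_le Ω w.1 j)).trans
      (hC w.1 (frontier_subset_closure hx))
  have hnm : Measurable fun x => φ x * exteriorNormal Ω x j :=
    hφ.continuous.measurable.mul (measurable_exteriorNormal_apply Ω j)
  have hbulk : Integrable (fun w : Vec (k + 1) × Vec m × Mat m (k + 1) =>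
      pderiv j φ w.1 • w.2.1 + φ w.1 • w.2.2 j) μ := by
    have h1 := (hL.integrable hp).fst
    have h2 := (hL.integrable hp).snd.eval j
    refine Integrable.add (h1.bdd_smul C' (hφd.comp continuous_fst).aestronglyMeasurable
      (hcl.mono fun w hw => hC' _ hw)) (h2.bdd_smul C
      (hφ.continuous.comp continuous_fst).aestronglyMeasurable (hcl.mono fun w hw => hC _ hw))
  have hbdry : Integrable (fun w : Vec (k + 1) × Vec m =>
      (φ w.1 * exteriorNormal Ω w.1 j) • w.2) μb :=
    (hLb.integrable hp).bdd_smul C (hnm.comp measurable_fst).aestronglyMeasurable hnb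
  have key : ∫ w, (pderiv j φ w.1 • w.2.1 + φ w.1 • w.2.2 j) ∂μ
      = ∫ w, (φ w.1 * exteriorNormal Ω w.1 j) • w.2 ∂μb := by
    -- The vector identity is tested against each fixed `v`, which corresponds to `φ₂ = φ • v`.
    refine ext_inner_left ℝ fun v => ?_
    rw [← integral_inner hbulk, ← integral_inner hbdry]
    have hl := h.liouville 0 (fun x => φ x • v) contDiff_const (hφ.smul contDiff_const) j
    rw [restrict_fst_mem hr.bulk] at hl
    have e3 : ∀ x, pderiv j (0 : Vec (k + 1) → ℝ) x = 0 := fun x => by simp [pderiv]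
    have e4 : ∀ x, pderiv j (fun x => φ x • v) x = pderiv j φ x • v := fun x => by
      rw [pderiv, pderiv, fderiv_smul_const (hφ.differentiable (by simp) x)]
      simp
    simp only [e3, e4, zero_add, Pi.zero_apply] at hl
    convert hl using 1
    · refine integral_congr_ae (ae_of_all _ fun w => ?_)
      simp only [inner_add_right, inner_smul_right, inner_smul_left, RCLike.conj_to_real,
        real_inner_comm]
    · refine integral_congr_ae (ae_of_all _ fun w => ?_)
      simp only [inner_smul_right, real_inner_comm]
      ring
  have l1 : ∫ w, (pderiv j φ w.1 • w.2.1 + φ w.1 • w.2.2 j) ∂μ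
      = ∫ x in Ω, (pderiv j φ x • (bulkMean μ x).1 + φ x • (bulkMean μ x).2 j) := by
    conv_lhs => rw [← e1]
    rw [Measure.integral_compProd (by rwa [e1])]
    refine integral_congr_ae (hint.mono fun x hx => ?_)
    have h1 := hx.fst
    have h2 := hx.snd
    have a1 : Integrable (fun q : Vec m × Mat m (k + 1) => pderiv j φ x • q.1) (μ.condKernel x) :=
      h1.smul (pderiv j φ x)
    have a2 : Integrable (fun q : Vec m × Mat m (k + 1) => φ x • q.2 j) (μ.condKernel x) :=
      (h2.eval j).smul (φ x)
    simp only
    rw [integral_add a1 a2, integral_smul, integral_smul, bulkMean,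
      fst_integral hx, snd_integral hx, eval_integral fun i => h2.eval i]
  have l2 : ∫ w, (φ w.1 * exteriorNormal Ω w.1 j) • w.2 ∂μb
      = ∫ x, (φ x * exteriorNormal Ω x j) • bdryMean μb x ∂(surfaceMeasure Ω) := by
    conv_lhs => rw [← e2]
    rw [Measure.integral_compProd (by rwa [e2])]
    refine integral_congr_ae (ae_of_all _ fun x => ?_)
    simp only
    rw [integral_smul, bdryMean]
  rw [← l1, ← l2, key]

end VarData

end OccMeas

end

/-! ### Mollification and density of functions smooth up to the boundary -/

noncomputable section

namespace OccMeas

variable {n : ℕ} {F : Type*} [NormedAddCommGroup F]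

/-- Translations are continuous in `L¹`. -/
theorem exists_eLpNorm_translate_le {f : Vec n → F} (hf : Integrable f) {ε : ℝ≥0∞} (hε : 0 < ε) :
    ∃ δ > 0, ∀ v : Vec n, ‖v‖ < δ → ∫⁻ x, ‖f (x - v) - f x‖ₑ ≤ ε := by
  have : Fact ((1 : ℝ≥0∞) ≠ ⊤) := ⟨ENNReal.one_ne_top⟩
  have hL : MemLp f 1 (volume : Measure (Vec n)) := memLp_one_iff_integrable.2 hf
  set g : Lp F 1 (volume : Measure (Vec n)) := hL.toLp f with hg
  have hc : Continuous fun v : (Vec n)ᵈᵃᵃ => v +ᵥ g := continuous_id.vadd continuous_const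
  have h0 : Tendsto (fun v : Vec n => edist (DomAddAct.mk v +ᵥ g) g) (𝓝 0) (𝓝 0) := by
    have h1 : Continuous fun v : Vec n => edist (DomAddAct.mk v +ᵥ g) g :=
      (hc.comp DomAddAct.continuous_mk).edist continuous_const
    have := h1.tendsto 0
    simpa using this
  obtain ⟨δ, hδ, hb⟩ := Metric.eventually_nhds_iff.1 (h0.eventually_lt_const hε)
  refine ⟨δ, hδ, fun v hv => ?_⟩
  -- The action adds its parameter to the argument, so `-v` produces `f (x - v)`.
  have h2 := (hb (y := -v) (by simpa using hv)).le
  rw [Lp.edist_def, eLpNorm_one_eq_lintegral_enorm] at h2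
  refine le_trans (le_of_eq (lintegral_congr_ae ?_)) h2
  have h3 : (fun x => g (-v + x)) =ᵐ[volume] fun x => f (-v + x) :=
    (measurePreserving_add_left volume (-v)).quasiMeasurePreserving.ae_eq_comp hL.coeFn_toLp
  filter_upwards [DomAddAct.vadd_Lp_ae_eq (DomAddAct.mk (-v)) g, hL.coeFn_toLp, h3] with x h4 h5 h6
  rw [Pi.sub_apply, h4, h5]
  simp only [Equiv.symm_apply_apply, vadd_eq_add]
  rw [h6, neg_add_eq_sub]

variable [NormedSpace ℝ F]

/-- The convolution of `f` with the scalar kernel `ρ`. -/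
def mollify (ρ : Vec n → ℝ) (f : Vec n → F) (x : Vec n) : F := ∫ ξ, ρ (x - ξ) • f ξ

theorem mollify_eq_convolution (ρ : Vec n → ℝ) (f : Vec n → F) :
    mollify ρ f = convolution f ρ (ContinuousLinearMap.lsmul ℝ ℝ).flip volume := by
  ext x
  rw [convolution_def]
  rfl

theorem contDiff_mollify {ρ : Vec n → ℝ} (hρ : ContDiff ℝ ∞ ρ) (hρc : HasCompactSupport ρ)
    {f : Vec n → F} (hf : Integrable f) : ContDiff ℝ ∞ (mollify ρ f) := by
  rw [mollify_eq_convolution]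
  exact hρc.contDiff_convolution_right _ hf.locallyIntegrable hρ

theorem pderiv_mollify [CompleteSpace F] {ρ : Vec n → ℝ} (hρ : ContDiff ℝ ∞ ρ)
    (hρc : HasCompactSupport ρ) {f : Vec n → F} (hf : Integrable f) (j : Fin n) (x : Vec n) :
    pderiv j (mollify ρ f) x = ∫ ξ, pderiv j ρ (x - ξ) • f ξ := by
  rw [mollify_eq_convolution, pderiv, (hρc.hasFDerivAt_convolution_right _ hf.locallyIntegrable
    (hρ.of_le (by simp)) x).fderiv, convolution_def]
  obtain ⟨C, hC⟩ := hasCompactSupport_fderiv_bound hρ hρc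
  have hint : Integrable (fun ξ => (ContinuousLinearMap.precompR (Vec n)
      (ContinuousLinearMap.lsmul ℝ ℝ).flip) (f ξ) (fderiv ℝ ρ (x - ξ))) :=
    (hρc.fderiv (𝕜 := ℝ)).convolutionExists_right _ hf.locallyIntegrable
      (hρ.continuous_fderiv (by simp)) x
  rw [ContinuousLinearMap.integral_apply hint]
  refine integral_congr_ae (ae_of_all _ fun ξ => ?_)
  simp [pderiv, ContinuousLinearMap.precompR_apply]

/-- A smooth nonnegative kernel of mass one, supported in the `δ`-ball. -/
structure IsMollifier (δ : ℝ) (ρ : Vec n → ℝ) : Prop where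
  smooth : ContDiff ℝ ∞ ρ
  compact : HasCompactSupport ρ
  nonneg : ∀ x, 0 ≤ ρ x
  mass : ∫ x, ρ x = 1
  support : ∀ x, ρ x ≠ 0 → ‖x‖ < δ

/-- The error is an average of the differences `f (x - v) - f x` over `‖v‖ < δ`; by Fubini its `L¹`
norm is the average of their `L¹` norms. -/
theorem IsMollifier.lintegral_mollify_sub_le [CompleteSpace F] {δ : ℝ} {ρ : Vec n → ℝ}
    (h : IsMollifier δ ρ)
    {f : Vec n → F} (hf : Integrable f) {ε : ℝ≥0∞}
    (hδ : ∀ v : Vec n, ‖v‖ < δ → ∫⁻ x, ‖f (x - v) - f x‖ₑ ≤ ε) :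
    ∫⁻ x, ‖mollify ρ f x - f x‖ₑ ≤ ε := by
  have hρi : Integrable ρ := h.smooth.continuous.integrable_of_hasCompactSupport h.compact
  obtain ⟨C, hC⟩ := h.compact.exists_bound_of_continuous h.smooth.continuous
  have e1 : ∀ x, mollify ρ f x - f x = ∫ v, ρ v • (f (x - v) - f x) := by
    intro x
    have i1 : Integrable fun v => ρ v • f (x - v) :=
      (hf.comp_sub_left x).bdd_smul C h.smooth.continuous.aestronglyMeasurable (ae_of_all _ hC)
    simp only [smul_sub]
    rw [integral_sub i1 (hρi.smul_const _), integral_smul_const, h.mass, one_smul, mollify,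
      ← integral_sub_left_eq_self (fun ξ => ρ (x - ξ) • f ξ) volume x]
    simp
  have hm : AEMeasurable (Function.uncurry fun x v : Vec n => ‖ρ v • (f (x - v) - f x)‖ₑ)
      (volume.prod volume) := by
    have m1 : AEStronglyMeasurable (fun q : Vec n × Vec n => f (q.1 - q.2)) (volume.prod volume) :=
      hf.1.comp_quasiMeasurePreserving (quasiMeasurePreserving_sub volume volume)
    have m2 : AEStronglyMeasurable (fun q : Vec n × Vec n => f q.1) (volume.prod volume) :=
      hf.1.comp_fst
    have m3 : AEStronglyMeasurable (fun q : Vec n × Vec n => ρ q.2) (volume.prod volume) :=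
      (h.smooth.continuous.comp continuous_snd).aestronglyMeasurable
    exact (m3.smul (m1.sub m2)).enorm
  calc ∫⁻ x, ‖mollify ρ f x - f x‖ₑ
      ≤ ∫⁻ x, ∫⁻ v, ‖ρ v • (f (x - v) - f x)‖ₑ := lintegral_mono fun x => by
        rw [e1]; exact enorm_integral_le_lintegral_enorm _
    _ = ∫⁻ v, ∫⁻ x, ‖ρ v • (f (x - v) - f x)‖ₑ := lintegral_lintegral_swap hm
    _ ≤ ∫⁻ v, ENNReal.ofReal (ρ v) * ε := lintegral_mono fun v => by
        simp only [enorm_smul]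
        rw [lintegral_const_mul' _ _ enorm_ne_top, Real.enorm_of_nonneg (h.nonneg v)]
        by_cases hv : ρ v = 0
        · simp [hv]
        · gcongr
          exact hδ v (h.support v hv)
    _ = ε := by
        rw [lintegral_mul_const _ h.smooth.continuous.measurable.ennreal_ofReal,
          ← ofReal_integral_eq_lintegral_ofReal hρi (ae_of_all _ h.nonneg), h.mass,
          ENNReal.ofReal_one, one_mul]

/-- The bump may be centred away from the origin, so that mollification can sample `Ω` on one side
only. -/
theorem isMollifier_normed {c : Vec n} (B : ContDiffBump c) {δ : ℝ} (h : ‖c‖ + B.rOut < δ) :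
    IsMollifier δ (B.normed volume) where
  smooth := B.contDiff_normed
  compact := B.hasCompactSupport_normed
  nonneg := B.nonneg_normed
  mass := B.integral_normed
  support x hx := by
    have : x ∈ tsupport (B.normed volume) := subset_tsupport _ hx
    rw [B.tsupport_normed_eq, mem_closedBall_iff_norm] at this
    calc ‖x‖ = ‖c + (x - c)‖ := by congr 1; abel
      _ ≤ ‖c‖ + ‖x - c‖ := norm_add_le _ _
      _ < δ := by linarith

/-- If the translates of `Ω` used by `ρ` stay in `Ω` on the support of the cutoff `η`, mollification
commutes with weak derivatives in `Ω`. -/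
theorem pderiv_mollify_of_isWeakDeriv {m : ℕ} {Ω : Set (Vec n)} (hopen : IsOpen Ω)
    (hbdd : Bornology.IsBounded Ω) {y : Vec n → Vec m} {G : Vec n → Mat m n}
    (hy : Integrable y (volume.restrict Ω))
    (hG : ∀ j, Integrable (fun x => G x j) (volume.restrict Ω)) (hw : IsWeakDeriv Ω y G)
    {ρ η : Vec n → ℝ} (hρ : ContDiff ℝ ∞ ρ) (hρc : HasCompactSupport ρ) (hη : ContDiff ℝ ∞ η)
    {x : Vec n} (hx : ∀ ξ ∈ tsupport η, x - ξ ∈ tsupport ρ → ξ ∈ Ω) (j : Fin n) :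
    pderiv j (mollify ρ (Ω.indicator fun ξ => η ξ • y ξ)) x =
      mollify ρ (Ω.indicator fun ξ => pderiv j η ξ • y ξ + η ξ • G ξ j) x := by
  have hηd := continuous_pderiv (hη.of_le (m := 1) (by simp)) j
  have hρd := continuous_pderiv (hρ.of_le (m := 1) (by simp)) j
  have i0 : Integrable (Ω.indicator fun ξ => η ξ • y ξ) :=
    (integrable_indicator_iff hopen.measurableSet).2
      (integrable_smul_of_continuous hopen hbdd hη.continuous hy)
  rw [pderiv_mollify hρ hρc i0, mollify]
  have e : ∀ (a : Vec n → ℝ) (b : Vec n → Vec m),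
      ∫ ξ, a ξ • Ω.indicator b ξ = ∫ ξ in Ω, a ξ • b ξ := by
    intro a b
    rw [← integral_indicator hopen.measurableSet]
    refine integral_congr_ae (ae_of_all _ fun ξ => ?_)
    by_cases hξ : ξ ∈ Ω <;> simp [hξ]
  rw [e, e]
  have hρx : ContDiff ℝ ∞ fun ξ => ρ (x - ξ) := hρ.comp (contDiff_const.sub contDiff_id)
  have hcont : Continuous fun ξ : Vec n => x - ξ := continuous_const.sub continuous_id
  have hρt : tsupport (fun ξ => ρ (x - ξ)) = (fun ξ => x - ξ) ⁻¹' tsupport ρ :=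
    tsupport_comp_eq_preimage ρ (Homeomorph.subLeft x)
  have hρxc : HasCompactSupport fun ξ => ρ (x - ξ) := hρc.comp_homeomorph (Homeomorph.subLeft x)
  have hd : ∀ ξ, pderiv j (fun ξ => ρ (x - ξ) * η ξ) ξ =
      -(pderiv j ρ (x - ξ) * η ξ) + ρ (x - ξ) * pderiv j η ξ := by
    intro ξ
    have h1 : HasFDerivAt (fun ξ : Vec n => x - ξ) (-ContinuousLinearMap.id ℝ (Vec n)) ξ := by
      simpa using (hasFDerivAt_id ξ).const_sub x
    have h2 : HasFDerivAt (fun ξ => ρ (x - ξ))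
        ((fderiv ℝ ρ (x - ξ)).comp (-ContinuousLinearMap.id ℝ (Vec n))) ξ :=
      ((hρ.differentiable (by simp)) (x - ξ)).hasFDerivAt.comp ξ h1
    have h3 := h2.mul ((hη.differentiable (by simp)) ξ).hasFDerivAt
    rw [pderiv, HasFDerivAt.fderiv (f := fun ξ => ρ (x - ξ) * η ξ) h3]
    simp [pderiv]
    ring
  -- Admissible as a test function for the weak derivative: by `hx` its support lies in `Ω` although
  -- `y` is not defined beyond.
  have key := hw (fun ξ => ρ (x - ξ) * η ξ) (hρx.mul hη) hρxc.mul_right (by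
    intro ξ hξ
    refine hx ξ (tsupport_mul_subset_right hξ) ?_
    have := tsupport_mul_subset_left hξ
    rw [hρt] at this
    exact this) j
  simp only [hd] at key
  have j1 : Integrable (fun ξ => (pderiv j ρ (x - ξ) * η ξ) • y ξ) (volume.restrict Ω) :=
    integrable_smul_of_continuous hopen hbdd ((hρd.comp hcont).mul hη.continuous) hy
  have j2 : Integrable (fun ξ => (ρ (x - ξ) * pderiv j η ξ) • y ξ) (volume.restrict Ω) :=
    integrable_smul_of_continuous hopen hbdd ((hρ.continuous.comp hcont).mul hηd) hy
  have j3 : Integrable (fun ξ => (ρ (x - ξ) * η ξ) • G ξ j) (volume.restrict Ω) :=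
    integrable_smul_of_continuous hopen hbdd ((hρ.continuous.comp hcont).mul hη.continuous) (hG j)
  have e1 : ∫ ξ in Ω, (-(pderiv j ρ (x - ξ) * η ξ) + ρ (x - ξ) * pderiv j η ξ) • y ξ
      = -(∫ ξ in Ω, (pderiv j ρ (x - ξ) * η ξ) • y ξ)
        + ∫ ξ in Ω, (ρ (x - ξ) * pderiv j η ξ) • y ξ := by
    simp only [neg_add_eq_sub, sub_smul]
    rw [integral_sub j2 j1]
  have e2 : ∫ ξ in Ω, ρ (x - ξ) • (pderiv j η ξ • y ξ + η ξ • G ξ j)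
      = (∫ ξ in Ω, (ρ (x - ξ) * pderiv j η ξ) • y ξ) + ∫ ξ in Ω, (ρ (x - ξ) * η ξ) • G ξ j := by
    simp only [smul_add, smul_smul]
    rw [integral_add j2 j3]
  rw [e1] at key
  rw [e2]
  simp only [smul_smul]
  rw [neg_add_eq_iff_eq_add] at key
  rw [key]
  abel

section Atlas

variable {k m : ℕ} {Ω : Set (Vec (k + 1))}

/-- For the interior patch any small kernel works. In a chart the kernel is centred at `-(K + 2) ε •
e` with radius `ε`, so the sampled points lie above `x` by at least `(K + 1) ε`, while the graph
rises by at most `K ε`. -/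
theorem LipAtlas.exists_mollifier (a : LipAtlas Ω) (hbdd : Bornology.IsBounded Ω)
    (i : Option a.ix) {δ : ℝ} (hδ : 0 < δ) :
    ∃ ρ : Vec (k + 1) → ℝ, IsMollifier δ ρ ∧
      ∀ x ∈ Ω, ∀ ξ ∈ tsupport (a.η i), x - ξ ∈ tsupport ρ → ξ ∈ Ω := by
  cases i with
  | none =>
    exact ⟨_, isMollifier_normed (c := 0) ⟨δ / 4, δ / 2, by positivity, by linarith⟩
      (by simp; linarith), fun x _ ξ hξ _ => a.supp_none hξ⟩
  | some i =>
    obtain ⟨δ', hδ', hsub⟩ := (a.hasCompactSupport hbdd (some i)).isCompact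
      |>.exists_thickening_subset_open Metric.isOpen_ball (a.supp_some i)
    have hc := a.chart i
    set K : ℝ := (a.K i : ℝ)
    have hK : 0 ≤ K := (a.K i).2
    have he : ‖a.e i‖ = 1 := hc.frame.norm
    set d := min δ δ' with hd
    have hd0 : 0 < d := lt_min hδ hδ'
    -- The kernel reaches out to `(K + 2) ε + ε`, which must stay below both `δ` and the margin `δ'`
    -- of the cutoff inside its ball.
    set ε := d / (2 * (K + 3)) with hε
    have hε0 : 0 < ε := by positivity
    have hεd : (K + 3) * ε < d := by
      have : (K + 3) * ε = d / 2 := by rw [hε]; field_simp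
      rw [this]; linarith
    have hcn : ‖-((K + 2) * ε) • a.e i‖ = (K + 2) * ε := by
      rw [norm_smul, he, mul_one, norm_neg, Real.norm_of_nonneg (by positivity)]
    set B : ContDiffBump (-((K + 2) * ε) • a.e i) := ⟨ε / 2, ε, by positivity, by linarith⟩ with hB
    refine ⟨B.normed volume, isMollifier_normed B ?_, ?_⟩
    · rw [hcn]
      have : d ≤ δ := min_le_left _ _
      change (K + 2) * ε + ε < δ
      linarith
    · intro x hx ξ hξ hxξ
      rw [B.tsupport_normed_eq, mem_closedBall_iff_norm] at hxξ
      change ‖x - ξ - -((K + 2) * ε) • a.e i‖ ≤ ε at hxξ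
      set b := x - ξ - -((K + 2) * ε) • a.e i with hb
      have hξeq : ξ = (x - b) + ((K + 2) * ε) • a.e i := by
        rw [hb, neg_smul]; abel
      have hxball : x ∈ Metric.ball (a.x₀ i) (a.r i) := by
        refine hsub (Metric.mem_thickening_iff.2 ⟨ξ, hξ, ?_⟩)
        rw [dist_eq_norm]
        have : x - ξ = b + -((K + 2) * ε) • a.e i := by rw [hb]; abel
        rw [this]
        have h1 := norm_add_le b (-((K + 2) * ε) • a.e i)
        rw [hcn] at h1
        have : d ≤ δ' := min_le_right _ _
        linarith
      rw [hc.mem_iff ξ (a.supp_some i hξ)]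
      rw [hc.mem_iff x hxball] at hx
      have hg : a.g i ξ ≤ a.g i x + K * ε := by
        rw [hξeq, hc.inv]
        have := hc.lip.dist_le_mul (x - b) x
        rw [Real.dist_eq, dist_eq_norm, sub_sub_cancel_left, norm_neg] at this
        have h2 := (abs_le.1 this).2
        have h3 : K * ‖b‖ ≤ K * ε := mul_le_mul_of_nonneg_left hxξ hK
        change _ ≤ K * ‖b‖ at h2
        linarith
      have hin : inner ℝ ξ (a.e i) = inner ℝ x (a.e i) - inner ℝ b (a.e i) + (K + 2) * ε := by
        rw [hξeq, inner_add_left, inner_sub_left, real_inner_smul_left, real_inner_self_eq_norm_sq,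
          he]
        ring
      have hbe : inner ℝ b (a.e i) ≤ ε := by
        have := real_inner_le_norm b (a.e i)
        rw [he, mul_one] at this
        exact this.trans hxξ
      rw [hin]
      nlinarith

/-- Functions smooth up to the boundary are dense in `W^{1,1}(Ω)`. -/
theorem exists_contDiff_approx (hopen : IsOpen Ω) (hbdd : Bornology.IsBounded Ω)
    (hlip : HasLipschitzBoundary Ω) {y : Vec (k + 1) → Vec m} {G : Vec (k + 1) → Mat m (k + 1)}
    (hy : Integrable y (volume.restrict Ω))
    (hG : ∀ j, Integrable (fun x => G x j) (volume.restrict Ω)) (hw : IsWeakDeriv Ω y G)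
    {ε : ℝ≥0∞} (hε : 0 < ε) :
    ∃ u : Vec (k + 1) → Vec m, ContDiff ℝ ∞ u ∧
      ∫⁻ x in Ω, ‖u x - y x‖ₑ ≤ ε ∧ ∀ j, ∫⁻ x in Ω, ‖pderiv j u x - G x j‖ₑ ≤ ε := by
  obtain ⟨a⟩ := exists_lipAtlas hopen hbdd hlip
  set N : ℝ≥0∞ := (Fintype.card (Option a.ix) : ℝ≥0∞) with hN
  have hN0 : N ≠ ⊤ := ENNReal.natCast_ne_top _
  -- The error is shared equally among the patches, each of which has its own kernel.
  have hε' : 0 < ε / N := ENNReal.div_pos hε.ne' hN0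
  set f : Option a.ix → Vec (k + 1) → Vec m := fun i => Ω.indicator fun ξ => a.η i ξ • y ξ with hf
  set h : Option a.ix → Fin (k + 1) → Vec (k + 1) → Vec m := fun i j =>
    Ω.indicator fun ξ => pderiv j (a.η i) ξ • y ξ + a.η i ξ • G ξ j with hh
  have hfi : ∀ i, Integrable (f i) := fun i => (integrable_indicator_iff hopen.measurableSet).2
    (integrable_smul_of_continuous hopen hbdd (a.smooth i).continuous hy)
  have hhi : ∀ i j, Integrable (h i j) := fun i j =>
    (integrable_indicator_iff hopen.measurableSet).2
    ((integrable_smul_of_continuous hopen hbdd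
      (continuous_pderiv ((a.smooth i).of_le (by simp)) j) hy).add
      (integrable_smul_of_continuous hopen hbdd (a.smooth i).continuous (hG j)))
  have hchoose : ∀ i, ∃ ρ : Vec (k + 1) → ℝ, ContDiff ℝ ∞ ρ ∧ HasCompactSupport ρ ∧
      (∀ x ∈ Ω, ∀ ξ ∈ tsupport (a.η i), x - ξ ∈ tsupport ρ → ξ ∈ Ω) ∧
      ∫⁻ x, ‖mollify ρ (f i) x - f i x‖ₑ ≤ ε / N ∧
      ∀ j, ∫⁻ x, ‖mollify ρ (h i j) x - h i j x‖ₑ ≤ ε / N := by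
    intro i
    obtain ⟨δ₀, hδ₀, H₀⟩ := exists_eLpNorm_translate_le (hfi i) hε'
    choose δ hδ H using fun j => exists_eLpNorm_translate_le (hhi i j) hε'
    set d := min δ₀ (Finset.univ.inf' Finset.univ_nonempty δ) with hd
    have hd0 : 0 < d := lt_min hδ₀ ((Finset.lt_inf'_iff _).2 fun j _ => hδ j)
    obtain ⟨ρ, hρ, hρ'⟩ := a.exists_mollifier hbdd i hd0
    refine ⟨ρ, hρ.smooth, hρ.compact, hρ', hρ.lintegral_mollify_sub_le (hfi i) fun v hv =>
      H₀ v (hv.trans_le (min_le_left _ _)), fun j => hρ.lintegral_mollify_sub_le (hhi i j)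
      fun v hv => H j v (hv.trans_le ((min_le_right _ _).trans
        (Finset.inf'_le _ (Finset.mem_univ j))))⟩
  choose ρ hρs hρc hρ hρf hρh using hchoose
  have hsum : ∀ g : Option a.ix → Vec (k + 1) → Vec m, (∀ i, Integrable (g i)) →
      (∀ i, ∫⁻ x, ‖mollify (ρ i) (g i) x - g i x‖ₑ ≤ ε / N) →
      ∫⁻ x in Ω, ‖∑ i, (mollify (ρ i) (g i) x - g i x)‖ₑ ≤ ε := by
    intro g hgi hg
    have hm : ∀ i, AEMeasurable (fun x => ‖mollify (ρ i) (g i) x - g i x‖ₑ) volume := fun i =>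
      (((contDiff_mollify (hρs i) (hρc i) (hgi i)).continuous.aestronglyMeasurable).sub
        (hgi i).1).enorm
    calc ∫⁻ x in Ω, ‖∑ i, (mollify (ρ i) (g i) x - g i x)‖ₑ
        ≤ ∫⁻ x, ‖∑ i, (mollify (ρ i) (g i) x - g i x)‖ₑ := setLIntegral_le_lintegral _ _
      _ ≤ ∫⁻ x, ∑ i, ‖mollify (ρ i) (g i) x - g i x‖ₑ :=
          lintegral_mono fun x => enorm_sum_le _ _
      _ = ∑ i, ∫⁻ x, ‖mollify (ρ i) (g i) x - g i x‖ₑ :=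
          lintegral_finsetSum' _ fun i _ => hm i
      _ ≤ ∑ _i : Option a.ix, ε / N := Finset.sum_le_sum fun i _ => hg i
      _ ≤ ε := by
          rw [Finset.sum_const, Finset.card_univ, nsmul_eq_mul, ← hN]
          exact ENNReal.mul_div_le
  have hη1 : ∀ x ∈ Ω, ∑ i, a.η i x = 1 := fun x hx => a.sum_eq x (subset_closure hx)
  -- The cutoffs sum to `1`, so the terms in which a cutoff is differentiated cancel and the
  -- localized derivatives sum to `G`.
  have hη0 : ∀ x ∈ Ω, ∀ j, ∑ i, pderiv j (a.η i) x = 0 := by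
    intro x hx j
    have h1 : fderiv ℝ (fun x => ∑ i, a.η i x) x = 0 := by
      have : (fun x => ∑ i, a.η i x) =ᶠ[𝓝 x] fun _ => 1 := by
        filter_upwards [hopen.mem_nhds hx] with z hz using hη1 z hz
      rw [this.fderiv_eq]; simp
    rw [fderiv_fun_sum fun i _ => (a.smooth i).differentiable (by simp) x] at h1
    have h2 := congrArg (fun L => L (EuclideanSpace.single j 1)) h1
    simpa [pderiv] using h2
  refine ⟨fun x => ∑ i, mollify (ρ i) (f i) x, ContDiff.sum fun i _ =>
    contDiff_mollify (hρs i) (hρc i) (hfi i), ?_, fun j => ?_⟩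
  · refine le_trans (le_of_eq (setLIntegral_congr_fun hopen.measurableSet fun x hx => ?_))
      (hsum f hfi hρf)
    have : ∑ i, f i x = y x := by
      simp only [hf, indicator_of_mem hx]
      rw [← Finset.sum_smul, hη1 x hx, one_smul]
    simp only [Finset.sum_sub_distrib, this]
  · refine le_trans (le_of_eq (setLIntegral_congr_fun hopen.measurableSet fun x hx => ?_))
      (hsum (fun i => h i j) (fun i => hhi i j) fun i => hρh i j)
    have h1 : ∑ i, h i j x = G x j := by
      simp only [hh, indicator_of_mem hx]
      rw [Finset.sum_add_distrib, ← Finset.sum_smul, ← Finset.sum_smul, hη0 x hx, hη1 x hx,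
        one_smul, zero_smul, zero_add]
    have h2 : pderiv j (fun x => ∑ i, mollify (ρ i) (f i) x) x = ∑ i, mollify (ρ i) (h i j) x := by
      rw [pderiv, fderiv_fun_sum fun i _ =>
        (contDiff_mollify (hρs i) (hρc i) (hfi i)).differentiable (by simp) x]
      rw [sum_apply]
      exact Finset.sum_congr rfl fun i _ => pderiv_mollify_of_isWeakDeriv hopen hbdd hy hG hw
        (hρs i) (hρc i) (a.smooth i) (fun ξ hξ => hρ i x hx ξ hξ) j
    simp only [Finset.sum_sub_distrib, h1, h2]

end Atlas

end OccMeas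

end

/-! ### The trace inequality and the identification of traces -/

noncomputable section

namespace OccMeas

variable {k m : ℕ} {Ω : Set (Vec (k + 1))}

theorem pderiv_mul {n : ℕ} {f g : Vec n → ℝ} {x : Vec n} (hf : DifferentiableAt ℝ f x)
    (hg : DifferentiableAt ℝ g x) (j : Fin n) :
    pderiv j (fun x => f x * g x) x = pderiv j f x * g x + f x * pderiv j g x := by
  rw [pderiv, fderiv_fun_mul hf hg]
  simp [pderiv]
  ring

/-- The length `√(δ² + ‖w‖²)` of a vector field, regularized at `0`. -/
theorem contDiff_sqrt_add_norm_sq {n : ℕ} {w : Vec n → Vec m} (hw : ContDiff ℝ ∞ w) {δ : ℝ}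
    (hδ : 0 < δ) : ContDiff ℝ ∞ fun x => √(δ ^ 2 + ‖w x‖ ^ 2) :=
  (contDiff_const.add (hw.norm_sq ℝ)).sqrt fun x => by positivity

theorem abs_pderiv_sqrt_le {n : ℕ} {w : Vec n → Vec m} (hw : ContDiff ℝ ∞ w) {δ : ℝ}
    (hδ : 0 < δ) (j : Fin n) (x : Vec n) :
    |pderiv j (fun x => √(δ ^ 2 + ‖w x‖ ^ 2)) x| ≤ ‖pderiv j w x‖ := by
  have hpos : 0 < δ ^ 2 + ‖w x‖ ^ 2 := by positivity
  have h1 : HasFDerivAt w (fderiv ℝ w x) x := (hw.differentiable (by simp) x).hasFDerivAt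
  have h2 := (h1.norm_sq.const_add (δ ^ 2)).sqrt hpos.ne'
  have hs : 0 < √(δ ^ 2 + ‖w x‖ ^ 2) := Real.sqrt_pos.2 hpos
  have e : pderiv j (fun x => √(δ ^ 2 + ‖w x‖ ^ 2)) x
      = (√(δ ^ 2 + ‖w x‖ ^ 2))⁻¹ * inner ℝ (w x) (pderiv j w x) := by
    rw [pderiv, h2.fderiv]
    simp [pderiv]
    field_simp
  rw [e, abs_mul, abs_inv, abs_of_pos hs, inv_mul_le_iff₀ hs]
  refine (abs_real_inner_le_norm _ _).trans (mul_le_mul_of_nonneg_right ?_ (norm_nonneg _))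
  exact Real.le_sqrt_of_sq_le (by nlinarith [sq_nonneg δ])

theorem sqrt_add_sq_le {δ a : ℝ} (hδ : 0 ≤ δ) (ha : 0 ≤ a) : √(δ ^ 2 + a ^ 2) ≤ δ + a :=
  Real.sqrt_le_iff.2 ⟨by positivity, by nlinarith [mul_nonneg hδ ha]⟩

/-- The trace inequality. -/
theorem exists_trace_le (hopen : IsOpen Ω) (hbdd : Bornology.IsBounded Ω)
    (hlip : HasLipschitzBoundary Ω) (m : ℕ) : ∃ C : ℝ, 0 ≤ C ∧ ∀ w : Vec (k + 1) → Vec m,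
      ContDiff ℝ ∞ w → ∫ x, ‖w x‖ ∂(surfaceMeasure Ω)
        ≤ C * ((∫ x in Ω, ‖w x‖) + ∑ j, ∫ x in Ω, ‖pderiv j w x‖) := by
  have hfin := isFiniteMeasure_surfaceMeasure hopen hbdd hlip
  have hfin' := isFiniteMeasure_restrict_of_isBounded hbdd
  obtain ⟨X, c, hc, hX, hXn⟩ := exists_transversal hopen hbdd hlip
  have hXd : ∀ j, Continuous (pderiv j (X j)) := fun j =>
    continuous_pderiv ((hX j).of_le (by simp)) j
  choose M₁ hM₁ using fun j =>
    hbdd.isCompact_closure.exists_bound_of_continuousOn (hX j).continuous.continuousOn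
  choose M₂ hM₂ using fun j =>
    hbdd.isCompact_closure.exists_bound_of_continuousOn (hXd j).continuousOn
  set M : ℝ := ∑ j, (|M₁ j| + |M₂ j|) with hM
  have hM0 : 0 ≤ M := Finset.sum_nonneg fun j _ => by positivity
  have hMj : ∀ j, |M₁ j| + |M₂ j| ≤ M := fun j =>
    Finset.single_le_sum (f := fun j => |M₁ j| + |M₂ j|) (fun j _ => by positivity)
      (Finset.mem_univ j)
  have b1 : ∀ j, ∀ x ∈ Ω, |X j x| ≤ M := fun j x hx => by
    have := hM₁ j x (subset_closure hx)
    have h2 := le_abs_self (M₁ j)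
    have h3 := hMj j
    have h4 := abs_nonneg (M₂ j)
    rw [Real.norm_eq_abs] at this
    linarith
  have b2 : ∀ j, ∀ x ∈ Ω, |pderiv j (X j) x| ≤ M := fun j x hx => by
    have := hM₂ j x (subset_closure hx)
    have h2 := le_abs_self (M₂ j)
    have h3 := hMj j
    have h4 := abs_nonneg (M₁ j)
    rw [Real.norm_eq_abs] at this
    linarith
  set V : ℝ := (volume Ω).toReal with hV
  have hV0 : 0 ≤ V := ENNReal.toReal_nonneg
  refine ⟨c⁻¹ * ((k + 1) * M), by positivity, fun w hw => ?_⟩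
  have hwd : ∀ j, Continuous (pderiv j w) := fun j => continuous_pderiv (hw.of_le (by simp)) j
  have iw : Integrable (fun x => ‖w x‖) (volume.restrict Ω) :=
    integrable_bulk_of_continuous hbdd hw.continuous.norm
  have iwd : ∀ j, Integrable (fun x => ‖pderiv j w x‖) (volume.restrict Ω) := fun j =>
    integrable_bulk_of_continuous hbdd (hwd j).norm
  -- Gauss-Green is applied to the transversal field times `√(δ² + ‖w‖²)`, a smooth substitute for
  -- `‖w‖` whose derivatives are bounded by those of `w`. The error is linear in `δ`.
  have key : ∀ δ > 0, c * ∫ x, ‖w x‖ ∂(surfaceMeasure Ω) ≤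
      ((k + 1) * M * ∫ x in Ω, ‖w x‖) + M * (∑ j, ∫ x in Ω, ‖pderiv j w x‖)
        + (k + 1) * M * V * δ := by
    intro δ hδ
    set N : Vec (k + 1) → ℝ := fun x => √(δ ^ 2 + ‖w x‖ ^ 2) with hN
    have hNs : ContDiff ℝ ∞ N := contDiff_sqrt_add_norm_sq hw hδ
    have hwN : ∀ x, ‖w x‖ ≤ N x := fun x =>
      Real.le_sqrt_of_sq_le (by nlinarith [sq_nonneg δ])
    have hN0 : ∀ x, 0 ≤ N x := fun x => Real.sqrt_nonneg _
    have hXN : ∀ j, ContDiff ℝ 1 fun x => X j x * N x := fun j =>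
      ((hX j).mul hNs).of_le (by simp)
    have s1 : c * ∫ x, ‖w x‖ ∂(surfaceMeasure Ω) ≤
        ∑ j, ∫ x, (X j x * N x) * exteriorNormal Ω x j ∂(surfaceMeasure Ω) := by
      have hi : ∀ j, Integrable (fun x => (X j x * N x) * exteriorNormal Ω x j)
          (surfaceMeasure Ω) := fun j => integrable_mul_exteriorNormal (q := fun x => x)
        measurable_id (integrable_bdry_of_continuous hbdd (hXN j).continuous) j
      rw [← integral_finsetSum _ fun j _ => hi j, ← integral_const_mul]
      refine integral_mono_ae
        ((integrable_bdry_of_continuous hbdd hw.continuous.norm).const_mul c)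
        (integrable_finsetSum _ fun j _ => hi j) (hXn.mono fun x hx => ?_)
      calc c * ‖w x‖ ≤ (∑ j, X j x * exteriorNormal Ω x j) * N x :=
            mul_le_mul hx (hwN x) (norm_nonneg _) (hc.le.trans hx)
        _ = ∑ j, (X j x * N x) * exteriorNormal Ω x j := by
            rw [Finset.sum_mul]
            exact Finset.sum_congr rfl fun j _ => by ring
    have s2 : ∀ j, ∫ x, (X j x * N x) * exteriorNormal Ω x j ∂(surfaceMeasure Ω)
        ≤ M * V * δ + M * (∫ x in Ω, ‖w x‖) + M * ∫ x in Ω, ‖pderiv j w x‖ := by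
      intro j
      rw [← gauss_green hopen hbdd hlip (hXN j) j]
      have hR : ∫ x in Ω, (M * (δ + ‖w x‖) + M * ‖pderiv j w x‖)
          = M * V * δ + M * (∫ x in Ω, ‖w x‖) + M * ∫ x in Ω, ‖pderiv j w x‖ := by
        have i1 : Integrable (fun x => M * (δ + ‖w x‖)) (volume.restrict Ω) :=
          ((integrable_const δ).add iw).const_mul M
        have i2 : Integrable (fun x => M * ‖pderiv j w x‖) (volume.restrict Ω) :=
          (iwd j).const_mul M
        rw [integral_add i1 i2, integral_const_mul, integral_const_mul,
          integral_add (integrable_const δ) iw, integral_const, smul_eq_mul]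
        simp only [Measure.real, Measure.restrict_apply_univ]
        rw [← hV]; ring
      rw [← hR]
      refine integral_mono_ae
        (integrable_bulk_of_continuous hbdd (continuous_pderiv (hXN j) j))
        ((((integrable_const δ).add iw).const_mul M).add ((iwd j).const_mul M)) ?_
      filter_upwards [ae_restrict_mem hopen.measurableSet] with x hx
      rw [pderiv_mul ((hX j).differentiable (by simp) x) (hNs.differentiable (by simp) x)]
      have t1 : pderiv j (X j) x * N x ≤ M * (δ + ‖w x‖) :=
        mul_le_mul ((le_abs_self _).trans (b2 j x hx))
          (sqrt_add_sq_le hδ.le (norm_nonneg _)) (hN0 x) hM0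
      have t2 : X j x * pderiv j N x ≤ M * ‖pderiv j w x‖ := by
        refine (le_abs_self _).trans ?_
        rw [abs_mul]
        exact mul_le_mul (b1 j x hx) (abs_pderiv_sqrt_le hw hδ j x) (abs_nonneg _) hM0
      exact add_le_add t1 t2
    refine s1.trans ((Finset.sum_le_sum fun j _ => s2 j).trans (le_of_eq ?_))
    rw [Finset.sum_add_distrib, Finset.sum_const, Finset.card_univ, Fintype.card_fin,
      ← Finset.mul_sum, nsmul_eq_mul]
    push_cast
    ring
  have hlim : c * ∫ x, ‖w x‖ ∂(surfaceMeasure Ω) ≤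
      ((k + 1) * M * ∫ x in Ω, ‖w x‖) + M * (∑ j, ∫ x in Ω, ‖pderiv j w x‖) := by
    refine le_of_forall_pos_le_add fun ε hε => ?_
    have h1 := key (ε / ((k + 1) * M * V + 1)) (by positivity)
    refine h1.trans (add_le_add le_rfl ?_)
    rw [← mul_div_assoc, div_le_iff₀ (by positivity)]
    nlinarith [show 0 ≤ (k + 1) * M * V by positivity]
  have hS0 : 0 ≤ ∑ j, ∫ x in Ω, ‖pderiv j w x‖ :=
    Finset.sum_nonneg fun j _ => integral_nonneg fun x => norm_nonneg _
  rw [mul_assoc, ← div_eq_inv_mul, le_div_iff₀' hc]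
  refine hlim.trans ?_
  have : M * (∑ j, ∫ x in Ω, ‖pderiv j w x‖)
      ≤ (k + 1) * M * ∑ j, ∫ x in Ω, ‖pderiv j w x‖ := by
    refine mul_le_mul_of_nonneg_right ?_ hS0
    have : (0 : ℝ) ≤ k := k.cast_nonneg
    nlinarith
  linarith

theorem exists_lintegral_trace_le (hopen : IsOpen Ω) (hbdd : Bornology.IsBounded Ω)
    (hlip : HasLipschitzBoundary Ω) (m : ℕ) : ∃ C : ℝ≥0∞, C ≠ ⊤ ∧ ∀ w : Vec (k + 1) → Vec m,
      ContDiff ℝ ∞ w → ∫⁻ x, ‖w x‖ₑ ∂(surfaceMeasure Ω)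
        ≤ C * ((∫⁻ x in Ω, ‖w x‖ₑ) + ∑ j, ∫⁻ x in Ω, ‖pderiv j w x‖ₑ) := by
  have hfin := isFiniteMeasure_surfaceMeasure hopen hbdd hlip
  obtain ⟨C, hC, H⟩ := exists_trace_le hopen hbdd hlip m
  refine ⟨ENNReal.ofReal C, ENNReal.ofReal_ne_top, fun w hw => ?_⟩
  have h := H w hw
  rw [← ofReal_integral_norm_eq_lintegral_enorm (integrable_bdry_of_continuous hbdd hw.continuous),
    ← ofReal_integral_norm_eq_lintegral_enorm (integrable_bulk_of_continuous hbdd hw.continuous)]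
  have e : ∀ j, ∫⁻ x in Ω, ‖pderiv j w x‖ₑ = ENNReal.ofReal (∫ x in Ω, ‖pderiv j w x‖) :=
    fun j => (ofReal_integral_norm_eq_lintegral_enorm (integrable_bulk_of_continuous hbdd
      (continuous_pderiv (hw.of_le (by simp)) j))).symm
  simp only [e]
  rw [← ENNReal.ofReal_sum_of_nonneg fun j _ => integral_nonneg fun x => norm_nonneg _,
    ← ENNReal.ofReal_add (integral_nonneg fun x => norm_nonneg _)
      (Finset.sum_nonneg fun j _ => integral_nonneg fun x => norm_nonneg _),
    ← ENNReal.ofReal_mul hC]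
  exact ENNReal.ofReal_le_ofReal h

theorem tendsto_integral_smul_of_L1 {X F : Type*} [MeasurableSpace X] [NormedAddCommGroup F]
    [NormedSpace ℝ F] {μ : Measure X} {φ : X → ℝ} {C : ℝ} (hφ : AEStronglyMeasurable φ μ)
    (hb : ∀ᵐ x ∂μ, ‖φ x‖ ≤ C) {f : X → F} {u : ℕ → X → F} (hf : Integrable f μ)
    (hu : ∀ l, Integrable (u l) μ)
    (h : Tendsto (fun l => ∫⁻ x, ‖u l x - f x‖ₑ ∂μ) atTop (𝓝 0)) :
    Tendsto (fun l => ∫ x, φ x • u l x ∂μ) atTop (𝓝 (∫ x, φ x • f x ∂μ)) := by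
  refine tendsto_integral_of_L1 _ (hφ.smul hf.1)
    (Eventually.of_forall fun l => (hu l).bdd_smul C hφ hb) ?_
  have h1 : Tendsto (fun l => ENNReal.ofReal C * ∫⁻ x, ‖u l x - f x‖ₑ ∂μ) atTop (𝓝 0) := by
    simpa using ENNReal.Tendsto.const_mul h (Or.inr ENNReal.ofReal_ne_top)
  refine tendsto_of_tendsto_of_tendsto_of_le_of_le tendsto_const_nhds h1 (fun _ => zero_le)
    fun l => ?_
  simp only
  rw [← lintegral_const_mul' _ _ ENNReal.ofReal_ne_top]
  refine lintegral_mono_ae (hb.mono fun x hx => ?_)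
  change ‖φ x • u l x - φ x • f x‖ₑ ≤ _
  rw [← smul_sub, enorm_smul]
  gcongr
  rw [← ofReal_norm]
  exact ENNReal.ofReal_le_ofReal hx

/-- Pairing with a fixed vector `v` reduces this to the scalar formula for `φ x * inner ℝ v (u x)`.
-/
theorem isGreenTriple_of_contDiff (hopen : IsOpen Ω) (hbdd : Bornology.IsBounded Ω)
    (hlip : HasLipschitzBoundary Ω) {u : Vec (k + 1) → Vec m} (hu : ContDiff ℝ ∞ u) :
    IsGreenTriple Ω u (fun x j => pderiv j u x) u := by
  have hfin := isFiniteMeasure_surfaceMeasure hopen hbdd hlip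
  intro φ hφ j
  have hφd := continuous_pderiv (hφ.of_le (m := 1) (by simp)) j
  have hud := continuous_pderiv (hu.of_le (m := 1) (by simp)) j
  have h1 : Integrable (fun x => pderiv j φ x • u x + φ x • pderiv j u x) (volume.restrict Ω) :=
    integrable_bulk_of_continuous hbdd
      ((hφd.smul hu.continuous).add (hφ.continuous.smul hud))
  have h2 : Integrable (fun x => (φ x * exteriorNormal Ω x j) • u x) (surfaceMeasure Ω) := by
    have : Integrable (fun x => φ x • u x) (surfaceMeasure Ω) :=
      integrable_bdry_of_continuous hbdd (hφ.continuous.smul hu.continuous)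
    refine (this.bdd_smul (φ := fun x => exteriorNormal Ω x j) 1
      (measurable_exteriorNormal_apply Ω j).aestronglyMeasurable
      (ae_of_all _ fun x => abs_exteriorNormal_apply_le Ω x j)).congr (ae_of_all _ fun x => ?_)
    change exteriorNormal Ω x j • (φ x • u x) = _
    rw [smul_smul, mul_comm]
  refine ext_inner_left ℝ fun v => ?_
  rw [← integral_inner h1, ← integral_inner h2]
  have hg : ContDiff ℝ ∞ fun x => inner ℝ v (u x) := contDiff_const.inner ℝ hu
  have := gauss_green hopen hbdd hlip (φ := fun x => φ x * inner ℝ v (u x))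
    ((hφ.mul hg).of_le (by simp)) j
  convert this using 1
  · refine integral_congr_ae (ae_of_all _ fun x => ?_)
    simp only
    rw [pderiv_mul (hφ.differentiable (by simp) x) (hg.differentiable (by simp) x)]
    have : pderiv j (fun x => inner ℝ v (u x)) x = inner ℝ v (pderiv j u x) := by
      have hh : HasFDerivAt (fun x => inner ℝ v (u x)) ((innerSL ℝ v).comp (fderiv ℝ u x)) x :=
        (innerSL ℝ v).hasFDerivAt.comp x (hu.differentiable (by simp) x).hasFDerivAt
      rw [pderiv, pderiv, hh.fderiv]
      simp
    rw [this, inner_add_right, inner_smul_right, inner_smul_right]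
  · refine integral_congr_ae (ae_of_all _ fun x => ?_)
    simp only [inner_smul_right]
    ring

/-- The boundary values in the Gauss-Green formula of a Sobolev function are its trace. -/
theorem IsGreenTriple.isTrace (hopen : IsOpen Ω) (hbdd : Bornology.IsBounded Ω)
    (hlip : HasLipschitzBoundary Ω) {y : Vec (k + 1) → Vec m} {G : Vec (k + 1) → Mat m (k + 1)}
    {t : Vec (k + 1) → Vec m} (h : IsGreenTriple Ω y G t)
    (hy : Integrable y (volume.restrict Ω))
    (hG : ∀ j, Integrable (fun x => G x j) (volume.restrict Ω))
    (ht : Integrable t (surfaceMeasure Ω)) : IsTrace Ω y G t := by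
  have hfin := isFiniteMeasure_surfaceMeasure hopen hbdd hlip
  have hw := h.isWeakDeriv hopen hbdd hy hG
  -- Summable errors, as required by the completeness criterion for `L¹` used for the boundary
  -- values.
  set a : ℕ → ℝ≥0∞ := fun l => (2⁻¹ : ℝ≥0∞) ^ l with ha
  have ha0 : ∀ l, 0 < a l := fun l => ENNReal.pow_pos (by simp) l
  have hatop : ∀ l, a l ≠ ⊤ := fun l => ENNReal.pow_ne_top (by simp)
  have hanti : ∀ {i j}, i ≤ j → a j ≤ a i := fun hij =>
    pow_le_pow_right_of_le_one' (ENNReal.inv_le_one.2 (by norm_num)) hij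
  have hlim : Tendsto a atTop (𝓝 0) :=
    ENNReal.tendsto_pow_atTop_nhds_zero_of_lt_one (by simp [ENNReal.inv_lt_one])
  choose u hus huy huG using fun l => exists_contDiff_approx hopen hbdd hlip hy hG hw (ha0 l)
  have ud : ∀ l j, Continuous (pderiv j (u l)) := fun l j =>
    continuous_pderiv ((hus l).of_le (by simp)) j
  have tail : ∀ {f : ℕ → ℝ≥0∞}, (∀ l, f l ≤ a l) → Tendsto f atTop (𝓝 0) := fun hf =>
    tendsto_of_tendsto_of_tendsto_of_le_of_le tendsto_const_nhds hlim (fun _ => zero_le) hf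
  have t1 : Tendsto (fun l => ∫⁻ x in Ω, ‖u l x - y x‖ₑ) atTop (𝓝 0) := tail huy
  have t2 : ∀ j, Tendsto (fun l => ∫⁻ x in Ω, ‖pderiv j (u l) x - G x j‖ₑ) atTop (𝓝 0) :=
    fun j => tail fun l => huG l j
  have cauchy : ∀ {f : ℕ → Vec (k + 1) → Vec m} {g : Vec (k + 1) → Vec m},
      (∀ l, Continuous (f l)) → Integrable g (volume.restrict Ω) →
      (∀ l, ∫⁻ x in Ω, ‖f l x - g x‖ₑ ≤ a l) → ∀ {N i j : ℕ}, N ≤ i → N ≤ j →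
      ∫⁻ x in Ω, ‖f i x - f j x‖ₑ ≤ 2 * a N := by
    intro f g hf hg hfg N i j hi hj
    calc ∫⁻ x in Ω, ‖f i x - f j x‖ₑ
        ≤ ∫⁻ x in Ω, (‖f i x - g x‖ₑ + ‖f j x - g x‖ₑ) := lintegral_mono fun x => by
          rw [← sub_sub_sub_cancel_right (f i x) (f j x) (g x)]
          exact enorm_sub_le
      _ = (∫⁻ x in Ω, ‖f i x - g x‖ₑ) + ∫⁻ x in Ω, ‖f j x - g x‖ₑ :=
          lintegral_add_left' ((hf i).aestronglyMeasurable.sub hg.1).enorm _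
      _ ≤ a N + a N := add_le_add ((hfg i).trans (hanti hi)) ((hfg j).trans (hanti hj))
      _ = 2 * a N := (two_mul _).symm
  obtain ⟨C, hC, HC⟩ := exists_lintegral_trace_le hopen hbdd hlip m
  -- Two members of the sequence differ by at most `2 a N` in value and in each of the `k + 1`
  -- derivatives. Below, `D + 1` replaces `D` to make the inequality strict.
  set D : ℝ≥0∞ := C * (2 + (k + 1) * 2) with hD
  have hDtop : D ≠ ⊤ := by
    refine ENNReal.mul_ne_top hC (ENNReal.add_ne_top.2 ⟨by simp, ENNReal.mul_ne_top ?_ (by simp)⟩)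
    exact ENNReal.add_ne_top.2 ⟨ENNReal.natCast_ne_top k, by simp⟩
  have hcau : ∀ N i j : ℕ, N ≤ i → N ≤ j →
      eLpNorm (u i - u j) 1 (surfaceMeasure Ω) < (D + 1) * a N := by
    intro N i j hi hj
    rw [eLpNorm_one_eq_lintegral_enorm]
    have h1 := HC (fun x => u i x - u j x) ((hus i).sub (hus j))
    have h2 : ∀ q x, pderiv q (fun x => u i x - u j x) x = pderiv q (u i) x - pderiv q (u j) x := by
      intro q x
      rw [pderiv, fderiv_fun_sub ((hus i).differentiable (by simp) x)
        ((hus j).differentiable (by simp) x)]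
      rfl
    simp only [h2] at h1
    calc ∫⁻ x, ‖(u i - u j) x‖ₑ ∂(surfaceMeasure Ω)
        ≤ C * (2 * a N + ∑ _q : Fin (k + 1), 2 * a N) := h1.trans <| by
          gcongr with q
          · exact cauchy (fun l => (hus l).continuous) hy huy hi hj
          · exact cauchy (fun l => ud l q) (hG q) (fun l => huG l q) hi hj
      _ = D * a N := by
          rw [Finset.sum_const, Finset.card_univ, Fintype.card_fin, nsmul_eq_mul, hD]
          push_cast
          ring
      _ < (D + 1) * a N := by
          rw [add_mul, one_mul]
          exact ENNReal.lt_add_right (ENNReal.mul_ne_top hDtop (hatop N)) (ha0 N).ne'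
  have hsum : ∑' N, (D + 1) * a N ≠ ⊤ := by
    rw [ENNReal.tsum_mul_left]
    refine ENNReal.mul_ne_top (ENNReal.add_ne_top.2 ⟨hDtop, by simp⟩) ?_
    rw [ha, ENNReal.tsum_geometric]
    simp
  have hui : ∀ l, Integrable (u l) (surfaceMeasure Ω) := fun l =>
    integrable_bdry_of_continuous hbdd (hus l).continuous
  obtain ⟨t', ht', hlimt⟩ := Lp.cauchy_complete_eLpNorm le_rfl
    (fun l => memLp_one_iff_integrable.2 (hui l)) hsum hcau
  have ht'i := memLp_one_iff_integrable.1 ht'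
  have t3 : Tendsto (fun l => ∫⁻ x, ‖u l x - t' x‖ₑ ∂(surfaceMeasure Ω)) atTop (𝓝 0) := by
    simpa [eLpNorm_one_eq_lintegral_enorm] using hlimt
  -- The `L¹` limit `t'` of the boundary values is the actual trace. It satisfies the same formula
  -- as `t`, by passage to the limit.
  have hgreen : IsGreenTriple Ω y G t' := by
    intro φ hφ j
    have hφd := continuous_pderiv (hφ.of_le (m := 1) (by simp)) j
    obtain ⟨C₁, hC₁⟩ := hbdd.isCompact_closure.exists_bound_of_continuousOn
      hφ.continuous.continuousOn
    obtain ⟨C₂, hC₂⟩ := hbdd.isCompact_closure.exists_bound_of_continuousOn hφd.continuousOn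
    have hmem : ∀ᵐ x ∂(volume.restrict Ω), x ∈ closure Ω :=
      (ae_restrict_mem hopen.measurableSet).mono fun x hx => subset_closure hx
    have l1 := tendsto_integral_smul_of_L1 hφd.aestronglyMeasurable
      (hmem.mono fun x hx => hC₂ x hx) hy
      (fun l => integrable_bulk_of_continuous hbdd (hus l).continuous) t1
    have l2 := tendsto_integral_smul_of_L1 hφ.continuous.aestronglyMeasurable
      (hmem.mono fun x hx => hC₁ x hx) (hG j)
      (fun l => integrable_bulk_of_continuous hbdd (ud l j)) (t2 j)
    have l3 := tendsto_integral_smul_of_L1 (φ := fun x => φ x * exteriorNormal Ω x j) (C := C₁)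
      (hφ.continuous.measurable.mul (measurable_exteriorNormal_apply Ω j)).aestronglyMeasurable
      ((ae_mem_frontier Ω).mono fun x hx => by
        rw [norm_mul]
        exact (mul_le_of_le_one_right (norm_nonneg _)
          (abs_exteriorNormal_apply_le Ω x j)).trans (hC₁ x (frontier_subset_closure hx)))
      ht'i hui t3
    rw [integral_add (integrable_smul_of_continuous hopen hbdd hφd hy)
      (integrable_smul_of_continuous hopen hbdd hφ.continuous (hG j))]
    refine tendsto_nhds_unique (l1.add l2) (l3.congr fun l => ?_)
    rw [← isGreenTriple_of_contDiff hopen hbdd hlip (hus l) φ hφ j]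
    exact integral_add (integrable_bulk_of_continuous hbdd (hφd.smul (hus l).continuous))
      (integrable_bulk_of_continuous hbdd (hφ.continuous.smul (ud l j)))
  -- Every component of the normal times `t - t'` integrates to zero against all test functions, and
  -- the normal is nonzero almost everywhere.
  have heq : t =ᵐ[surfaceMeasure Ω] t' := by
    have hz : ∀ j, ∀ᵐ x ∂(surfaceMeasure Ω), exteriorNormal Ω x j • (t x - t' x) = 0 := by
      intro j
      have hn : ∀ {s : Vec (k + 1) → Vec m}, Integrable s (surfaceMeasure Ω) →
          Integrable (fun x => exteriorNormal Ω x j • s x) (surfaceMeasure Ω) := fun hs =>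
        hs.bdd_smul 1 (measurable_exteriorNormal_apply Ω j).aestronglyMeasurable
          (ae_of_all _ fun x => abs_exteriorNormal_apply_le Ω x j)
      refine ae_eq_zero_of_integral_contDiff_smul_eq_zero
        (hn (ht.sub ht'i)).locallyIntegrable fun φ hφ hφc => ?_
      obtain ⟨C₁, hC₁⟩ := hφc.exists_bound_of_continuous hφ.continuous
      have hs : ∀ {s : Vec (k + 1) → Vec m}, Integrable s (surfaceMeasure Ω) →
          Integrable (fun x => (φ x * exteriorNormal Ω x j) • s x) (surfaceMeasure Ω) := by
        intro s hs
        simp only [mul_smul]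
        exact (hn hs).bdd_smul C₁ hφ.continuous.aestronglyMeasurable (ae_of_all _ hC₁)
      simp only [smul_smul, smul_sub]
      rw [integral_sub (hs ht) (hs ht'i), ← h φ hφ j, ← hgreen φ hφ j, sub_self]
    filter_upwards [ae_all_iff.2 hz, ae_isExteriorNormal hopen hbdd hlip] with x hx ⟨ν, hν⟩
    by_contra hne
    have h0 : ν = 0 := by
      ext j
      have := (smul_eq_zero.1 (hx j)).resolve_right (sub_ne_zero.2 hne)
      rw [hν.exteriorNormal_eq] at this
      simpa using this
    have := hν.1
    rw [h0] at this
    simp at this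
  refine ⟨ht.1, u, hus, ?_, fun j => ?_, ?_⟩
  · simpa only [eLpNorm_one_eq_lintegral_enorm] using t1
  · simpa only [eLpNorm_one_eq_lintegral_enorm] using t2 j
  · simp only [eLpNorm_one_eq_lintegral_enorm]
    refine t3.congr fun l => lintegral_congr_ae (heq.mono fun x hx => ?_)
    simp only [hx]

end OccMeas

end

/-! ### Feasibility of the conditional means in the convex problem -/

noncomputable section

namespace OccMeas

namespace VarData

variable {k m : ℕ} {I : Type*} {Ω : Set (Vec (k + 1))} {P Q : VarData (k + 1) m I} {p : ℝ≥0∞}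
  {μ : Measure (Vec (k + 1) × Vec m × Mat m (k + 1))} {μb : Measure (Vec (k + 1) × Vec m)}

/-- Zero sets of affine functions and sublevel sets of convex functions are convex. This is where
affinity of the equality constraints is needed: the mean must satisfy them again. -/
theorem IsConvexUnderestimator.convex_admissible (hu : Q.IsConvexUnderestimator P Ω)
    {x : Vec (k + 1)} (hx : x ∈ Ω)
    (hA : ∀ i, ∃ a : Vec m × Mat m (k + 1) →ᵃ[ℝ] ℝ,
      ∀ y ∈ Q.Y, ∀ z ∈ Q.Z, P.A i x y z = a (y, z)) :
    Convex ℝ {q : Vec m × Mat m (k + 1) | q ∈ Q.Y ×ˢ Q.Z ∧ Q.Admissible x q.1 q.2} := by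
  have hYZ : Convex ℝ (Q.Y ×ˢ Q.Z) := hu.convex_Y.prod hu.convex_Z
  intro q hq q' hq' s t hs ht hst
  have hm := hYZ hq.1 hq'.1 hs ht hst
  refine ⟨hm, fun i => ⟨?_, ?_⟩⟩
  · obtain ⟨a, ha⟩ := hA i
    have h1 := (hq.2 i).1
    have h2 := (hq'.2 i).1
    rw [hu.A_eq] at h1 h2 ⊢
    rw [ha _ hq.1.1 _ hq.1.2] at h1
    rw [ha _ hq'.1.1 _ hq'.1.2] at h2
    rw [ha _ hm.1 _ hm.2]
    have := Convex.combo_affine_apply (f := a) (x := q) (y := q') hst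
    change a (s • q + t • q') = 0
    change a q = 0 at h1
    change a q' = 0 at h2
    rw [this, h1, h2]; simp
  · exact ((hu.convex_B i x hx).2 hq.1 hq'.1 hs ht hst).trans
      (add_nonpos (mul_nonpos_of_nonneg_of_nonpos hs (hq.2 i).2)
        (mul_nonpos_of_nonneg_of_nonpos ht (hq'.2 i).2))

theorem IsConvexUnderestimator.convex_admissibleBdry (hu : Q.IsConvexUnderestimator P Ω)
    {x : Vec (k + 1)} (hx : x ∈ frontier Ω)
    (hA : ∀ i, ∃ a : Vec m →ᵃ[ℝ] ℝ, ∀ y ∈ Q.Y, P.Ab i x y = a y) :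
    Convex ℝ {q : Vec m | q ∈ Q.Y ∧ Q.AdmissibleBdry x q} := by
  intro q hq q' hq' s t hs ht hst
  have hm := hu.convex_Y hq.1 hq'.1 hs ht hst
  refine ⟨hm, fun i => ⟨?_, ?_⟩⟩
  · obtain ⟨a, ha⟩ := hA i
    have h1 := (hq.2 i).1
    have h2 := (hq'.2 i).1
    rw [hu.Ab_eq] at h1 h2 ⊢
    rw [ha _ hq.1] at h1
    rw [ha _ hq'.1] at h2
    rw [ha _ hm, Convex.combo_affine_apply hst, h1, h2]; simp
  · exact ((hu.convex_Bb i x hx).2 hq.1 hq'.1 hs ht hst).trans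
      (add_nonpos (mul_nonpos_of_nonneg_of_nonpos hs (hq.2 i).2)
        (mul_nonpos_of_nonneg_of_nonpos ht (hq'.2 i).2))

/-- For affine equality constraints, convex underestimators bound the affine relaxation from
below. -/
theorem classicalValue_le_affRelaxedValue (hopen : IsOpen Ω) (hconn : IsConnected Ω)
    (hbdd : Bornology.IsBounded Ω) (hlip : HasLipschitzBoundary Ω) (hp : 1 ≤ p)
    (hP : P.MeasurableIntegrands Ω) (hQ : Q.MeasurableIntegrands Ω)
    (hu : Q.IsConvexUnderestimator P Ω)
    (hA : ∀ i, ∀ x ∈ Ω, ∃ a : Vec m × Mat m (k + 1) →ᵃ[ℝ] ℝ,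
      ∀ y ∈ Q.Y, ∀ z ∈ Q.Z, P.A i x y z = a (y, z))
    (hAb : ∀ i, ∀ x ∈ frontier Ω, ∃ a : Vec m →ᵃ[ℝ] ℝ, ∀ y ∈ Q.Y, P.Ab i x y = a y) :
    Q.classicalValue Ω p ≤ P.affRelaxedValue Ω p := by
  refine le_iInf fun μ => le_iInf fun μb => le_iInf fun ⟨h, hr⟩ => ?_
  have := h.finite_bulk
  have := h.finite_bdry
  have hfin := isFiniteMeasure_restrict_of_isBounded hbdd
  have hfin' := isFiniteMeasure_surfaceMeasure hopen hbdd hlip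
  have e1 : (volume.restrict Ω).compProd μ.condKernel = μ := by
    conv_rhs => rw [← μ.disintegrate μ.condKernel, h.fst_bulk hr hopen hconn hbdd]
  have e2 : (surfaceMeasure Ω).compProd μb.condKernel = μb := by
    conv_rhs => rw [← μb.disintegrate μb.condKernel, h.fst_bdry hr hopen hconn hbdd hlip]
  have hL : MemLp (fun w : Vec (k + 1) × Vec m × Mat m (k + 1) => w.2) p
      ((volume.restrict Ω).compProd μ.condKernel) := by rw [e1]; exact h.memLp_bulk hr hp
  have hLb : MemLp (fun w : Vec (k + 1) × Vec m => w.2) p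
      ((surfaceMeasure Ω).compProd μb.condKernel) := by rw [e2]; exact h.memLp_bdry hp
  have hint := ae_integrable_of_memLp_snd hp hL
  have hintb := ae_integrable_of_memLp_snd hp hLb
  have hB : MemLp (bulkMean μ) p (volume.restrict Ω) := memLp_barycenter hp hL
  have hBb : MemLp (bdryMean μb) p (surfaceMeasure Ω) := memLp_barycenter hp hLb
  have hG := h.isGreenTriple hr hopen hconn hbdd hlip hp
  have hyI : Integrable (fun x => (bulkMean μ x).1) (volume.restrict Ω) := hB.fst.integrable hp
  have hGI : ∀ j, Integrable (fun x => (bulkMean μ x).2 j) (volume.restrict Ω) :=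
    fun j => (hB.snd.integrable hp).eval j
  have hin : ∀ᵐ x ∂(volume.restrict Ω), x ∈ Ω := ae_restrict_mem hopen.measurableSet
  have hin' := ae_mem_frontier Ω
  have hle : ∀ᵐ w ∂μ, Q.L w.1 w.2.1 w.2.2 ≤ P.L w.1 w.2.1 w.2.2 ∧
      ∀ i, Q.B i w.1 w.2.1 w.2.2 ≤ P.B i w.1 w.2.1 w.2.2 ∧
        Q.C i w.1 w.2.1 w.2.2 ≤ P.C i w.1 w.2.1 w.2.2 :=
    hr.bulk.mono fun w hw => hu.le_bulk _ hw.1.1 _ hw.1.2.1 _ hw.1.2.2 hw.2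
  have hleb : ∀ᵐ w ∂μb, Q.Lb w.1 w.2 ≤ P.Lb w.1 w.2 ∧
      ∀ i, Q.Bb i w.1 w.2 ≤ P.Bb i w.1 w.2 ∧ Q.Cb i w.1 w.2 ≤ P.Cb i w.1 w.2 :=
    hr.bdry.mono fun w hw => hu.le_bdry _ hw.1.1 _ hw.1.2 hw.2
  have hmemQ : ∀ᵐ w ∂μ, w ∈ Q.bulk Ω := hr.bulk.mono fun w hw =>
    ⟨hw.1.1, hu.subset_Y hw.1.2.1, hu.subset_Z hw.1.2.2⟩
  have hmemQb : ∀ᵐ w ∂μb, w ∈ Q.bdry Ω := hr.bdry.mono fun w hw => ⟨hw.1.1, hu.subset_Y hw.1.2⟩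
  -- `μ` is carried by points admissible for `P`, which are admissible for `Q` because `Q.B`
  -- underestimates `P.B` there. Convexity passes this to the means.
  have hadm : ∀ᵐ x ∂(volume.restrict Ω), bulkMean μ x ∈
      {q : Vec m × Mat m (k + 1) | q ∈ Q.Y ×ˢ Q.Z ∧ Q.Admissible x q.1 q.2} := by
    refine ae_barycenter_mem (S := fun x =>
      {q : Vec m × Mat m (k + 1) | q ∈ Q.Y ×ˢ Q.Z ∧ Q.Admissible x q.1 q.2})
      (hin.mono fun x hx => hu.convex_admissible hx fun i => hA i x hx) hint ?_
    rw [e1]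
    filter_upwards [hr.bulk, hmemQ, hle] with w h1 h2 h3
    refine ⟨h2.2, fun i => ⟨?_, ((h3.2 i).1).trans (h1.2 i).2⟩⟩
    rw [hu.A_eq]; exact (h1.2 i).1
  have hadmb : ∀ᵐ x ∂(surfaceMeasure Ω), bdryMean μb x ∈
      {q : Vec m | q ∈ Q.Y ∧ Q.AdmissibleBdry x q} := by
    refine ae_barycenter_mem (S := fun x => {q : Vec m | q ∈ Q.Y ∧ Q.AdmissibleBdry x q})
      (hin'.mono fun x hx => hu.convex_admissibleBdry hx fun i => hAb i x hx) hintb ?_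
    rw [e2]
    filter_upwards [hr.bdry, hmemQb, hleb] with w h1 h2 h3
    refine ⟨h2.2, fun i => ⟨?_, ((h3.2 i).1).trans (h1.2 i).2⟩⟩
    rw [hu.Ab_eq]; exact (h1.2 i).1
  -- Jensen for the convex `f`, then `f ≤ g` almost everywhere. It serves both the cost and the
  -- integral constraints.
  have hJ : ∀ {f g : Vec (k + 1) → Vec m → Mat m (k + 1) → ℝ},
      Measurable ((Q.bulk Ω).domRestrict fun w => f w.1 w.2.1 w.2.2) →
      Measurable ((P.bulk Ω).domRestrict fun w => g w.1 w.2.1 w.2.2) →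
      (∀ x ∈ Ω, ConvexOn ℝ (Q.Y ×ˢ Q.Z) fun q => f x q.1 q.2) →
      (∀ᵐ w ∂μ, f w.1 w.2.1 w.2.2 ≤ g w.1 w.2.1 w.2.2) →
      extIntegral (volume.restrict Ω) (fun x => f x (bulkMean μ x).1 (bulkMean μ x).2) ≤
        extIntegral (μ.restrict {w | w.1 ∈ Ω}) fun w => g w.1 w.2.1 w.2.2 := by
    intro f g hf hg hc hfg
    rw [restrict_fst_mem hr.bulk]
    refine le_trans ?_ (extIntegral_mono_ae (aemeasurable_of_domRestrict hf hmemQ)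
      (aemeasurable_of_domRestrict hg (hr.bulk.mono fun w hw => hw.1)) hfg)
    have := extIntegral_barycenter_le_of_carried (ρ := volume.restrict Ω) (κ := μ.condKernel)
      (U := Ω) (T := Q.Y ×ˢ Q.Z) (hu.convex_Y.prod hu.convex_Z)
      (f := fun x q => f x q.1 q.2) hf hc hint hin (by rw [e1]; exact hmemQ)
    rw [e1] at this
    exact this
  have hJb : ∀ {f g : Vec (k + 1) → Vec m → ℝ},
      Measurable ((Q.bdry Ω).domRestrict fun w => f w.1 w.2) →
      Measurable ((P.bdry Ω).domRestrict fun w => g w.1 w.2) →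
      (∀ x ∈ frontier Ω, ConvexOn ℝ Q.Y (f x)) → (∀ᵐ w ∂μb, f w.1 w.2 ≤ g w.1 w.2) →
      extIntegral (surfaceMeasure Ω) (fun x => f x (bdryMean μb x)) ≤
        extIntegral μb fun w => g w.1 w.2 := by
    intro f g hf hg hc hfg
    refine le_trans ?_ (extIntegral_mono_ae (aemeasurable_of_domRestrict hf hmemQb)
      (aemeasurable_of_domRestrict hg (hr.bdry.mono fun w hw => hw.1)) hfg)
    have := extIntegral_barycenter_le_of_carried (ρ := surfaceMeasure Ω) (κ := μb.condKernel)
      (U := frontier Ω) (T := Q.Y) hu.convex_Y (f := f) hf hc hintb hin'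
      (by rw [e2]; exact hmemQb)
    rw [e2] at this
    exact this
  -- The conditional means form the competitor: the Green formula makes them a Sobolev function with
  -- its trace, and the means of `p`-integrable variables are `p`-integrable.
  refine iInf_le_of_le (fun x => (bulkMean μ x).1) (iInf_le_of_le (fun x => (bulkMean μ x).2)
    (iInf_le_of_le (bdryMean μb) (iInf_le_of_le ⟨⟨hB.fst, hB.snd,
      hG.isWeakDeriv hopen hbdd hyI hGI⟩,
      hG.isTrace hopen hbdd hlip hyI hGI (hBb.integrable hp), hadm.mono fun x hx => hx.1,
      hadmb.mono fun x hx => hx.1, hadm.mono fun x hx => hx.2, hadmb.mono fun x hx => hx.2,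
      fun i => ?_, fun i => ?_⟩ ?_)))
  · exact (hJ (hQ.C i) (hP.C i) (hu.convex_C i) (hle.mono fun w hw => (hw.2 i).2)).trans
      (hr.integral_bulk i)
  · exact (hJb (hQ.Cb i) (hP.Cb i) (hu.convex_Cb i) (hleb.mono fun w hw => (hw.2 i).2)).trans
      (hr.integral_bdry i)
  · exact addTop_le_addTop (hJ hQ.L hP.L hu.convex_L (hle.mono fun w hw => hw.1))
      (hJb hQ.Lb hP.Lb hu.convex_Lb (hleb.mono fun w hw => hw.1))

end VarData

end OccMeas

end

theorem mainTheorem5 {n m : ℕ} {I : Type*} (hn : 0 < n)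
    (Ω : Set (OccMeas.Vec n)) (hopen : IsOpen Ω) (hconn : IsConnected Ω)
    (hbdd : Bornology.IsBounded Ω) (hlip : OccMeas.HasLipschitzBoundary Ω)
    (p : ℝ≥0∞) (hp : 1 ≤ p)
    (P Q : OccMeas.VarData n m I)
    (hP : P.MeasurableIntegrands Ω) (hQ : Q.MeasurableIntegrands Ω)
    (hunder : Q.IsConvexUnderestimator P Ω)
    (hA : ∀ i, ∀ x ∈ Ω, ∃ a : OccMeas.Vec m × OccMeas.Mat m n →ᵃ[ℝ] ℝ,
      ∀ y ∈ Q.Y, ∀ z ∈ Q.Z, P.A i x y z = a (y, z))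
    (hAb : ∀ i, ∀ x ∈ frontier Ω, ∃ a : OccMeas.Vec m →ᵃ[ℝ] ℝ,
      ∀ y ∈ Q.Y, P.Ab i x y = a y) :
    (Q.classicalValue Ω p ≤ P.affRelaxedValue Ω p ∧
      P.affRelaxedValue Ω p ≤ P.relaxedValue Ω p ∧
      P.relaxedValue Ω p ≤ P.classicalValue Ω p) ∧
    (Q.classicalValue Ω p = P.classicalValue Ω p →
      P.affRelaxedValue Ω p = P.classicalValue Ω p ∧
      P.relaxedValue Ω p = P.classicalValue Ω p) := by
  -- The boundary is parametrized by `ℝᵏ` with `k = n - 1`, which may be zero.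
  obtain ⟨k, rfl⟩ : ∃ k, n = k + 1 := ⟨n - 1, by omega⟩
  have h1 := OccMeas.VarData.classicalValue_le_affRelaxedValue hopen hconn hbdd hlip hp hP hQ
    hunder hA hAb
  have h2 := OccMeas.VarData.affRelaxedValue_le_relaxedValue P Ω p
  have h3 := OccMeas.VarData.relaxedValue_le_classicalValue hopen hbdd hlip hp hP
  exact ⟨⟨h1, h2, h3⟩, fun h => ⟨le_antisymm (h2.trans h3) (h.ge.trans h1),
    le_antisymm h3 (h.ge.trans (h1.trans h2))⟩⟩
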